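/- **Theorem 5.5 (Embedding in $(0,T)\times\mathbb R^d$ and $(0,T)\times\mathbb R^d_+$).** Let $d\ge 1$ and $m\ge 0$ be integers, $T>0$, let $\Omega=\mathbb R^d$ or $\Omega=\mathbb R^d_+=\{x\in\mathbb R^d: x_1>0\}$, and put $\Omega_T=(0,T)\times\Omega$. For $p,q\in(0,\infty]$ let $L_{p,q}(\Omega_T)$ be the set of measurable $v$ on $\Omega_T$ with $$\|v\|_{L_{p,q}(\Omega_T)}=\Big(\int_0^T\Big(\int_\Omega |v(t,x)|^p\,dx\Big)^{q/p}dt\Big)^{1/q}<\infty$$ (with essential suprema when $p=\infty$ or $q=\infty$), and let $W^{1,0}_{p,q}(\Omega_T)$ be the set of $u\in L_{p,q}(\Omega_T)$ with weak spatial gradient $Du\in L_{p,q}(\Omega_T)$, with $\|u\|_{W^{1,0}_{p,q}(\Omega_T)}=\|u\|_{L_{p,q}(\Omega_T)}+\|Du\|_{L_{p,q}(\Omega_T)}$. All functions are real-valued, or $\mathbb R^d$-valued in the case of $g$ and $Du$, and $a/\infty=0$. Let $p,q\in[1,\infty]$, $p_0\in[p,\infty]$, $q_0\in[q,\infty]$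 and $p_k,q_k\in(0,\infty]$, $k=1,\dots,m$, satisfy one of the following conditions. (i) $q_0=q$, $\ \frac dp\le 1+\frac d{p_0}$, and it is not the case that $d\ge 2$, $p=d$ and $p_0=\infty$. (The $p_k,q_k$ are arbitrary.) (ii) $q_0>q$ and $$\frac dp+\frac2q\le 1+\frac d{p_0}+\frac2{q_0},$$ where $1<q<q_0<\infty$ in case of equality; moreover, for every $k$, $p_k\in[1,p_0]$, $q_k\in[1,q_0]$ and $$\frac d{p_k}+\frac2{q_k}\le 2+\frac d{p_0}+\frac2{q_0},$$ where in case of equality either $1=q_k<q_0=\infty$ or $1<q_k<q_0<\infty$. Then there is a constant $N$, depending only on $d,p,q,p_0,q_0,p_k,q_k,m,T$, such that the following holds. If $u\in W^{1,0}_{p,q}(\Omega_T)$, $g=(g_1,\dots,g_d)\in (L_{p,q}(\Omega_T))^d$, and $f_k\in L_{p_k,q_k}(\Omega_T)$, $k=1,\dots,m$, are such that each $f_k$ is locally integrable in $\Omega_T$ and $$u_t=D_ig_i+\sum_{k=1}^m f_k\quad\text{in }\Omega_T\text{ in the sense of distributions},$$ then $$\|u\|_{L_{p_0,q_0}(\Omega_T)}\le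 N\Big(\|u\|_{W^{1,0}_{p,q}(\Omega_T)}+\|g\|_{L_{p,q}(\Omega_T)}+\sum_{k=1}^m\|f_k\|_{L_{p_k,q_k}(\Omega_T)}\Big).$$ -/

import Mathlib

open MeasureTheory Set
open scoped ENNReal NNReal

noncomputable section

namespace ParabolicEmbedding

/-- `ℝ^d` with its Euclidean norm and Lebesgue measure. -/
abbrev Space (d : ℕ) : Type := EuclideanSpace ℝ (Fin d)

/-- The half-space `ℝ^d_+ = {x : x₁ > 0}`; the first coordinate has index `0`. -/
def halfSpace (d : ℕ) [NeZero d] : Set (Space d) := {x | 0 < x 0}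

/-- The cylinder `Ω_T = (0,T) × Ω`. -/
def cylinder {d : ℕ} (T : ℝ) (Ω : Set (Space d)) : Set (ℝ × Space d) := Ioo 0 T ×ˢ Ω

/-- The mixed norm of `L_{p,q}(Ω_T)`: the `L_q(0,T)`-norm in `t` of the `L_p(Ω)`-norm in `x`
(a quasi-norm if an exponent is below `1`, an essential supremum if it is `∞`). -/
def mixedNorm {d : ℕ} {F : Type*} [NormedAddCommGroup F] (T : ℝ) (Ω : Set (Space d))
    (p q : ℝ≥0∞) (v : ℝ × Space d → F) : ℝ≥0∞ :=
  eLpNorm (fun t : ℝ => eLpNorm (fun x : Space d => v (t, x)) p (volume.restrict Ω)) q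
    (volume.restrict (Ioo 0 T))

/-- `v ∈ L_{p,q}(Ω_T)`. -/
def MemMixed {d : ℕ} {F : Type*} [NormedAddCommGroup F] (T : ℝ) (Ω : Set (Space d))
    (p q : ℝ≥0∞) (v : ℝ × Space d → F) : Prop :=
  AEStronglyMeasurable v (volume.restrict (cylinder T Ω)) ∧ mixedNorm T Ω p q v < ∞

/-- `φ ∈ C_c^∞(Ω_T)`. -/
structure IsTestFunction {d : ℕ} (T : ℝ) (Ω : Set (Space d)) (φ : ℝ × Space d → ℝ) : Prop where
  smooth : ContDiff ℝ ((⊤ : ℕ∞) : WithTop ℕ∞) φ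
  hasCompactSupport : HasCompactSupport φ
  tsupport_subset : tsupport φ ⊆ cylinder T Ω

/-- The classical time derivative `φ_t`. -/
def timeDeriv {d : ℕ} (φ : ℝ × Space d → ℝ) (z : ℝ × Space d) : ℝ :=
  fderiv ℝ φ z (1, 0)

/-- The classical spatial derivative `D_i φ`. -/
def spaceDeriv {d : ℕ} (i : Fin d) (φ : ℝ × Space d → ℝ) (z : ℝ × Space d) : ℝ :=
  fderiv ℝ φ z (0, EuclideanSpace.single i 1)

/-- `w` is the weak spatial gradient `Du` of `u` in `Ω_T`. -/
structure IsWeakSpatialGradient {d : ℕ} (T : ℝ) (Ω : Set (Space d))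
    (u : ℝ × Space d → ℝ) (w : ℝ × Space d → Space d) : Prop where
  locallyIntegrable : LocallyIntegrableOn u (cylinder T Ω)
  locallyIntegrable_grad : LocallyIntegrableOn w (cylinder T Ω)
  integral_eq : ∀ φ : ℝ × Space d → ℝ, IsTestFunction T Ω φ → ∀ i : Fin d,
    ∫ z in cylinder T Ω, u z * spaceDeriv i φ z = - ∫ z in cylinder T Ω, w z i * φ z

/-- `u ∈ W^{1,0}_{p,q}(Ω_T)`, with weak spatial gradient `Du` (unique up to null sets). -/
structure MemW10 {d : ℕ} (T : ℝ) (Ω : Set (Space d)) (p q : ℝ≥0∞)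
    (u : ℝ × Space d → ℝ) (Du : ℝ × Space d → Space d) : Prop where
  isWeakSpatialGradient : IsWeakSpatialGradient T Ω u Du
  memMixed : MemMixed T Ω p q u
  memMixed_grad : MemMixed T Ω p q Du

/-- `‖u‖_{W^{1,0}_{p,q}(Ω_T)} = ‖u‖_{L_{p,q}(Ω_T)} + ‖Du‖_{L_{p,q}(Ω_T)}`. -/
def normW10 {d : ℕ} (T : ℝ) (Ω : Set (Space d)) (p q : ℝ≥0∞)
    (u : ℝ × Space d → ℝ) (Du : ℝ × Space d → Space d) : ℝ≥0∞ :=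
  mixedNorm T Ω p q u + mixedNorm T Ω p q Du

/-- `u_t = D_i g_i + ∑_k f_k` in `Ω_T` in the sense of distributions. All functions are
locally integrable in `Ω_T`, so that they are distributions there. -/
structure SolvesDistrib {d m : ℕ} (T : ℝ) (Ω : Set (Space d)) (u : ℝ × Space d → ℝ)
    (g : ℝ × Space d → Space d) (f : Fin m → ℝ × Space d → ℝ) : Prop where
  locallyIntegrable : LocallyIntegrableOn u (cylinder T Ω)
  locallyIntegrable_g : LocallyIntegrableOn g (cylinder T Ω)
  locallyIntegrable_f : ∀ k, LocallyIntegrableOn (f k) (cylinder T Ω)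
  integral_eq : ∀ φ : ℝ × Space d → ℝ, IsTestFunction T Ω φ →
    - ∫ z in cylinder T Ω, u z * timeDeriv φ z =
      - (∑ i : Fin d, ∫ z in cylinder T Ω, g z i * spaceDeriv i φ z)
        + ∑ k : Fin m, ∫ z in cylinder T Ω, f k z * φ z

/-- Condition (i), the case `q₀ = q`: `d/p ≤ 1 + d/p₀`, and `(p, p₀) ≠ (d, ∞)` if `d ≥ 2`.
Here `a / ∞ = 0`. -/
def CondEqual (d : ℕ) (p q p₀ q₀ : ℝ≥0∞) : Prop :=
  q₀ = q ∧ (d : ℝ≥0∞) / p ≤ 1 + d / p₀ ∧ ¬ (2 ≤ d ∧ p = d ∧ p₀ = ∞)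

/-- Condition (ii), the case `q₀ > q`. Here `a / ∞ = 0`. -/
structure CondGreater {m : ℕ} (d : ℕ) (p q p₀ q₀ : ℝ≥0∞) (pk qk : Fin m → ℝ≥0∞) : Prop where
  q_lt : q < q₀
  le : (d : ℝ≥0∞) / p + 2 / q ≤ 1 + d / p₀ + 2 / q₀
  borderline : (d : ℝ≥0∞) / p + 2 / q = 1 + d / p₀ + 2 / q₀ → 1 < q ∧ q < q₀ ∧ q₀ < ∞
  pk_mem : ∀ k, pk k ∈ Icc 1 p₀
  qk_mem : ∀ k, qk k ∈ Icc 1 q₀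
  le_k : ∀ k, (d : ℝ≥0∞) / pk k + 2 / qk k ≤ 2 + d / p₀ + 2 / q₀
  borderline_k : ∀ k, (d : ℝ≥0∞) / pk k + 2 / qk k = 2 + d / p₀ + 2 / q₀ →
    (qk k = 1 ∧ q₀ = ∞) ∨ (1 < qk k ∧ qk k < q₀ ∧ q₀ < ∞)

end ParabolicEmbedding

end

open ParabolicEmbedding

/-! The function is recovered from its mollifications `u_l` at parabolic scale `l` (duration `l^2`,
radius `l`), and `u_l` is estimated by integrating its derivative in `l`. The mollifiers are
one-sided: in time they look only to the past (`σ = 1`) or only to the future (`σ = -1`), in space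
only towards larger first coordinate. They therefore stay inside the cylinder for the half-space as
well as for the whole space, and neither extension operators nor boundary terms occur. Each time
direction covers one half of `(0,T)`.

The scale derivative of a mollifier is `-1/l` times a rescaled divergence, `2 ∂_t(t θ) + ∑ D_i(y_i
θ)`. The spatial part is moved onto `Du`. The time part is moved, by the equation, onto `g` and
`f_k`. Hence `|u_l|` at a point is at most a constant times the average of `|u|` at a fixed scale
`L` plus the integral over `0 < s < L` of the averages at scale `s` of `|Du|`, `|g|` and `s |f_k|`.
If the time scale is frozen, the same argument uses `Du` alone and never the equation. These are
`parabolic_pointwise` and `elliptic_pointwise`.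

What remains is a bound for potentials `∫ l^(e-1) (average at scale l) dl`, with `e = 1` for `Du`,
`g` and `e = 2` for `f_k`. Averaging at scale `l` from `L_{a,q}` to `L_{b,r}` costs `l` to the power
`-(d(1/a-1/b)+2(1/q-1/r))` by Young's inequality. If this loss is less than `e`, Minkowski's
inequality suffices. If it equals `e`, the Hardy–Littlewood–Sobolev inequality is applied, in time
for condition (ii) and in space for condition (i). It is proved for families of bounded integrable
kernels by splitting the function at a height depending on the level. Two endpoints are outside its
range: `q_k = 1`, `q_0 = ∞`, where the time kernel integrated over the scales is bounded
(`potential_time_le`), and equality with `p = 1` in condition (i), where Gagliardo's argument with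
integrals along coordinate lines is applied to the mollifications (`exists_mollify_bound_of_lines`).

All bounds are uniform in the final scale. Almost everywhere convergence along a sequence of scales
and Fatou's lemma carry them over to `u`. -/

open Filter Topology

namespace ParabolicEmbedding

/-! ### Norms of `[0, ∞]`-valued functions and Minkowski's integral inequality. -/

section Tools

variable {α β : Type*} [MeasurableSpace α] [MeasurableSpace β]

theorem eLpNorm_ennreal_eq {μ : Measure α} {p : ℝ≥0∞} (hp0 : p ≠ 0) (hp : p ≠ ∞) (f : α → ℝ≥0∞) :
    eLpNorm f p μ = (∫⁻ x, f x ^ p.toReal ∂μ) ^ (1 / p.toReal) := by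
  rw [eLpNorm_eq_lintegral_rpow_enorm_toReal hp0 hp]
  simp

theorem eLpNorm_top_ennreal_eq {μ : Measure α} (f : α → ℝ≥0∞) :
    eLpNorm f ∞ μ = essSup f μ := by
  simp [eLpNormEssSup]

theorem eLpNorm_mono_ennreal {μ : Measure α} {p : ℝ≥0∞} {f g : α → ℝ≥0∞}
    (h : ∀ x, f x ≤ g x) : eLpNorm f p μ ≤ eLpNorm g p μ :=
  eLpNorm_mono_enorm fun x => by simpa using h x

theorem eLpNorm_const_mul_ennreal {μ : Measure α} {p : ℝ≥0∞} {c : ℝ≥0∞}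
    {f : α → ℝ≥0∞} (hf : Measurable f) :
    eLpNorm (fun x => c * f x) p μ = c * eLpNorm f p μ := by
  rcases eq_or_ne p 0 with rfl | hp0
  · simp
  rcases eq_or_ne p ∞ with rfl | hp
  · simp only [eLpNorm_top_ennreal_eq]
    exact ENNReal.essSup_const_mul
  · have h0 := ENNReal.toReal_pos hp0 hp
    simp only [eLpNorm_ennreal_eq hp0 hp, ENNReal.mul_rpow_of_nonneg _ _ h0.le]
    rw [lintegral_const_mul _ (hf.pow_const _), ENNReal.mul_rpow_of_nonneg _ _ (by positivity),
      ← ENNReal.rpow_mul, mul_one_div_cancel h0.ne', ENNReal.rpow_one]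

/-- For `p = ∞`, the essential supremum of a slice exceeds `c` exactly when the slice of `{c < w}`
has positive measure, and the measure of a slice is a measurable function. -/
theorem measurable_eLpNorm_slice {ν : Measure β} [SFinite ν] {w : α × β → ℝ≥0∞}
    (hw : Measurable w) (p : ℝ≥0∞) :
    Measurable fun a => eLpNorm (fun b => w (a, b)) p ν := by
  rcases eq_or_ne p 0 with rfl | hp0
  · simp
  rcases eq_or_ne p ∞ with rfl | hp
  · simp only [eLpNorm_top_ennreal_eq]
    refine measurable_of_Ioi fun c => ?_
    have h1 : (fun a => essSup (fun b => w (a, b)) ν) ⁻¹' Ioi c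
        = (fun a => ν (Prod.mk a ⁻¹' {z | c < w z})) ⁻¹' (Ioi 0) := by
      ext a
      simp only [mem_preimage, mem_Ioi, pos_iff_ne_zero]
      rw [← not_le, ← not_iff_not, not_not, not_not]
      constructor
      · intro h
        have := (ae_le_essSup (f := fun b => w (a, b)) (μ := ν)).mono
          fun b hb => not_lt.2 (hb.trans h)
        simpa [ae_iff] using this
      · intro h
        refine essSup_le_of_ae_le c ?_
        change ∀ᵐ b ∂ν, w (a, b) ≤ c
        rw [ae_iff]
        simpa using h
    rw [h1]
    exact measurable_measure_prodMk_left (measurableSet_lt measurable_const hw) measurableSet_Ioi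
  · simp only [eLpNorm_ennreal_eq hp0 hp]
    exact (Measurable.lintegral_prod_right' (hw.pow_const _)).pow_const _

/-- Minkowski's integral inequality. -/
theorem eLpNorm_lintegral_le {μ : Measure α} {ν : Measure β} [SigmaFinite μ] [SFinite ν]
    {p : ℝ≥0∞} (hp1 : 1 ≤ p) {f : α → β → ℝ≥0∞} (hf : Measurable (Function.uncurry f)) :
    eLpNorm (fun x => ∫⁻ y, f x y ∂ν) p μ ≤ ∫⁻ y, eLpNorm (fun x => f x y) p μ ∂ν := by
  have hp0 : p ≠ 0 := (zero_lt_one.trans_le hp1).ne'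
  have hf' : Measurable fun z : β × α => f z.2 z.1 := hf.comp measurable_swap
  have hN : Measurable fun y => eLpNorm (fun x => f x y) p μ := measurable_eLpNorm_slice hf' p
  rcases eq_or_ne p ∞ with rfl | hp
  · rw [eLpNorm_top_ennreal_eq]
    refine essSup_le_of_ae_le _ ?_
    have hms : MeasurableSet {z : α × β | f z.1 z.2 ≤ eLpNorm (fun x => f x z.2) ∞ μ} :=
      measurableSet_le hf (hN.comp measurable_snd)
    have h1 : ∀ᵐ y ∂ν, ∀ᵐ x ∂μ, f x y ≤ eLpNorm (fun x => f x y) ∞ μ := by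
      refine Eventually.of_forall fun y => ?_
      rw [eLpNorm_top_ennreal_eq]
      exact ae_le_essSup
    have h2 := (Measure.ae_ae_comm (μ := μ) (ν := ν)
      (p := fun x y => f x y ≤ eLpNorm (fun x => f x y) ∞ μ) hms).2 h1
    exact h2.mono fun x hx => lintegral_mono_ae hx
  · set r := p.toReal with hr
    have hr1 : 1 ≤ r := by
      rw [hr, ← ENNReal.toReal_one]; exact ENNReal.toReal_mono hp hp1
    have hr0 : 0 < r := by linarith
    have hF : Measurable fun x => ∫⁻ y, f x y ∂ν := Measurable.lintegral_prod_right' hf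
    rcases hr1.eq_or_lt with hr1' | hr1'
    · have hp1' : p = 1 := by
        rw [← ENNReal.toReal_eq_toReal_iff' hp (by simp)]; simp [← hr, ← hr1']
      subst hp1'
      simp only [eLpNorm_one_eq_lintegral_enorm, enorm_eq_self]
      exact (lintegral_lintegral_swap hf.aemeasurable).le
    set A := ∫⁻ y, eLpNorm (fun x => f x y) p μ ∂ν with hA
    rw [eLpNorm_ennreal_eq hp0 hp, ← hr, one_div, ENNReal.rpow_inv_le_iff hr0]
    have hconj : (r / (r - 1)).HolderConjugate r := by
      rw [Real.holderConjugate_iff]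
      constructor
      · rw [one_lt_div] <;> linarith
      · rw [inv_div]; field_simp; ring
    -- If `G` lies below the `r`-th power and has finite integral `X`, Hölder's inequality in `x`
    -- for each `y` gives `X ≤ X^(1-1/r) A`. Since `X` is finite, the power of `X` cancels.
    have key : ∀ G : α → ℝ≥0∞, Measurable G → (∀ x, G x ≤ (∫⁻ y, f x y ∂ν) ^ r) →
        ∫⁻ x, G x ∂μ ≠ ∞ → ∫⁻ x, G x ∂μ ≤ A ^ r := by
      intro G hG hGF hfin
      have h1 : ∫⁻ x, G x ∂μ ≤ (∫⁻ x, G x ∂μ) ^ (1 - r⁻¹) * A := by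
        calc ∫⁻ x, G x ∂μ ≤ ∫⁻ x, G x ^ (1 - r⁻¹) * ∫⁻ y, f x y ∂ν ∂μ := by
              refine lintegral_mono fun x => ?_
              have e : G x = G x ^ (1 - r⁻¹) * G x ^ r⁻¹ := by
                rw [← ENNReal.rpow_add_of_nonneg _ _ (sub_nonneg.2 (inv_le_one_of_one_le₀ hr1))
                  (by positivity)]
                simp
              conv_lhs => rw [e]
              gcongr
              rw [ENNReal.rpow_inv_le_iff hr0]
              exact hGF x
          _ = ∫⁻ x, ∫⁻ y, G x ^ (1 - r⁻¹) * f x y ∂ν ∂μ := by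
              refine lintegral_congr fun x => ?_
              exact (lintegral_const_mul _ (hf.comp (measurable_prodMk_left (x := x)))).symm
          _ = ∫⁻ y, ∫⁻ x, G x ^ (1 - r⁻¹) * f x y ∂μ ∂ν :=
              lintegral_lintegral_swap
                (((hG.comp measurable_fst).pow_const _).mul hf).aemeasurable
          _ ≤ ∫⁻ y, (∫⁻ x, G x ∂μ) ^ (1 - r⁻¹) * eLpNorm (fun x => f x y) p μ ∂ν := by
              refine lintegral_mono fun y => ?_
              have := ENNReal.lintegral_mul_le_Lp_mul_Lq μ hconj
                (f := fun x => G x ^ (1 - r⁻¹)) (g := fun x => f x y)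
                (hG.pow_const _).aemeasurable (hf.comp measurable_prodMk_right).aemeasurable
              refine this.trans (le_of_eq ?_)
              rw [eLpNorm_ennreal_eq hp0 hp, ← hr]
              congr 1
              have e1 : 1 / (r / (r - 1)) = 1 - r⁻¹ := by field_simp
              have e2 : (1 - r⁻¹) * (r / (r - 1)) = 1 := by
                have : r - 1 ≠ 0 := by linarith
                field_simp
              simp only [← ENNReal.rpow_mul, e1, e2, ENNReal.rpow_one]
          _ = _ := by rw [lintegral_const_mul _ hN]
      set X := ∫⁻ x, G x ∂μ
      rcases eq_or_ne X 0 with h0 | h0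
      · simp [h0]
      have e : X = X ^ (1 - r⁻¹) * X ^ r⁻¹ := by
        rw [← ENNReal.rpow_add_of_nonneg _ _ (sub_nonneg.2 (inv_le_one_of_one_le₀ hr1))
          (by positivity)]
        simp
      have h2 : X ^ (1 - r⁻¹) * X ^ r⁻¹ ≤ X ^ (1 - r⁻¹) * A := by rwa [← e]
      have hne : X ^ (1 - r⁻¹) ≠ 0 := by simp [ENNReal.rpow_eq_zero_iff, h0, hfin]
      have hnt : X ^ (1 - r⁻¹) ≠ ∞ :=
        ENNReal.rpow_ne_top_of_nonneg (sub_nonneg.2 (inv_le_one_of_one_le₀ hr1)) hfin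
      rw [ENNReal.mul_le_mul_iff_right hne hnt, ENNReal.rpow_inv_le_iff hr0] at h2
      exact h2
    have hFr : Measurable fun x => (∫⁻ y, f x y ∂ν) ^ r := hF.pow_const _
    -- The `r`-th power itself may have infinite integral. It is replaced by a simple function below
    -- it, cut off at height `n` and restricted to a set of finite measure, whose integral still
    -- exceeds `A ^ r`.
    by_contra! hlt
    obtain ⟨g, hg, hgl⟩ : ∃ g : SimpleFunc α ℝ≥0∞, (∀ x, g x ≤ (∫⁻ y, f x y ∂ν) ^ r) ∧
        A ^ r < g.lintegral μ := by
      rw [lintegral_def] at hlt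
      obtain ⟨g, hg⟩ := lt_iSup_iff.1 hlt
      obtain ⟨hg1, hg2⟩ := lt_iSup_iff.1 hg
      exact ⟨g, hg1, hg2⟩
    rw [← SimpleFunc.lintegral_eq_lintegral] at hgl
    have hsum : A ^ r < ⨆ n : ℕ, ∫⁻ x in spanningSets μ n, min (g x) n ∂μ := by
      have : ∫⁻ x, g x ∂μ = ⨆ n : ℕ, ∫⁻ x in spanningSets μ n, min (g x) n ∂μ := by
        simp only [← lintegral_indicator (measurableSet_spanningSets μ _)]
        rw [← lintegral_iSup]
        · refine lintegral_congr fun x => ?_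
          apply le_antisymm
          · refine le_of_forall_lt fun c hc => ?_
            obtain ⟨n1, hn1⟩ : ∃ n : ℕ, c < n := ENNReal.exists_nat_gt (ne_top_of_lt hc)
            have hx := mem_spanningSetsIndex μ x
            refine lt_of_lt_of_le ?_ (le_iSup _ (max n1 (spanningSetsIndex μ x)))
            rw [indicator_of_mem (monotone_spanningSets μ (le_max_right _ _) hx)]
            refine lt_min hc (hn1.trans_le ?_)
            exact_mod_cast le_max_left _ _
          · refine iSup_le fun n => ?_
            exact (indicator_le_self _ _ x).trans (min_le_left _ _)
        · intro n
          exact (g.measurable.min measurable_const).indicator (measurableSet_spanningSets μ n)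
        · intro n m hnm x
          refine (indicator_le_indicator_of_subset (monotone_spanningSets μ hnm)
            (fun _ => zero_le) x).trans (indicator_le_indicator ?_)
          gcongr
      rw [← this]; exact hgl
    obtain ⟨n, hn⟩ := lt_iSup_iff.1 hsum
    refine absurd (key ((spanningSets μ n).indicator fun x => min (g x) n)
      ((g.measurable.min measurable_const).indicator (measurableSet_spanningSets μ n))
      (fun x => (indicator_le_self _ _ x).trans ((min_le_left _ _).trans (hg x))) ?_) ?_
    · rw [lintegral_indicator (measurableSet_spanningSets μ n)]
      refine ne_of_lt (lt_of_le_of_lt (lintegral_mono (g := fun _ => (n : ℝ≥0∞))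
        fun x => min_le_right _ _) ?_)
      rw [setLIntegral_const]
      exact ENNReal.mul_lt_top (by simp) (measure_spanningSets_lt_top μ n)
    · rw [lintegral_indicator (measurableSet_spanningSets μ n)]
      exact not_le.2 hn

/-- Log-convexity of `L^p` norms between an exponent and `∞`. -/
theorem eLpNorm_le_of_bound {μ : Measure α} {a b : ℝ≥0∞} (ha : 1 ≤ a) (hab : a ≤ b)
    {F : α → ℝ≥0∞} (hF : Measurable F) {M m B : ℝ≥0∞} (hm0 : m ≠ 0) (hm : m ≠ ∞)
    (h1 : ∀ x, F x ≤ M ^ (a⁻¹.toReal) * m ^ (1 - a⁻¹.toReal) * B)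
    (h2 : eLpNorm F a μ ≤ m * B) :
    eLpNorm F b μ ≤ M ^ (a⁻¹.toReal - b⁻¹.toReal) * m ^ (1 - (a⁻¹.toReal - b⁻¹.toReal)) * B := by
  have ha0 : a ≠ 0 := (zero_lt_one.trans_le ha).ne'
  have hb0 : b ≠ 0 := (zero_lt_one.trans_le (ha.trans hab)).ne'
  rcases eq_or_ne b ∞ with rfl | hb
  · rw [eLpNorm_top_ennreal_eq]
    refine essSup_le_of_ae_le _ (Eventually.of_forall fun x => ?_)
    simpa using h1 x
  have haT : a ≠ ∞ := ne_top_of_le_ne_top hb hab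
  set s := a.toReal
  set r := b.toReal
  have hs : 1 ≤ s := by
    rw [← ENNReal.toReal_one]; exact ENNReal.toReal_mono haT ha
  have hsr : s ≤ r := ENNReal.toReal_mono hb hab
  have hs0 : 0 < s := by linarith
  have hr0 : 0 < r := by linarith
  have e1 : a⁻¹.toReal = s⁻¹ := ENNReal.toReal_inv a
  have e2 : b⁻¹.toReal = r⁻¹ := ENNReal.toReal_inv b
  rw [e1] at h1
  rw [e1, e2]
  have hrs : r⁻¹ ≤ s⁻¹ := inv_anti₀ hs0 hsr
  have hs1 : s⁻¹ ≤ 1 := inv_le_one_of_one_le₀ hs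
  have hri : 0 < r⁻¹ := by positivity
  rw [eLpNorm_ennreal_eq hb0 hb, one_div, ENNReal.rpow_inv_le_iff hr0]
  rw [eLpNorm_ennreal_eq ha0 haT, one_div, ENNReal.rpow_inv_le_iff hs0] at h2
  set S := M ^ s⁻¹ * m ^ (1 - s⁻¹) * B
  -- Of the `r` powers of `F`, `r - s` are bounded by the pointwise bound `S` and the other `s` are
  -- integrated.
  calc ∫⁻ x, F x ^ r ∂μ ≤ ∫⁻ x, S ^ (r - s) * F x ^ s ∂μ := by
        refine lintegral_mono fun x => ?_
        have : F x ^ r = F x ^ (r - s) * F x ^ s := by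
          rw [← ENNReal.rpow_add_of_nonneg _ _ (by linarith) hs0.le]; simp
        rw [this]
        gcongr
        exact h1 x
    _ = S ^ (r - s) * ∫⁻ x, F x ^ s ∂μ := lintegral_const_mul _ (hF.pow_const _)
    _ ≤ S ^ (r - s) * (m * B) ^ s := by gcongr
    _ = _ := by
        have h3 : 0 ≤ r - s := by linarith
        simp only [S, ENNReal.mul_rpow_of_nonneg _ _ h3, ENNReal.mul_rpow_of_nonneg _ _ hs0.le,
          ENNReal.mul_rpow_of_nonneg _ _ hr0.le, ← ENNReal.rpow_mul]
        have h4 : B ^ r = B ^ (r - s) * B ^ s := by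
          rw [← ENNReal.rpow_add_of_nonneg _ _ h3 hs0.le]; simp
        have h5 : m ^ ((1 - (s⁻¹ - r⁻¹)) * r) = m ^ ((1 - s⁻¹) * (r - s)) * m ^ s := by
          rw [← ENNReal.rpow_add _ _ hm0 hm]
          congr 1
          field_simp
          ring
        have h6 : (s⁻¹ - r⁻¹) * r = s⁻¹ * (r - s) := by field_simp
        rw [h4, h5, h6]
        ring

end Tools

/-! ### Convolution with bounded integrable kernels and superposition over scales. -/

section Kernels

set_option linter.unusedSectionVars false

variable {G : Type*} [AddCommGroup G] [MeasurableSpace G] [MeasurableAdd₂ G] [MeasurableNeg G]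
  {μ : Measure G} [SigmaFinite μ] [μ.IsAddLeftInvariant] [μ.IsNegInvariant]

/-- The convolution `w * k` of functions with values in `[0, ∞]`. -/
noncomputable def lconv (μ : Measure G) (w k : G → ℝ≥0∞) (x : G) : ℝ≥0∞ :=
  ∫⁻ y, w (x - y) * k y ∂μ

theorem lconv_comm (w k : G → ℝ≥0∞) (x : G) : lconv μ w k x = lconv μ k w x := by
  unfold lconv
  rw [← lintegral_sub_left_eq_self (μ := μ) (fun y => w (x - y) * k y) x]
  simp [mul_comm]

theorem measurable_lconv_param {γ : Type*} [MeasurableSpace γ] {w : G → ℝ≥0∞} {k : γ → G → ℝ≥0∞}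
    (hw : Measurable w) (hk : Measurable (Function.uncurry k)) :
    Measurable fun z : γ × G => lconv μ w (k z.1) z.2 := by
  have hk' : Measurable fun p : γ × G => k p.1 p.2 := hk
  have h1 : Measurable fun z : (γ × G) × G => z.1.2 - z.2 :=
    (measurable_snd.comp measurable_fst).sub measurable_snd
  have h2 : Measurable fun z : (γ × G) × G => (z.1.1, z.2) :=
    (measurable_fst.comp measurable_fst).prodMk measurable_snd
  exact Measurable.lintegral_prod_right' ((hw.comp h1).mul (hk'.comp h2))

theorem measurable_lconv {w k : G → ℝ≥0∞} (hw : Measurable w) (hk : Measurable k) :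
    Measurable (lconv μ w k) := by
  have := measurable_lconv_param (μ := μ) (γ := Unit) (k := fun _ => k) hw (hk.comp measurable_snd)
  exact this.comp (measurable_const (a := ()) |>.prodMk measurable_id)

/-- Hölder's inequality for the measure with density `k`, of mass at most `m`, produces the power of
`m`. The bound `k ≤ M` then compares the `L^a` norm for this measure with that for `μ`. -/
theorem lconv_le_eLpNorm {w k : G → ℝ≥0∞} (hw : Measurable w) (hk : Measurable k)
    {a M m : ℝ≥0∞} (ha : 1 ≤ a) (hM0 : M ≠ 0) (hM : ∀ y, k y ≤ M) (hm : ∫⁻ y, k y ∂μ ≤ m) (x : G) :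
    lconv μ w k x ≤ M ^ (a⁻¹.toReal) * m ^ (1 - a⁻¹.toReal) * eLpNorm w a μ := by
  have hwx : Measurable fun y => w (x - y) := hw.comp (measurable_const.sub measurable_id)
  have hs1 : 0 ≤ 1 - a⁻¹.toReal := by
    have : a⁻¹.toReal ≤ 1 := by
      rw [← ENNReal.toReal_one]
      exact ENNReal.toReal_mono (by simp) (ENNReal.inv_le_one.2 ha)
    linarith
  calc lconv μ w k x = eLpNorm (fun y => w (x - y)) 1 (μ.withDensity k) := by
        rw [eLpNorm_one_eq_lintegral_enorm, lintegral_withDensity_eq_lintegral_mul _ hk (by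
          simpa using hwx)]
        simp [lconv, mul_comm]
    _ ≤ eLpNorm (fun y => w (x - y)) a (μ.withDensity k)
          * (μ.withDensity k) univ ^ (1 / (1 : ℝ≥0∞).toReal - 1 / a.toReal) :=
        eLpNorm_le_eLpNorm_mul_rpow_measure_univ ha hwx.aestronglyMeasurable
    _ ≤ (M ^ (a⁻¹.toReal) * eLpNorm w a μ) * m ^ (1 - a⁻¹.toReal) := by
        gcongr
        · have h1 : μ.withDensity k ≤ M • μ := by
            rw [← withDensity_const]
            exact withDensity_mono (Eventually.of_forall hM)
          refine (eLpNorm_mono_measure _ h1).trans ?_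
          rw [eLpNorm_smul_measure_of_ne_zero hM0, one_div, smul_eq_mul]
          gcongr
          exact (eLpNorm_comp_measurePreserving hw.aestronglyMeasurable
            (Measure.measurePreserving_sub_left μ x)).le
        · rw [ENNReal.toReal_one, div_one, one_div, ← ENNReal.toReal_inv]
          gcongr
          rwa [withDensity_apply _ MeasurableSet.univ, Measure.restrict_univ]
    _ = _ := by ring

theorem eLpNorm_comp_sub_right {w : G → ℝ≥0∞} (a : ℝ≥0∞) (hw : Measurable w) (y : G) :
    eLpNorm (fun x => w (x - y)) a μ = eLpNorm w a μ := by
  exact eLpNorm_comp_measurePreserving hw.aestronglyMeasurable (measurePreserving_sub_right μ y)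

/-- A convolution is a superposition of translates, so Minkowski's inequality and translation
invariance suffice. -/
theorem eLpNorm_lconv_le_self {w k : G → ℝ≥0∞} (hw : Measurable w) (hk : Measurable k)
    {a m : ℝ≥0∞} (ha : 1 ≤ a) (hm : ∫⁻ y, k y ∂μ ≤ m) :
    eLpNorm (lconv μ w k) a μ ≤ m * eLpNorm w a μ := by
  unfold lconv
  refine (eLpNorm_lintegral_le ha ?_).trans ?_
  · exact (hw.comp (measurable_fst.sub measurable_snd)).mul (hk.comp measurable_snd)
  · have h1 : ∀ y, eLpNorm (fun x => w (x - y) * k y) a μ = k y * eLpNorm w a μ := fun y => by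
      simp only [mul_comm _ (k y)]
      rw [eLpNorm_const_mul_ennreal (f := fun x => w (x - y)) (hw.comp (measurable_id.sub_const y)),
        eLpNorm_comp_sub_right a hw]
    simp only [h1]
    rw [lintegral_mul_const _ hk]
    gcongr

/-- Young's inequality for bounded integrable kernels. -/
theorem eLpNorm_lconv_le {w k : G → ℝ≥0∞} (hw : Measurable w) (hk : Measurable k)
    {a b M m : ℝ≥0∞} (ha : 1 ≤ a) (hab : a ≤ b) (hM0 : M ≠ 0) (hm0 : m ≠ 0) (hmt : m ≠ ∞)
    (hM : ∀ y, k y ≤ M) (hm : ∫⁻ y, k y ∂μ ≤ m) :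
    eLpNorm (lconv μ w k) b μ
      ≤ M ^ (a⁻¹.toReal - b⁻¹.toReal) * m ^ (1 - (a⁻¹.toReal - b⁻¹.toReal)) * eLpNorm w a μ :=
  eLpNorm_le_of_bound ha hab (measurable_lconv hw hk) hm0 hmt
    (fun x => lconv_le_eLpNorm hw hk ha hM0 hM hm x) (eLpNorm_lconv_le_self hw hk ha hm)

/-- A family of kernels of homogeneous dimension `D`. -/
structure IsKernelFamily (μ : Measure G) (D C : ℝ) (k : ℝ → G → ℝ≥0∞) : Prop where
  pos : 0 < C
  measurable : Measurable (Function.uncurry k)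
  le : ∀ l, 0 < l → ∀ y, k l y ≤ ENNReal.ofReal (C * l ^ (-D))
  lintegral_le : ∀ l, 0 < l → ∫⁻ y, k l y ∂μ ≤ ENNReal.ofReal C

variable {D C : ℝ} {k : ℝ → G → ℝ≥0∞}

theorem IsKernelFamily.measurable_apply (hk : IsKernelFamily μ D C k) (l : ℝ) :
    Measurable (k l) := hk.measurable.comp measurable_prodMk_left

theorem inv_toReal_le_one {a : ℝ≥0∞} (ha : 1 ≤ a) : a⁻¹.toReal ≤ 1 := by
  rw [← ENNReal.toReal_one]
  exact ENNReal.toReal_mono (by simp) (ENNReal.inv_le_one.2 ha)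

theorem inv_toReal_anti {a b : ℝ≥0∞} (ha : 1 ≤ a) (hab : a ≤ b) : b⁻¹.toReal ≤ a⁻¹.toReal :=
  ENNReal.toReal_mono (by simpa using (zero_lt_one.trans_le ha).ne') (ENNReal.inv_le_inv.2 hab)

theorem ofReal_kernel_const {l δ : ℝ} (hC : 0 < C) (hl : 0 < l) (hδ : 0 ≤ δ) (hδ1 : δ ≤ 1) :
    ENNReal.ofReal (C * l ^ (-D)) ^ δ * ENNReal.ofReal C ^ (1 - δ)
      = ENNReal.ofReal (C * l ^ (-(D * δ))) := by
  have := Real.rpow_pos_of_pos hl (-D)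
  rw [ENNReal.ofReal_rpow_of_nonneg (by positivity) hδ,
    ENNReal.ofReal_rpow_of_nonneg hC.le (by linarith), ← ENNReal.ofReal_mul (by positivity),
    Real.mul_rpow hC.le this.le, ← Real.rpow_mul hl.le, mul_right_comm, ← Real.rpow_add hC]
  simp

theorem IsKernelFamily.eLpNorm_lconv_le (hk : IsKernelFamily μ D C k) {a b : ℝ≥0∞} (ha : 1 ≤ a)
    (hab : a ≤ b) {w : G → ℝ≥0∞} (hw : Measurable w) {l : ℝ} (hl : 0 < l) :
    eLpNorm (lconv μ w (k l)) b μ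
      ≤ ENNReal.ofReal (C * l ^ (-(D * (a⁻¹.toReal - b⁻¹.toReal)))) * eLpNorm w a μ := by
  have h1 := hk.pos
  have := Real.rpow_pos_of_pos hl (-D)
  rw [← ofReal_kernel_const hk.pos hl]
  · exact ParabolicEmbedding.eLpNorm_lconv_le hw (hk.measurable_apply l) ha hab
      (by simpa using by positivity) (by simpa using hk.pos) (by simp) (hk.le l hl)
      (hk.lintegral_le l hl)
  · linarith [inv_toReal_anti ha hab]
  · have := inv_toReal_le_one ha
    have := ENNReal.toReal_nonneg (a := b⁻¹)
    linarith

/-- The superposition `∫_0^L l^(e-1) (w * k_l) dl`. -/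
noncomputable def potential (μ : Measure G) (k : ℝ → G → ℝ≥0∞) (e : ℝ) (S : Set ℝ)
    (w : G → ℝ≥0∞) (x : G) : ℝ≥0∞ :=
  ∫⁻ l in S, ENNReal.ofReal (l ^ (e - 1)) * lconv μ w (k l) x

theorem measurable_potential_integrand (hk : Measurable (Function.uncurry k)) {w : G → ℝ≥0∞}
    (hw : Measurable w) (e : ℝ) :
    Measurable fun z : G × ℝ => ENNReal.ofReal (z.2 ^ (e - 1)) * lconv μ w (k z.2) z.1 := by
  refine Measurable.mul (by fun_prop) ?_
  exact (measurable_lconv_param hw hk).comp measurable_swap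

theorem measurable_potential (hk : Measurable (Function.uncurry k)) {w : G → ℝ≥0∞}
    (hw : Measurable w) (e : ℝ) (S : Set ℝ) : Measurable (potential μ k e S w) :=
  Measurable.lintegral_prod_right' (measurable_potential_integrand hk hw e)

theorem lintegral_Ioo_rpow_ne_top {e L : ℝ} (he : 0 < e) (hL : 0 ≤ L) :
    ∫⁻ l in Ioo 0 L, ENNReal.ofReal (l ^ (e - 1)) ≠ ∞ := by
  have h1 : IntervalIntegrable (fun l : ℝ => l ^ (e - 1)) volume 0 L :=
    intervalIntegral.intervalIntegrable_rpow' (by linarith)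
  have h2 : IntegrableOn (fun l : ℝ => l ^ (e - 1)) (Ioo 0 L) :=
    ((intervalIntegrable_iff_integrableOn_Ioc_of_le hL).1 h1).mono_set Ioo_subset_Ioc_self
  exact h2.lintegral_lt_top.ne

/-- Minkowski's inequality in `l` and Young's inequality at each scale leave the integral of
`l^(e-δ-1)` over `(0, L)`, which converges because the loss `δ` is strictly less than `e`. -/
theorem IsKernelFamily.eLpNorm_potential_le_of_lt (hk : IsKernelFamily μ D C k) {a b : ℝ≥0∞}
    (ha : 1 ≤ a) (hab : a ≤ b) {e : ℝ} (he : D * (a⁻¹.toReal - b⁻¹.toReal) < e) {L : ℝ}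
    (hL : 0 < L) : ∃ N : ℝ≥0, ∀ w : G → ℝ≥0∞, Measurable w →
      eLpNorm (potential μ k e (Ioo 0 L) w) b μ ≤ N * eLpNorm w a μ := by
  set δ := D * (a⁻¹.toReal - b⁻¹.toReal) with hδ
  have hfin := lintegral_Ioo_rpow_ne_top (e := e - δ) (by linarith) hL.le
  refine ⟨(ENNReal.ofReal C * ∫⁻ l in Ioo 0 L, ENNReal.ofReal (l ^ (e - δ - 1))).toNNReal,
    fun w hw => ?_⟩
  rw [ENNReal.coe_toNNReal (ENNReal.mul_ne_top (by simp) hfin)]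
  unfold potential
  refine (eLpNorm_lintegral_le (ha.trans hab) (measurable_potential_integrand hk.measurable hw e)).trans ?_
  calc ∫⁻ l in Ioo 0 L, eLpNorm (fun x => ENNReal.ofReal (l ^ (e - 1)) * lconv μ w (k l) x) b μ
      ≤ ∫⁻ l in Ioo 0 L, ENNReal.ofReal C * ENNReal.ofReal (l ^ (e - δ - 1)) * eLpNorm w a μ := by
        refine setLIntegral_mono (by fun_prop) fun l hl => ?_
        rw [eLpNorm_const_mul_ennreal (measurable_lconv hw (hk.measurable_apply l))]
        refine (mul_le_mul_right (hk.eLpNorm_lconv_le ha hab hw hl.1) _).trans (le_of_eq ?_)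
        rw [← mul_assoc, ← ENNReal.ofReal_mul (by have := hl.1; positivity),
          ← ENNReal.ofReal_mul hk.pos.le, ← hδ]
        congr 2
        rw [mul_left_comm, ← Real.rpow_add hl.1]
        ring_nf
    _ = _ := by
        rw [lintegral_mul_const _ (by fun_prop), lintegral_const_mul _ (by fun_prop)]

end Kernels

/-! ### The Hardy–Littlewood–Sobolev inequality for kernel families. -/

section HLS

set_option linter.unusedSectionVars false

variable {G : Type*} [AddCommGroup G] [MeasurableSpace G] [MeasurableAdd₂ G] [MeasurableNeg G]
  {μ : Measure G} [SigmaFinite μ] [μ.IsAddLeftInvariant] [μ.IsNegInvariant]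
  {D C : ℝ} {k : ℝ → G → ℝ≥0∞}

theorem lintegral_Ioc_rpow {e L : ℝ} (he : 0 < e) (hL : 0 ≤ L) :
    ∫⁻ l in Ioc 0 L, ENNReal.ofReal (l ^ (e - 1)) = ENNReal.ofReal (L ^ e / e) := by
  have h1 : IntervalIntegrable (fun l : ℝ => l ^ (e - 1)) volume 0 L :=
    intervalIntegral.intervalIntegrable_rpow' (by linarith)
  have h2 := (intervalIntegrable_iff_integrableOn_Ioc_of_le hL).1 h1
  rw [← ofReal_integral_eq_lintegral_ofReal h2, ← intervalIntegral.integral_of_le hL,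
    integral_rpow (Or.inl (by linarith))]
  · simp [he.ne']
  · filter_upwards [ae_restrict_mem measurableSet_Ioc] with l hl
    exact Real.rpow_nonneg hl.1.le _

theorem lintegral_Ioi_rpow {e L : ℝ} (he : e < 0) (hL : 0 < L) :
    ∫⁻ l in Ioi L, ENNReal.ofReal (l ^ (e - 1)) = ENNReal.ofReal (L ^ e / -e) := by
  have h2 : IntegrableOn (fun l : ℝ => l ^ (e - 1)) (Ioi L) :=
    integrableOn_Ioi_rpow_of_lt (by linarith) hL
  rw [← ofReal_integral_eq_lintegral_ofReal h2, integral_Ioi_rpow_of_lt (by linarith) hL]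
  · congr 1
    rw [sub_add_cancel, neg_div, div_neg]
  · filter_upwards [ae_restrict_mem measurableSet_Ioi] with l hl
    exact Real.rpow_nonneg (hL.trans hl).le _

/-- The layer-cake formula. Comparing with finite numbers below `z` includes the value `z = ∞`. -/
theorem rpow_le_lintegral_level {r : ℝ} (hr : 0 < r) (z : ℝ≥0∞) :
    z ^ r ≤ ENNReal.ofReal r *
      ∫⁻ η in Ioi (0 : ℝ), {η | ENNReal.ofReal η < z}.indicator
        (fun η => ENNReal.ofReal (η ^ (r - 1))) η := by
  rw [← ENNReal.le_rpow_inv_iff hr]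
  refine le_of_forall_lt fun c hc => ?_
  obtain ⟨c', hcc', hc'⟩ := exists_between hc
  refine hcc'.trans_le ?_
  rw [ENNReal.le_rpow_inv_iff hr]
  have hc't : c' ≠ ∞ := ne_top_of_lt hc'
  set v := c'.toReal
  have hv : c' = ENNReal.ofReal v := (ENNReal.ofReal_toReal hc't).symm
  have hv0 : 0 ≤ v := ENNReal.toReal_nonneg
  calc c' ^ r = ENNReal.ofReal r * ENNReal.ofReal (v ^ r / r) := by
        rw [← ENNReal.ofReal_mul hr.le, mul_div_cancel₀ _ hr.ne', hv,
          ENNReal.ofReal_rpow_of_nonneg hv0 hr.le]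
    _ = ENNReal.ofReal r * ∫⁻ η in Ioc 0 v, ENNReal.ofReal (η ^ (r - 1)) := by
        rw [lintegral_Ioc_rpow hr hv0]
    _ = ENNReal.ofReal r * ∫⁻ η in Ioc 0 v, {η | ENNReal.ofReal η < z}.indicator
        (fun η => ENNReal.ofReal (η ^ (r - 1))) η := by
        congr 1
        refine setLIntegral_congr_fun measurableSet_Ioc fun η hη => ?_
        rw [indicator_of_mem]
        refine lt_of_le_of_lt ?_ hc'
        rw [hv]
        exact ENNReal.ofReal_le_ofReal hη.2
    _ ≤ _ := by gcongr; exact Ioc_subset_Ioi_self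

/-- This is the inner integral over levels that arises when the bound of `measure_potential_gt_le`
is put into the layer-cake formula. It converges at zero because `r/s < r`, and the indicator stops
it at `η = (z/c)^(s/r)`, whence the power `s - 1`. One more factor `z` then yields `z ^ s`. -/
theorem lintegral_level_le {r s c : ℝ} (hs : 1 < s) (hr : 0 < r) (hc : 0 < c) (z : ℝ≥0∞) :
    ∫⁻ η in Ioi (0 : ℝ), {η | ENNReal.ofReal (c * η ^ (r / s)) < z}.indicator
        (fun η => ENNReal.ofReal (η ^ (r - 1) * (2 * (c * η ^ (r / s)))⁻¹)) η
      ≤ ENNReal.ofReal ((c ^ s)⁻¹ / (2 * (r - r / s))) * z ^ (s - 1) := by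
  have hs0 : 0 < s := by linarith
  have he : 0 < r - r / s := by
    have : r / s < r := div_lt_self hr hs
    linarith
  rcases eq_or_ne z ∞ with rfl | hz
  · rw [ENNReal.top_rpow_of_pos (by linarith), ENNReal.mul_top]
    · exact le_top
    · simpa using by positivity
  set v := z.toReal
  have hv : z = ENNReal.ofReal v := (ENNReal.ofReal_toReal hz).symm
  have hv0 : 0 ≤ v := ENNReal.toReal_nonneg
  set X := (v / c) ^ (s / r)
  have hX : 0 ≤ X := by positivity
  calc ∫⁻ η in Ioi (0 : ℝ), {η | ENNReal.ofReal (c * η ^ (r / s)) < z}.indicator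
        (fun η => ENNReal.ofReal (η ^ (r - 1) * (2 * (c * η ^ (r / s)))⁻¹)) η
      ≤ ∫⁻ η in Ioi (0 : ℝ), (Ioc 0 X).indicator
        (fun η => ENNReal.ofReal (2 * c)⁻¹ * ENNReal.ofReal (η ^ (r - r / s - 1))) η := by
        refine setLIntegral_mono' measurableSet_Ioi fun η (hη : 0 < η) => ?_
        by_cases h : ENNReal.ofReal (c * η ^ (r / s)) < z
        · rw [indicator_of_mem (by exact h), indicator_of_mem, ← ENNReal.ofReal_mul (by positivity)]
          · refine le_of_eq ?_
            congr 1
            rw [← mul_assoc, mul_inv, ← Real.rpow_neg hη.le, mul_left_comm, ← Real.rpow_add hη]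
            ring_nf
          · refine ⟨hη, ?_⟩
            rw [hv, ENNReal.ofReal_lt_ofReal_iff_of_nonneg (by positivity)] at h
            have h1 : η ^ (r / s) ≤ v / c := by
              rw [le_div_iff₀ hc]; linarith
            have h2 := Real.rpow_le_rpow (by positivity) h1 (by positivity : 0 ≤ s / r)
            rw [← Real.rpow_mul hη.le] at h2
            have h3 : r / s * (s / r) = 1 := by field_simp
            rwa [h3, Real.rpow_one] at h2
        · rw [indicator_of_notMem (by exact h)]
          exact zero_le
    _ = ∫⁻ η in Ioc 0 X, ENNReal.ofReal (2 * c)⁻¹ * ENNReal.ofReal (η ^ (r - r / s - 1)) := by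
        rw [lintegral_indicator measurableSet_Ioc, Measure.restrict_restrict measurableSet_Ioc,
          inter_eq_left.2 Ioc_subset_Ioi_self]
    _ = _ := by
        rw [lintegral_const_mul _ (by fun_prop), lintegral_Ioc_rpow he hX, hv,
          ENNReal.ofReal_rpow_of_nonneg hv0 (by linarith), ← ENNReal.ofReal_mul (by positivity),
          ← ENNReal.ofReal_mul (by positivity)]
        congr 1
        have h1 : X ^ (r - r / s) = v ^ (s - 1) * (c ^ s)⁻¹ * c := by
          rw [← Real.rpow_mul (by positivity)]
          have : s / r * (r - r / s) = s - 1 := by field_simp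
          rw [this, Real.div_rpow hv0 hc.le, Real.rpow_sub_one hc.ne']
          field_simp
        rw [h1]
        field_simp

variable (hk : IsKernelFamily μ D C k)
include hk

/-- At scale `l` the convolution is at most `C l^(-D/s)` times the `L^s` norm, which is integrable
against `l^(e-1)` at infinity when `e < D/s`. -/
theorem IsKernelFamily.potential_tail_le {s : ℝ} (hs : 1 ≤ s) {e : ℝ}
    (he : e < D / s) {w : G → ℝ≥0∞} (hw : Measurable w)
    {L : ℝ} (hL : 0 < L) (x : G) :
    potential μ k e (Ioi L) w x
      ≤ ENNReal.ofReal (C * (L ^ (e - D / s) / (D / s - e)))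
        * eLpNorm w (ENNReal.ofReal s) μ := by
  have hs0 : 0 < s := by linarith
  have ha : 1 ≤ ENNReal.ofReal s := by simpa using hs
  have hinv : (ENNReal.ofReal s)⁻¹.toReal = s⁻¹ := by
    rw [ENNReal.toReal_inv, ENNReal.toReal_ofReal hs0.le]
  have hC := hk.pos
  calc potential μ k e (Ioi L) w x
      ≤ ∫⁻ l in Ioi L, (ENNReal.ofReal C * ENNReal.ofReal (l ^ (e - D / s - 1)))
          * eLpNorm w (ENNReal.ofReal s) μ := by
        refine setLIntegral_mono' measurableSet_Ioi fun l (hl : L < l) => ?_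
        have hl0 : 0 < l := hL.trans hl
        have h1 := lconv_le_eLpNorm (μ := μ) hw (hk.measurable_apply l) ha
          (by have := Real.rpow_pos_of_pos hl0 (-D); simpa using by positivity)
          (hk.le l hl0) (hk.lintegral_le l hl0) x
        rw [hinv, ofReal_kernel_const hC hl0 (by positivity) (inv_le_one_of_one_le₀ hs)] at h1
        refine (mul_le_mul_right h1 _).trans (le_of_eq ?_)
        rw [← mul_assoc, ← ENNReal.ofReal_mul (by positivity), ← ENNReal.ofReal_mul hC.le]
        congr 2
        rw [mul_left_comm, ← Real.rpow_add hl0]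
        congr 2
        ring
    _ = _ := by
        rw [lintegral_mul_const _ (by fun_prop), lintegral_const_mul _ (by fun_prop),
          lintegral_Ioi_rpow (by linarith) hL, ← ENNReal.ofReal_mul hC.le, neg_sub]

theorem IsKernelFamily.potential_head_le {e : ℝ} (he : 0 < e) {w : G → ℝ≥0∞} {m : ℝ} (hm : 0 ≤ m)
    (hwm : ∀ x, w x ≤ ENNReal.ofReal m) {L : ℝ} (hL : 0 < L) (x : G) :
    potential μ k e (Ioc 0 L) w x ≤ ENNReal.ofReal (m * (C * (L ^ e / e))) := by
  have hC := hk.pos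
  calc potential μ k e (Ioc 0 L) w x
      ≤ ∫⁻ l in Ioc 0 L, ENNReal.ofReal (l ^ (e - 1)) * (ENNReal.ofReal m * ENNReal.ofReal C) := by
        refine setLIntegral_mono' measurableSet_Ioc fun l hl => ?_
        gcongr
        refine (lintegral_mono fun y => mul_le_mul_left (hwm _) _).trans ?_
        rw [lintegral_const_mul _ (hk.measurable_apply l)]
        gcongr
        exact hk.lintegral_le l hl.1
    _ = _ := by
        rw [lintegral_mul_const _ (by fun_prop), lintegral_Ioc_rpow he hL.le,
          ← ENNReal.ofReal_mul hm, ← ENNReal.ofReal_mul (by positivity)]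
        ring_nf

theorem IsKernelFamily.lintegral_potential_head_le {e : ℝ} (he : 0 < e) {w : G → ℝ≥0∞}
    (hw : Measurable w) {L : ℝ} (hL : 0 < L) :
    ∫⁻ x, potential μ k e (Ioc 0 L) w x ∂μ
      ≤ ENNReal.ofReal (C * (L ^ e / e)) * ∫⁻ x, w x ∂μ := by
  have hC := hk.pos
  have h1 := measurable_potential_integrand (μ := μ) hk.measurable hw e
  unfold potential
  rw [lintegral_lintegral_swap h1.aemeasurable]
  calc _ ≤ ∫⁻ l in Ioc 0 L, ENNReal.ofReal (l ^ (e - 1)) * (ENNReal.ofReal C * ∫⁻ x, w x ∂μ) := by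
        refine setLIntegral_mono' measurableSet_Ioc fun l hl => ?_
        rw [lintegral_const_mul _ (measurable_lconv hw (hk.measurable_apply l))]
        gcongr
        have := eLpNorm_lconv_le_self (μ := μ) hw (hk.measurable_apply l) le_rfl
          (hk.lintegral_le l hl.1)
        simpa [eLpNorm_one_eq_lintegral_enorm] using this
    _ = _ := by
        rw [lintegral_mul_const _ (by fun_prop), lintegral_Ioc_rpow he hL.le,
          ENNReal.ofReal_mul hC.le]
        ring

theorem IsKernelFamily.potential_add {e : ℝ} {S : Set ℝ} {v w : G → ℝ≥0∞} (hv : Measurable v)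
    (x : G) :
    potential μ k e S (fun y => v y + w y) x = potential μ k e S v x + potential μ k e S w x := by
  unfold potential
  have hm : Measurable fun l => ENNReal.ofReal (l ^ (e - 1)) * lconv μ v (k l) x :=
    (measurable_potential_integrand hk.measurable hv e).comp (measurable_prodMk_left (x := x))
  rw [← lintegral_add_left hm]
  refine lintegral_congr fun l => ?_
  rw [← mul_add]
  congr 1
  unfold lconv
  rw [← lintegral_add_left]
  · simp [add_mul]
  · exact (hv.comp (measurable_const.sub measurable_id)).mul (hk.measurable_apply l)

/-- Scales above `ρ` contribute at most `η/4` by the norm bound; scales below `ρ` applied to the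
part of `w` below height `m` contribute at most `η/4` by the mass bound. Where the potential exceeds
`η`, the small scales applied to the high part of `w` must therefore contribute at least `η/2`, and
Chebyshev's inequality in `L¹` applies. -/
theorem IsKernelFamily.measure_potential_gt_le {s r : ℝ} (hD : 0 < D) (hs : 1 < s) (hsr : s < r)
    {w : G → ℝ≥0∞} (hw : Measurable w) (hw1 : eLpNorm w (ENNReal.ofReal s) μ ≤ 1) :
    ∃ c : ℝ, c = (D * (s⁻¹ - r⁻¹)) / (4 * C) * (4 * (C * r / D)) ^ (1 - r / s) ∧
      ∀ η : ℝ, 0 < η → μ {x | ENNReal.ofReal η < potential μ k (D * (s⁻¹ - r⁻¹)) (Ioi 0) w x}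
        ≤ ENNReal.ofReal (2 * (c * η ^ (r / s)))⁻¹ *
          ∫⁻ x, {x | ENNReal.ofReal (c * η ^ (r / s)) < w x}.indicator w x ∂μ := by
  refine ⟨_, rfl, fun η hη => ?_⟩
  have hs0 : 0 < s := by linarith
  have hr0 : 0 < r := by linarith
  have hC := hk.pos
  set e := D * (s⁻¹ - r⁻¹) with he
  have he0 : 0 < e := mul_pos hD (sub_pos.2 ((inv_lt_inv₀ hr0 hs0).2 hsr))
  -- The constant is determined by `hhead`. The powers of `η` there balance because `e = D(1/s -
  -- 1/r)`, so `c` does not depend on the level.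
  set c := e / (4 * C) * (4 * (C * r / D)) ^ (1 - r / s) with hc
  have hc0 : 0 < c := by positivity
  set m := c * η ^ (r / s) with hm
  have hm0 : 0 < m := by positivity
  -- The radius that makes the bound for the tail equal to `η/4`, as in `htail`.
  set ρ := (4 * (C * r / D) / η) ^ (r / D) with hρ
  have hρ0 : 0 < ρ := by positivity
  have hDs : D / s - e = D / r := by rw [he]; field_simp; ring
  have htail : C * (ρ ^ (e - D / s) / (D / s - e)) = η / 4 := by
    have h1 : e - D / s = -(D / r) := by linarith
    rw [hDs, h1, hρ, ← Real.rpow_mul (by positivity)]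
    have : r / D * -(D / r) = -1 := by field_simp
    rw [this, Real.rpow_neg_one]
    field_simp
  have hρe : ρ ^ e = (4 * (C * r / D)) ^ (r / s - 1) * (η ^ (r / s - 1))⁻¹ := by
    rw [hρ, ← Real.rpow_mul (by positivity)]
    have : r / D * e = r / s - 1 := by rw [he]; field_simp
    rw [this, Real.div_rpow (by positivity) hη.le]
    rfl
  have hhead : m * (C * (ρ ^ e / e)) = η / 4 := by
    rw [hρe, hm, hc, Real.rpow_sub_one hη.ne', Real.rpow_sub (by positivity),
      Real.rpow_sub (by positivity)]
    simp only [Real.rpow_one]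
    field_simp
  have hhead2 : C * (ρ ^ e / e) = η / 4 / m := by rw [← hhead]; field_simp
  set S := {x | ENNReal.ofReal m < w x}
  have hS : MeasurableSet S := measurableSet_lt measurable_const hw
  set w1 := S.indicator w
  set w2 := Sᶜ.indicator w
  have hw1m : Measurable w1 := hw.indicator hS
  have hw2m : Measurable w2 := hw.indicator hS.compl
  have hsub : {x | ENNReal.ofReal η < potential μ k e (Ioi 0) w x}
      ⊆ {x | ENNReal.ofReal (η / 2) ≤ potential μ k e (Ioc 0 ρ) w1 x} := by
    intro x hx
    by_contra hcon
    replace hcon : potential μ k e (Ioc 0 ρ) w1 x < ENNReal.ofReal (η / 2) := not_le.1 hcon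
    replace hx : ENNReal.ofReal η < potential μ k e (Ioi 0) w x := hx
    refine absurd hx (not_lt.2 ?_)
    have hsplit : potential μ k e (Ioi 0) w x
        = potential μ k e (Ioc 0 ρ) w x + potential μ k e (Ioi ρ) w x := by
      unfold potential
      rw [← lintegral_union measurableSet_Ioi (Ioc_disjoint_Ioi le_rfl),
        Ioc_union_Ioi_eq_Ioi hρ0.le]
    have hww : w = fun y => w1 y + w2 y := by
      funext y
      simp only [w1, w2]
      exact (congrFun (indicator_self_add_compl S w) y).symm
    have hadd : potential μ k e (Ioc 0 ρ) w x
        = potential μ k e (Ioc 0 ρ) w1 x + potential μ k e (Ioc 0 ρ) w2 x := by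
      conv_lhs => rw [hww]
      exact hk.potential_add hw1m x
    have h2 : potential μ k e (Ioc 0 ρ) w2 x ≤ ENNReal.ofReal (η / 4) := by
      rw [← hhead]
      refine hk.potential_head_le he0 hm0.le (fun y => ?_) hρ0 x
      by_cases hy : y ∈ S
      · simp [w2, hy]
      · simp only [w2]
        rw [indicator_of_mem (by exact hy)]
        exact not_lt.1 hy
    have h3 : potential μ k e (Ioi ρ) w x ≤ ENNReal.ofReal (η / 4) := by
      rw [← htail]
      refine (hk.potential_tail_le hs.le (by have : 0 < D / r := by positivity
                                             linarith) hw hρ0 x).trans ?_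
      exact mul_le_of_le_one_right zero_le hw1
    calc potential μ k e (Ioi 0) w x
        ≤ ENNReal.ofReal (η / 2) + ENNReal.ofReal (η / 4) + ENNReal.ofReal (η / 4) := by
          rw [hsplit, hadd]
          gcongr
      _ = ENNReal.ofReal η := by
          rw [← ENNReal.ofReal_add (by positivity) (by positivity),
            ← ENNReal.ofReal_add (by positivity) (by positivity)]
          ring_nf
  refine (measure_mono hsub).trans ?_
  refine (meas_ge_le_lintegral_div (measurable_potential hk.measurable hw1m e _).aemeasurable
    (by simpa using hη) (by simp)).trans ?_
  calc _ ≤ ENNReal.ofReal (C * (ρ ^ e / e)) * (∫⁻ x, w1 x ∂μ) / ENNReal.ofReal (η / 2) := by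
        gcongr
        exact hk.lintegral_potential_head_le he0 hw1m hρ0
    _ = _ := by
        rw [hhead2, div_eq_mul_inv, mul_right_comm, ← ENNReal.ofReal_inv_of_pos (by positivity),
          ← ENNReal.ofReal_mul (by positivity)]
        congr 2
        field_simp
        norm_num

/-- The Hardy–Littlewood–Sobolev inequality, for functions of norm at most one. -/
theorem IsKernelFamily.lintegral_potential_rpow_le {s r : ℝ} (hD : 0 < D) (hs : 1 < s)
    (hsr : s < r) :
    ∃ N : ℝ≥0, ∀ w : G → ℝ≥0∞, Measurable w → eLpNorm w (ENNReal.ofReal s) μ ≤ 1 →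
      ∫⁻ x, potential μ k (D * (s⁻¹ - r⁻¹)) (Ioi 0) w x ^ r ∂μ ≤ N := by
  have hs0 : 0 < s := by linarith
  have hr0 : 0 < r := by linarith
  have hC := hk.pos
  set e := D * (s⁻¹ - r⁻¹) with he
  have he0 : 0 < e := mul_pos hD (sub_pos.2 ((inv_lt_inv₀ hr0 hs0).2 hsr))
  set c := e / (4 * C) * (4 * (C * r / D)) ^ (1 - r / s) with hc
  have hc0 : 0 < c := by positivity
  set K := ENNReal.ofReal ((c ^ s)⁻¹ / (2 * (r - r / s)))
  refine ⟨(ENNReal.ofReal r * K).toNNReal, fun w hw hw1 => ?_⟩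
  rw [ENNReal.coe_toNNReal (ENNReal.mul_ne_top (by simp) (by simp [K]))]
  obtain ⟨c', hc', hdist⟩ := hk.measure_potential_gt_le hD hs hsr hw hw1
  rw [← he, ← hc] at hc'
  subst hc'
  set J := potential μ k e (Ioi 0) w with hJ
  have hJm : Measurable J := measurable_potential hk.measurable hw e _
  have hw1' : ∫⁻ x, w x ^ s ∂μ ≤ 1 := by
    rw [eLpNorm_ennreal_eq (by simpa using hs0) (by simp), ENNReal.toReal_ofReal hs0.le, one_div,
      ENNReal.rpow_inv_le_iff hs0, ENNReal.one_rpow] at hw1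
    exact hw1
  calc ∫⁻ x, J x ^ r ∂μ
      ≤ ∫⁻ x, (ENNReal.ofReal r * ∫⁻ η in Ioi (0 : ℝ), {η | ENNReal.ofReal η < J x}.indicator
        (fun η => ENNReal.ofReal (η ^ (r - 1))) η) ∂μ :=
        lintegral_mono fun x => rpow_le_lintegral_level hr0 _
    _ = ENNReal.ofReal r * ∫⁻ η in Ioi (0 : ℝ), ∫⁻ x, {η | ENNReal.ofReal η < J x}.indicator
        (fun η => ENNReal.ofReal (η ^ (r - 1))) η ∂μ := by
        have hm : Measurable fun z : G × ℝ => {η | ENNReal.ofReal η < J z.1}.indicator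
            (fun η => ENNReal.ofReal (η ^ (r - 1))) z.2 := by
          have : (fun z : G × ℝ => {η | ENNReal.ofReal η < J z.1}.indicator
            (fun η => ENNReal.ofReal (η ^ (r - 1))) z.2) =
            {z : G × ℝ | ENNReal.ofReal z.2 < J z.1}.indicator
              (fun z => ENNReal.ofReal (z.2 ^ (r - 1))) := rfl
          rw [this]
          exact Measurable.indicator (by fun_prop) (measurableSet_lt (by fun_prop) (by fun_prop))
        rw [lintegral_const_mul _ (Measurable.lintegral_prod_right' hm),
          lintegral_lintegral_swap hm.aemeasurable]
    _ ≤ ENNReal.ofReal r * ∫⁻ η in Ioi (0 : ℝ), ∫⁻ x,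
          {η | ENNReal.ofReal (c * η ^ (r / s)) < w x}.indicator
          (fun η => ENNReal.ofReal (η ^ (r - 1) * (2 * (c * η ^ (r / s)))⁻¹)) η * w x ∂μ := by
        gcongr ENNReal.ofReal r * ?_
        refine setLIntegral_mono' measurableSet_Ioi fun η (hη : 0 < η) => ?_
        calc ∫⁻ x, {η | ENNReal.ofReal η < J x}.indicator
              (fun η => ENNReal.ofReal (η ^ (r - 1))) η ∂μ
            = ENNReal.ofReal (η ^ (r - 1)) * μ {x | ENNReal.ofReal η < J x} := by
              rw [← lintegral_indicator_const (measurableSet_lt measurable_const hJm)]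
              rfl
          _ ≤ ENNReal.ofReal (η ^ (r - 1)) * (ENNReal.ofReal (2 * (c * η ^ (r / s)))⁻¹ *
              ∫⁻ x, {x | ENNReal.ofReal (c * η ^ (r / s)) < w x}.indicator w x ∂μ) := by
              gcongr
              exact hdist η hη
          _ = _ := by
              rw [← mul_assoc, ← ENNReal.ofReal_mul (by positivity), ← lintegral_const_mul]
              · refine lintegral_congr fun x => ?_
                by_cases h : ENNReal.ofReal (c * η ^ (r / s)) < w x
                · rw [indicator_of_mem (by exact h), indicator_of_mem (by exact h)]
                · rw [indicator_of_notMem (by exact h), indicator_of_notMem (by exact h)]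
                  simp
              · exact hw.indicator (measurableSet_lt measurable_const hw)
    _ = ENNReal.ofReal r * ∫⁻ x, (∫⁻ η in Ioi (0 : ℝ),
          {η | ENNReal.ofReal (c * η ^ (r / s)) < w x}.indicator
          (fun η => ENNReal.ofReal (η ^ (r - 1) * (2 * (c * η ^ (r / s)))⁻¹)) η) * w x ∂μ := by
        have hm : Measurable fun z : ℝ × G =>
            {η | ENNReal.ofReal (c * η ^ (r / s)) < w z.2}.indicator
            (fun η => ENNReal.ofReal (η ^ (r - 1) * (2 * (c * η ^ (r / s)))⁻¹)) z.1 := by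
          have : (fun z : ℝ × G => {η | ENNReal.ofReal (c * η ^ (r / s)) < w z.2}.indicator
            (fun η => ENNReal.ofReal (η ^ (r - 1) * (2 * (c * η ^ (r / s)))⁻¹)) z.1) =
            {z : ℝ × G | ENNReal.ofReal (c * z.1 ^ (r / s)) < w z.2}.indicator
              (fun z => ENNReal.ofReal (z.1 ^ (r - 1) * (2 * (c * z.1 ^ (r / s)))⁻¹)) := rfl
          rw [this]
          exact Measurable.indicator (by fun_prop) (measurableSet_lt (by fun_prop) (by fun_prop))
        rw [lintegral_lintegral_swap (hm.mul (hw.comp measurable_snd)).aemeasurable]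
        congr 1
        refine lintegral_congr fun x => ?_
        exact lintegral_mul_const _ (hm.comp measurable_prodMk_right)
    _ ≤ ENNReal.ofReal r * ∫⁻ x, K * w x ^ s ∂μ := by
        refine mul_le_mul_right (lintegral_mono fun x => ?_) _
        refine (mul_le_mul_left (lintegral_level_le hs hr0 hc0 (w x)) _).trans (le_of_eq ?_)
        rw [mul_assoc]
        congr 1
        conv_lhs => rw [← ENNReal.rpow_one (w x), ← ENNReal.rpow_mul, one_mul]
        rw [← ENNReal.rpow_add_of_nonneg _ _ (by linarith) zero_le_one]
        simp
    _ ≤ ENNReal.ofReal r * K := by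
        rw [lintegral_const_mul _ (hw.pow_const _)]
        gcongr
        exact mul_le_of_le_one_right zero_le hw1'

theorem IsKernelFamily.potential_const_mul {e : ℝ} {S : Set ℝ} {w : G → ℝ≥0∞}
    (hw : Measurable w) (c : ℝ≥0∞) (x : G) :
    potential μ k e S (fun y => c * w y) x = c * potential μ k e S w x := by
  unfold potential
  have hm : Measurable fun l => ENNReal.ofReal (l ^ (e - 1)) * lconv μ w (k l) x :=
    (measurable_potential_integrand hk.measurable hw e).comp (measurable_prodMk_left (x := x))
  rw [← lintegral_const_mul _ hm]
  refine lintegral_congr fun l => ?_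
  rw [mul_left_comm]
  congr 1
  unfold lconv
  rw [← lintegral_const_mul]
  · simp [mul_assoc]
  · exact (hw.comp (measurable_const.sub measurable_id)).mul (hk.measurable_apply l)

/-- The Hardy–Littlewood–Sobolev inequality. -/
theorem IsKernelFamily.eLpNorm_potential_le_of_eq {a b : ℝ≥0∞} (hD : 0 < D) (ha : 1 < a)
    (hab : a < b) (hb : b < ∞) :
    ∃ N : ℝ≥0, ∀ w : G → ℝ≥0∞, Measurable w →
      eLpNorm (potential μ k (D * (a⁻¹.toReal - b⁻¹.toReal)) (Ioi 0) w) b μ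
        ≤ N * eLpNorm w a μ := by
  have haT : a ≠ ∞ := ne_top_of_lt hab
  have hs : 1 < a.toReal := by
    rw [← ENNReal.toReal_one]; exact (ENNReal.toReal_lt_toReal (by simp) haT).2 ha
  have hsr : a.toReal < b.toReal := (ENNReal.toReal_lt_toReal haT hb.ne).2 hab
  have hr0 : 0 < b.toReal := by linarith
  obtain ⟨N, hN⟩ := hk.lintegral_potential_rpow_le hD hs hsr
  rw [ENNReal.toReal_inv, ENNReal.toReal_inv]
  rw [ENNReal.ofReal_toReal haT] at hN
  set e := D * (a.toReal⁻¹ - b.toReal⁻¹)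
  -- The added one keeps the constant nonzero, so that the right-hand side is `∞` when the norm of
  -- `w` is.
  refine ⟨N ^ b.toReal⁻¹ + 1, fun w hw => ?_⟩
  set A := eLpNorm w a μ with hA
  have hNpos : ((N ^ b.toReal⁻¹ + 1 : ℝ≥0) : ℝ≥0∞) ≠ 0 := by
    exact_mod_cast (by positivity : (N ^ b.toReal⁻¹ + 1 : ℝ≥0) ≠ 0)
  rcases eq_or_ne A ∞ with hAt | hAt
  · rw [hAt, ENNReal.mul_top hNpos]; exact le_top
  rcases eq_or_ne A 0 with hA0 | hA0
  · have h0 : ∀ x, potential μ k e (Ioi 0) w x = 0 := by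
      intro x
      unfold potential
      rw [setLIntegral_congr_fun (g := fun _ => 0) measurableSet_Ioi]
      · simp
      · intro l (hl : 0 < l)
        have hC := hk.pos
        have h1 := lconv_le_eLpNorm (μ := μ) hw (hk.measurable_apply l) ha.le
          (by have := Real.rpow_pos_of_pos hl (-D); simpa using by positivity)
          (hk.le l hl) (hk.lintegral_le l hl) x
        rw [← hA, hA0, mul_zero, nonpos_iff_eq_zero] at h1
        simp [h1]
    have h1 : potential μ k e (Ioi 0) w = fun _ => 0 := funext h0
    rw [h1]
    simp
  · have hb0 : b ≠ 0 := (ENNReal.toReal_pos_iff.1 hr0).1.ne'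
    have hAi : A⁻¹ ≠ ∞ := by simpa using hA0
    have h1 := hN (fun y => A⁻¹ * w y) (hw.const_mul _) (by
      rw [eLpNorm_const_mul_ennreal hw, ← hA, ENNReal.inv_mul_cancel hA0 hAt])
    have h2 : eLpNorm (potential μ k e (Ioi 0) fun y => A⁻¹ * w y) b μ ≤ (N : ℝ≥0∞) ^ b.toReal⁻¹ := by
      rw [eLpNorm_ennreal_eq hb0 hb.ne, one_div]
      gcongr
    have h3 : (potential μ k e (Ioi 0) fun y => A⁻¹ * w y)
        = fun x => A⁻¹ * potential μ k e (Ioi 0) w x :=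
      funext fun x => hk.potential_const_mul hw _ x
    rw [h3, eLpNorm_const_mul_ennreal (measurable_potential hk.measurable hw e _)] at h2
    calc eLpNorm (potential μ k e (Ioi 0) w) b μ
        = A⁻¹ * eLpNorm (potential μ k e (Ioi 0) w) b μ * A := by
          rw [mul_right_comm, ENNReal.inv_mul_cancel hA0 hAt, one_mul]
      _ ≤ (N : ℝ≥0∞) ^ b.toReal⁻¹ * A := by gcongr
      _ ≤ _ := by
          gcongr
          rw [← ENNReal.coe_rpow_of_nonneg _ (by positivity)]
          exact_mod_cast le_self_add

end HLS

/-! ### Integration along a path of test kernels. -/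

section Path

set_option linter.unusedSectionVars false

variable {Z : Type*} [TopologicalSpace Z] [MeasurableSpace Z] [OpensMeasurableSpace Z] [T2Space Z]
  [SecondCountableTopology Z] {μ : Measure Z} [SFinite μ]

/-- The fundamental theorem of calculus in `l` combined with Fubini. Since `v` vanishes off the
compact set `K`, a bound for `k'` on the compact set `[a, b] × K` provides the integrability. -/
theorem integral_path_sub {v : Z → ℝ} (hv : Integrable v μ) {K : Set Z} (hK : IsCompact K)
    (hvK : ∀ z, z ∉ K → v z = 0) {k k' : ℝ → Z → ℝ} {a b : ℝ} (hab : a ≤ b)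
    (hk : ∀ l ∈ Icc a b, ∀ z, HasDerivAt (fun l => k l z) (k' l z) l)
    (hkc : ∀ l ∈ Icc a b, Continuous (k l))
    (hk' : ContinuousOn (fun q : ℝ × Z => k' q.1 q.2) (Icc a b ×ˢ univ)) :
    ∫ z, v z * k b z ∂μ - ∫ z, v z * k a z ∂μ = ∫ l in a..b, ∫ z, v z * k' l z ∂μ := by
  have hint : ∀ l ∈ Icc a b, Integrable (fun z => v z * k l z) μ := by
    intro l hl
    obtain ⟨M, hM⟩ := hK.exists_bound_of_continuousOn (hkc l hl).continuousOn
    refine (hv.norm.const_mul M).mono'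
      (hv.aestronglyMeasurable.mul (hkc l hl).aestronglyMeasurable) (Eventually.of_forall fun z => ?_)
    by_cases hz : z ∈ K
    · rw [norm_mul, mul_comm]
      gcongr
      exact hM z hz
    · simp [hvK z hz]
  obtain ⟨M, hM⟩ := (isCompact_Icc.prod hK).exists_bound_of_continuousOn
    (hk'.mono (prod_mono le_rfl (subset_univ K)))
  have hslice : ∀ z, ContinuousOn (fun l => k' l z) (Icc a b) := fun z =>
    hk'.comp (f := fun l => (l, z)) (by fun_prop) fun l hl => ⟨hl, mem_univ _⟩
  have hI : Integrable (Function.uncurry fun z l => v z * k' l z)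
      (μ.prod (volume.restrict (Ioc a b))) := by
    have h1 : Integrable (fun q : Z × ℝ => ‖v q.1‖ * M) (μ.prod (volume.restrict (Ioc a b))) :=
      hv.norm.mul_prod (integrable_const M)
    refine h1.mono' ?_ ?_
    · refine (hv.aestronglyMeasurable.comp_fst).mul ?_
      have h2 : ContinuousOn (fun q : Z × ℝ => k' q.2 q.1) (univ ×ˢ Icc a b) :=
        hk'.comp (f := fun q : Z × ℝ => (q.2, q.1)) (by fun_prop) fun q hq => ⟨hq.2, mem_univ _⟩
      have h3 := h2.aestronglyMeasurable (μ := μ.prod volume)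
        (MeasurableSet.univ.prod measurableSet_Icc)
      rw [← Measure.prod_restrict, Measure.restrict_univ] at h3
      refine h3.mono_measure (Measure.prod_mono le_rfl (Measure.restrict_mono Ioc_subset_Icc_self le_rfl))
    · have h4 : ∀ᵐ q : Z × ℝ ∂(μ.prod (volume.restrict (Ioc a b))), q.2 ∈ Ioc a b := by
        have : ∀ᵐ l ∂(volume.restrict (Ioc a b)), l ∈ Ioc a b := ae_restrict_mem measurableSet_Ioc
        exact Measure.quasiMeasurePreserving_snd.ae this
      filter_upwards [h4] with q hq
      by_cases hz : q.1 ∈ K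
      · simp only [Function.uncurry, norm_mul]
        gcongr
        exact hM (q.2, q.1) ⟨Ioc_subset_Icc_self hq, hz⟩
      · simp [Function.uncurry, hvK _ hz]
  rw [← integral_sub (hint b (right_mem_Icc.2 hab)) (hint a (left_mem_Icc.2 hab)),
    intervalIntegral.integral_of_le hab, ← integral_integral_swap hI]
  refine integral_congr_ae (Eventually.of_forall fun z => ?_)
  simp only
  rw [integral_const_mul, ← intervalIntegral.integral_of_le hab, ← mul_sub,
    intervalIntegral.integral_eq_sub_of_hasDerivAt]
  · intro l hl
    rw [uIcc_of_le hab] at hl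
    exact hk l hl z
  · exact ContinuousOn.intervalIntegrable (by rw [uIcc_of_le hab]; exact hslice z)

/-- As all kernels vanish off one compact `K ⊆ Q`, `v` may be replaced by its restriction to `K`.
Local integrability is then enough in the applications. -/
theorem enorm_setIntegral_path_le {v : Z → ℝ} {Q K : Set Z} (hQ : MeasurableSet Q)
    (hK : IsCompact K) (hKQ : K ⊆ Q)
    (hv : IntegrableOn v K μ) {k k' : ℝ → Z → ℝ} {a b : ℝ} (hab : a ≤ b)
    (hk : ∀ l ∈ Icc a b, ∀ z, HasDerivAt (fun l => k l z) (k' l z) l)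
    (hkc : ∀ l ∈ Icc a b, Continuous (k l))
    (hk' : ContinuousOn (fun q : ℝ × Z => k' q.1 q.2) (Icc a b ×ˢ univ))
    (hkK : ∀ l ∈ Icc a b, ∀ z, z ∉ K → k l z = 0)
    (hkK' : ∀ l ∈ Icc a b, ∀ z, z ∉ K → k' l z = 0) :
    ‖∫ z in Q, v z * k a z ∂μ‖ₑ ≤ ‖∫ z in Q, v z * k b z ∂μ‖ₑ
      + ∫⁻ l in Ioo a b, ‖∫ z in Q, v z * k' l z ∂μ‖ₑ := by
  have hred : ∀ κ : Z → ℝ, (∀ z, z ∉ K → κ z = 0) →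
      ∫ z in Q, v z * κ z ∂μ = ∫ z, K.indicator v z * κ z ∂μ := by
    intro κ hκ
    have h1 : (fun z => K.indicator v z * κ z) = K.indicator (fun z => v z * κ z) := by
      funext z
      by_cases hz : z ∈ K <;> simp [hz]
    rw [h1, integral_indicator hK.measurableSet]
    exact (setIntegral_eq_of_subset_of_forall_sdiff_eq_zero hQ hKQ
      fun z hz => by rw [hκ z hz.2, mul_zero])
  have h := integral_path_sub (μ := μ) ((integrable_indicator_iff hK.measurableSet).2 hv) hK
    (fun z hz => indicator_of_notMem hz v) hab hk hkc hk'
  rw [hred _ (hkK a (left_mem_Icc.2 hab)), hred _ (hkK b (right_mem_Icc.2 hab))]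
  have h2 : ∫⁻ l in Ioo a b, ‖∫ z in Q, v z * k' l z ∂μ‖ₑ
      = ∫⁻ l in Ioc a b, ‖∫ z, K.indicator v z * k' l z ∂μ‖ₑ := by
    rw [setLIntegral_congr Ioo_ae_eq_Ioc]
    exact setLIntegral_congr_fun measurableSet_Ioc fun l hl => by
      rw [hred _ (hkK' l (Ioc_subset_Icc_self hl))]
  rw [h2]
  have h3 : ∫ z, K.indicator v z * k a z ∂μ = ∫ z, K.indicator v z * k b z ∂μ
      - ∫ l in a..b, ∫ z, K.indicator v z * k' l z ∂μ := by rw [← h]; ring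
  rw [h3, intervalIntegral.integral_of_le hab]
  exact (enorm_sub_le).trans (by gcongr; exact enorm_integral_le_lintegral_enorm _)

end Path

/-! ### One-sided mollifiers, their test-function properties and their scale derivative. -/

section Profiles

set_option linter.unusedSectionVars false

variable {d : ℕ}

/-- The rescaled profile `τ⁻¹ l⁻ᵈ ψ (s / τ, y / l)`. -/
noncomputable def scaled (ψ : ℝ × Space d → ℝ) (τ l : ℝ) (z : ℝ × Space d) : ℝ :=
  τ⁻¹ * (l ^ d)⁻¹ * ψ (τ⁻¹ * z.1, l⁻¹ • z.2)

/-- The region which supports the mollifiers: one-sided in time and in the first coordinate. -/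
def box (d : ℕ) [NeZero d] (σ : ℝ) : Set (ℝ × Space d) :=
  {z | 1 ≤ σ * z.1 ∧ σ * z.1 ≤ 2 ∧ ‖z.2‖ ≤ 1 ∧ z.2 0 ≤ 0}

/-- A smooth function supported in `box d σ`. -/
structure IsProfile [NeZero d] (σ : ℝ) (ψ : ℝ × Space d → ℝ) : Prop where
  smooth : ContDiff ℝ ((⊤ : ℕ∞) : WithTop ℕ∞) ψ
  tsupport_subset : tsupport ψ ⊆ box d σ

variable [NeZero d] {σ : ℝ}

theorem isClosed_box (σ : ℝ) : IsClosed (box d σ) := by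
  have h0 : Continuous fun z : ℝ × Space d => z.2 0 := by fun_prop
  have h1 : Continuous fun z : ℝ × Space d => σ * z.1 := by fun_prop
  have h2 : Continuous fun z : ℝ × Space d => ‖z.2‖ := by fun_prop
  exact (isClosed_le continuous_const h1).inter <| (isClosed_le h1 continuous_const).inter <|
    (isClosed_le h2 continuous_const).inter (isClosed_le h0 continuous_const)

theorem isCompact_box (hσ : σ = 1 ∨ σ = -1) : IsCompact (box d σ) := by
  refine Metric.isCompact_of_isClosed_isBounded (isClosed_box σ)
    (Metric.isBounded_closedBall (x := (0 : ℝ × Space d)) (r := 2) |>.subset fun z hz => ?_)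
  obtain ⟨h1, h2, h3, -⟩ := hz
  rw [mem_closedBall_zero_iff, Prod.norm_def, max_le_iff, Real.norm_eq_abs, abs_le]
  refine ⟨?_, by linarith⟩
  rcases hσ with rfl | rfl <;> constructor <;> linarith

theorem IsProfile.eq_zero {ψ : ℝ × Space d → ℝ} (hψ : IsProfile σ ψ) {z : ℝ × Space d}
    (hz : z ∉ box d σ) : ψ z = 0 :=
  image_eq_zero_of_notMem_tsupport fun h => hz (hψ.tsupport_subset h)

theorem IsProfile.exists_bound {ψ : ℝ × Space d → ℝ} (hψ : IsProfile σ ψ)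
    (hσ : σ = 1 ∨ σ = -1) : ∃ M : ℝ, 0 < M ∧ ∀ z, |ψ z| ≤ M := by
  obtain ⟨M, hM⟩ := (isCompact_box hσ).exists_bound_of_continuousOn hψ.smooth.continuous.continuousOn
  refine ⟨max M 1, by positivity, fun z => ?_⟩
  by_cases hz : z ∈ box d σ
  · exact (hM z hz).trans (le_max_left _ _)
  · rw [hψ.eq_zero hz]; simp

theorem IsProfile.mul_left {ψ χ : ℝ × Space d → ℝ} (hψ : IsProfile σ ψ)
    (hχ : ContDiff ℝ ((⊤ : ℕ∞) : WithTop ℕ∞) χ) : IsProfile σ fun z => χ z * ψ z :=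
  ⟨hχ.mul hψ.smooth, (tsupport_mul_subset_right).trans hψ.tsupport_subset⟩

theorem IsProfile.fderiv_apply {ψ : ℝ × Space d → ℝ} (hψ : IsProfile σ ψ) (v : ℝ × Space d) :
    IsProfile σ fun z => fderiv ℝ ψ z v := by
  refine ⟨(hψ.smooth.fderiv_right (m := ((⊤ : ℕ∞) : WithTop ℕ∞)) (by simp)).clm_apply contDiff_const, ?_⟩
  refine (closure_mono ?_).trans ((tsupport_fderiv_subset ℝ).trans hψ.tsupport_subset)
  intro z hz
  simp only [Function.mem_support] at hz ⊢
  intro h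
  exact hz (by simp [h])

theorem IsProfile.timeDeriv {ψ : ℝ × Space d → ℝ} (hψ : IsProfile σ ψ) :
    IsProfile σ (timeDeriv ψ) := hψ.fderiv_apply _

theorem IsProfile.spaceDeriv {ψ : ℝ × Space d → ℝ} (hψ : IsProfile σ ψ) (i : Fin d) :
    IsProfile σ (spaceDeriv i ψ) := hψ.fderiv_apply _

theorem IsProfile.add {ψ χ : ℝ × Space d → ℝ} (hψ : IsProfile σ ψ) (hχ : IsProfile σ χ) :
    IsProfile σ fun z => ψ z + χ z :=
  ⟨hψ.smooth.add hχ.smooth, (tsupport_add ψ χ).trans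
    (union_subset hψ.tsupport_subset hχ.tsupport_subset)⟩

theorem IsProfile.sum {ι : Type*} (s : Finset ι) {ψ : ι → ℝ × Space d → ℝ}
    (hψ : ∀ i, IsProfile σ (ψ i)) : IsProfile σ fun z => ∑ i ∈ s, ψ i z := by
  classical
  induction s using Finset.induction_on with
  | empty =>
    refine ⟨by simpa using contDiff_const, ?_⟩
    simp [tsupport, Function.support]
  | insert i s hi ih =>
    simp only [Finset.sum_insert hi]
    exact (hψ i).add ih

/-- The point `z₀` and all times between it and `z₀ - 2στ` lie in the cylinder. -/
structure Admissible (σ T : ℝ) (Ω : Set (Space d)) (z₀ : ℝ × Space d) (τ : ℝ) : Prop where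
  space : z₀.2 ∈ Ω
  time : z₀.1 ∈ Ioo 0 T
  time' : z₀.1 - 2 * σ * τ ∈ Ioo 0 T

variable {T : ℝ} {Ω : Set (Space d)}

/-- This is the reason for the shape of `box`: times lie between `z₀.1` and `z₀.1 - 2στ`, both in
`(0,T)`, and the first space coordinate can only grow. -/
theorem Admissible.sub_mem (hσ : σ = 1 ∨ σ = -1) (hΩ : Ω = univ ∨ Ω = halfSpace d)
    {z₀ : ℝ × Space d} {τ l : ℝ} (h : Admissible σ T Ω z₀ τ) (hτ : 0 < τ) (hl : 0 < l)
    {ζ : ℝ × Space d} (hζ : ζ ∈ box d σ) : z₀ - (τ * ζ.1, l • ζ.2) ∈ cylinder T Ω := by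
  obtain ⟨h1, h2, h3, h4⟩ := hζ
  obtain ⟨h5, ⟨h6, h7⟩, ⟨h8, h9⟩⟩ := h
  refine ⟨?_, ?_⟩
  · have h10 : σ * (τ * ζ.1) ≤ 2 * τ := by nlinarith
    have h11 : 0 ≤ σ * (τ * ζ.1) := by
      have : σ * (τ * ζ.1) = τ * (σ * ζ.1) := by ring
      rw [this]; positivity
    change z₀.1 - τ * ζ.1 ∈ Ioo 0 T
    rcases hσ with rfl | rfl <;> constructor <;> nlinarith
  · rcases hΩ with rfl | rfl
    · trivial
    · change 0 < (z₀.2 - l • ζ.2) 0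
      have h5 : 0 < z₀.2 0 := h5
      simp only [PiLp.sub_apply, PiLp.smul_apply, smul_eq_mul]
      nlinarith

theorem scaled_eq_zero {ψ : ℝ × Space d → ℝ} (hψ : IsProfile σ ψ) {τ l : ℝ} {z : ℝ × Space d}
    (hz : (τ⁻¹ * z.1, l⁻¹ • z.2) ∉ box d σ) : scaled ψ τ l z = 0 := by
  simp [scaled, hψ.eq_zero hz]

theorem mem_image_box {z₀ z : ℝ × Space d} {τ l : ℝ} (hτ : τ ≠ 0) (hl : l ≠ 0)
    (h : (τ⁻¹ * (z₀ - z).1, l⁻¹ • (z₀ - z).2) ∈ box d σ) :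
    z ∈ (fun ζ : ℝ × Space d => z₀ - (τ * ζ.1, l • ζ.2)) '' box d σ := by
  refine ⟨_, h, ?_⟩
  simp only
  rw [mul_inv_cancel_left₀ hτ, smul_inv_smul₀ hl, Prod.mk.eta, sub_sub_cancel]

theorem contDiff_scaled {ψ : ℝ × Space d → ℝ} (hψ : ContDiff ℝ ((⊤ : ℕ∞) : WithTop ℕ∞) ψ)
    (τ l : ℝ) : ContDiff ℝ ((⊤ : ℕ∞) : WithTop ℕ∞) (scaled ψ τ l) := by
  unfold scaled
  fun_prop

theorem isTestFunction_scaled (hσ : σ = 1 ∨ σ = -1) (hΩ : Ω = univ ∨ Ω = halfSpace d)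
    {z₀ : ℝ × Space d} {τ l : ℝ} (h : Admissible σ T Ω z₀ τ) (hτ : 0 < τ) (hl : 0 < l)
    {ψ : ℝ × Space d → ℝ} (hψ : IsProfile σ ψ) :
    IsTestFunction T Ω fun z => scaled ψ τ l (z₀ - z) := by
  have hK : IsCompact ((fun ζ : ℝ × Space d => z₀ - (τ * ζ.1, l • ζ.2)) '' box d σ) :=
    (isCompact_box hσ).image (by fun_prop)
  have hsub : tsupport (fun z => scaled ψ τ l (z₀ - z))
      ⊆ (fun ζ : ℝ × Space d => z₀ - (τ * ζ.1, l • ζ.2)) '' box d σ := by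
    refine closure_minimal (fun z hz => ?_) hK.isClosed
    by_contra hcon
    exact hz (scaled_eq_zero hψ fun h => hcon (mem_image_box hτ.ne' hl.ne' h))
  refine ⟨?_, hK.of_isClosed_subset (isClosed_tsupport _) hsub, hsub.trans ?_⟩
  · exact (contDiff_scaled hψ.smooth τ l).comp (contDiff_const.sub contDiff_id)
  · rintro _ ⟨ζ, hζ, rfl⟩
    exact h.sub_mem hσ hΩ hτ hl hζ

theorem fderiv_scaled_sub {ψ : ℝ × Space d → ℝ} (hψ : Differentiable ℝ ψ) (τ l : ℝ)
    (z₀ z v : ℝ × Space d) :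
    fderiv ℝ (fun z => scaled ψ τ l (z₀ - z)) z v
      = - scaled (fun ζ => fderiv ℝ ψ ζ (τ⁻¹ * v.1, l⁻¹ • v.2)) τ l (z₀ - z) := by
  unfold scaled
  let A : ℝ × Space d →L[ℝ] ℝ × Space d :=
    (τ⁻¹ • ContinuousLinearMap.fst ℝ ℝ (Space d)).prod (l⁻¹ • ContinuousLinearMap.snd ℝ ℝ (Space d))
  have h1 : HasFDerivAt (fun z : ℝ × Space d => A (z₀ - z)) (-A) z := by
    have := A.hasFDerivAt.comp z ((hasFDerivAt_id z).const_sub z₀)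
    rwa [ContinuousLinearMap.comp_neg, ContinuousLinearMap.comp_id] at this
  have h2 := ((hψ (A (z₀ - z))).hasFDerivAt.comp z h1).const_mul (τ⁻¹ * (l ^ d)⁻¹)
  have h3 := h2.fderiv
  have h4 : (fun z => τ⁻¹ * (l ^ d)⁻¹ * ψ (τ⁻¹ * (z₀ - z).1, l⁻¹ • (z₀ - z).2))
    = (fun z => τ⁻¹ * (l ^ d)⁻¹ * (ψ ∘ fun z => A (z₀ - z)) z) := rfl
  rw [h4, h3]
  simp [A]

theorem scaled_const_mul (ψ : ℝ × Space d → ℝ) (c τ l : ℝ) (z : ℝ × Space d) :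
    scaled (fun ζ => c * ψ ζ) τ l z = c * scaled ψ τ l z := by
  unfold scaled; ring

theorem timeDeriv_scaled_sub {ψ : ℝ × Space d → ℝ} (hψ : Differentiable ℝ ψ) (τ l : ℝ)
    (z₀ z : ℝ × Space d) :
    timeDeriv (fun z => scaled ψ τ l (z₀ - z)) z = - (τ⁻¹ * scaled (timeDeriv ψ) τ l (z₀ - z)) := by
  unfold timeDeriv
  rw [fderiv_scaled_sub hψ, ← scaled_const_mul]
  congr 2
  funext ζ
  simpa using (fderiv ℝ ψ ζ).map_smul τ⁻¹ (1, 0)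

theorem spaceDeriv_scaled_sub {ψ : ℝ × Space d → ℝ} (hψ : Differentiable ℝ ψ) (τ l : ℝ)
    (i : Fin d) (z₀ z : ℝ × Space d) :
    spaceDeriv i (fun z => scaled ψ τ l (z₀ - z)) z
      = - (l⁻¹ * scaled (spaceDeriv i ψ) τ l (z₀ - z)) := by
  unfold spaceDeriv
  rw [fderiv_scaled_sub hψ, ← scaled_const_mul]
  congr 2
  funext ζ
  simpa using (fderiv ℝ ψ ζ).map_smul l⁻¹ (0, EuclideanSpace.single i 1)

theorem IsProfile.differentiable {ψ : ℝ × Space d → ℝ} (hψ : IsProfile σ ψ) :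
    Differentiable ℝ ψ := hψ.smooth.differentiable (by simp)

/-- The factor `l` gained here cancels the `l⁻¹` of the scale derivative. -/
theorem IsWeakSpatialGradient.integral_scaled (hσ : σ = 1 ∨ σ = -1)
    (hΩ : Ω = univ ∨ Ω = halfSpace d) {u : ℝ × Space d → ℝ} {w : ℝ × Space d → Space d}
    (hu : IsWeakSpatialGradient T Ω u w)
    {z₀ : ℝ × Space d} {τ l : ℝ} (h : Admissible σ T Ω z₀ τ) (hτ : 0 < τ) (hl : 0 < l)
    {ψ : ℝ × Space d → ℝ} (hψ : IsProfile σ ψ) (i : Fin d) :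
    ∫ z in cylinder T Ω, u z * scaled (spaceDeriv i ψ) τ l (z₀ - z)
      = l * ∫ z in cylinder T Ω, w z i * scaled ψ τ l (z₀ - z) := by
  have h1 := hu.integral_eq _ (isTestFunction_scaled hσ hΩ h hτ hl hψ) i
  simp only [spaceDeriv_scaled_sub hψ.differentiable] at h1
  have h2 : ∀ z, u z * -(l⁻¹ * scaled (spaceDeriv i ψ) τ l (z₀ - z))
      = -l⁻¹ * (u z * scaled (spaceDeriv i ψ) τ l (z₀ - z)) := fun z => by ring
  simp only [h2, integral_const_mul] at h1
  field_simp at h1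
  linarith

/-- For `τ = l^2` the data `g` and `f` enter with weights `l` and `l^2`, hence with weights `1` and
`l` after division by `l` in the scale derivative. -/
theorem SolvesDistrib.integral_scaled (hσ : σ = 1 ∨ σ = -1)
    (hΩ : Ω = univ ∨ Ω = halfSpace d) {m : ℕ} {u : ℝ × Space d → ℝ} {g : ℝ × Space d → Space d}
    {f : Fin m → ℝ × Space d → ℝ} (hu : SolvesDistrib T Ω u g f)
    {z₀ : ℝ × Space d} {τ l : ℝ} (h : Admissible σ T Ω z₀ τ) (hτ : 0 < τ) (hl : 0 < l)
    {ψ : ℝ × Space d → ℝ} (hψ : IsProfile σ ψ) :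
    ∫ z in cylinder T Ω, u z * scaled (timeDeriv ψ) τ l (z₀ - z)
      = τ * (l⁻¹ * (∑ i, ∫ z in cylinder T Ω, g z i * scaled (spaceDeriv i ψ) τ l (z₀ - z))
        + ∑ k, ∫ z in cylinder T Ω, f k z * scaled ψ τ l (z₀ - z)) := by
  have h1 := hu.integral_eq _ (isTestFunction_scaled hσ hΩ h hτ hl hψ)
  simp only [spaceDeriv_scaled_sub hψ.differentiable, timeDeriv_scaled_sub hψ.differentiable] at h1
  have h2 : ∀ z, u z * -(τ⁻¹ * scaled (timeDeriv ψ) τ l (z₀ - z))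
      = -τ⁻¹ * (u z * scaled (timeDeriv ψ) τ l (z₀ - z)) := fun z => by ring
  have h3 : ∀ i z, g z i * -(l⁻¹ * scaled (spaceDeriv i ψ) τ l (z₀ - z))
      = -l⁻¹ * (g z i * scaled (spaceDeriv i ψ) τ l (z₀ - z)) := fun i z => by ring
  simp only [h2, h3, integral_const_mul, ← Finset.mul_sum] at h1
  rw [neg_mul, neg_neg, neg_mul, neg_neg] at h1
  rw [← h1, mul_inv_cancel_left₀ hτ.ne']

/-- The profile of the scale derivative, in divergence form. -/
noncomputable def scaleProfile (κ : ℝ) (θ : ℝ × Space d → ℝ) (z : ℝ × Space d) : ℝ :=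
  κ * timeDeriv (fun z => z.1 * θ z) z + ∑ i, spaceDeriv i (fun z => z.2 i * θ z) z

/-- The product rule for the divergence of the field `(κ t, y) θ`. Differentiation in the scale
produces the right-hand side, and integration by parts needs the left-hand side. -/
theorem scaleProfile_eq {θ : ℝ × Space d → ℝ} (hθ : Differentiable ℝ θ) (κ : ℝ)
    (z : ℝ × Space d) :
    scaleProfile κ θ z = (κ + d) * θ z + fderiv ℝ θ z (κ * z.1, z.2) := by
  have h1 : timeDeriv (fun z => z.1 * θ z) z = θ z + z.1 * fderiv ℝ θ z (1, 0) := by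
    unfold timeDeriv
    have : HasFDerivAt (fun z : ℝ × Space d => z.1) (ContinuousLinearMap.fst ℝ ℝ (Space d)) z :=
      hasFDerivAt_fst
    rw [HasFDerivAt.fderiv (f := fun z : ℝ × Space d => z.1 * θ z) (this.mul (hθ z).hasFDerivAt)]
    simp [add_comm]
  have h2 : ∀ i, spaceDeriv i (fun z => z.2 i * θ z) z
      = θ z + z.2 i * fderiv ℝ θ z (0, EuclideanSpace.single i 1) := by
    intro i
    unfold spaceDeriv
    have : HasFDerivAt (fun z : ℝ × Space d => z.2 i)
        ((EuclideanSpace.proj i).comp (ContinuousLinearMap.snd ℝ ℝ (Space d))) z :=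
      ((EuclideanSpace.proj i).comp (ContinuousLinearMap.snd ℝ ℝ (Space d))).hasFDerivAt
    rw [HasFDerivAt.fderiv (f := fun z : ℝ × Space d => z.2 i * θ z)
      (this.mul (hθ z).hasFDerivAt)]
    simp [add_comm]
  unfold scaleProfile
  simp only [h1, h2, Finset.sum_add_distrib]
  have h3 : ((κ * z.1, z.2) : ℝ × Space d) = (κ * z.1) • (1, 0)
      + ∑ i, z.2 i • ((0, EuclideanSpace.single i 1) : ℝ × Space d) := by
    ext j
    · simp [Prod.fst_sum]
    · simp [Prod.snd_sum, Finset.sum_apply, Pi.single_apply]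
  rw [h3, map_add, map_smul, map_sum]
  simp only [map_smul, smul_eq_mul, Finset.sum_const, Finset.card_univ, Fintype.card_fin,
    nsmul_eq_mul]
  ring

/-- The hypothesis on `τ` is the differential equation of `l ^ κ`: `κ = 2` is parabolic scaling and
`κ = 0` a frozen time scale. -/
theorem hasDerivAt_scaled {θ : ℝ × Space d → ℝ} (hθ : Differentiable ℝ θ) {κ : ℝ} {τ : ℝ → ℝ}
    {l : ℝ} (hl : 0 < l) (hτ : 0 < τ l) (hτ' : HasDerivAt τ (κ * τ l / l) l) (z : ℝ × Space d) :
    HasDerivAt (fun l => scaled θ (τ l) l z) (-(l⁻¹ * scaled (scaleProfile κ θ) (τ l) l z)) l := by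
  have h1 : HasDerivAt (fun l => (τ l)⁻¹) (-(κ * l⁻¹ * (τ l)⁻¹)) l := by
    refine (hτ'.inv hτ.ne').congr_deriv ?_
    field_simp
  have h2 : HasDerivAt (fun l : ℝ => l⁻¹) (-(l⁻¹ * l⁻¹)) l := by
    refine (hasDerivAt_inv hl.ne').congr_deriv ?_
    field_simp
  have h3 : HasDerivAt (fun l : ℝ => (l ^ d)⁻¹) (-(d * l⁻¹ * (l ^ d)⁻¹)) l := by
    refine ((hasDerivAt_pow d l).inv (pow_ne_zero d hl.ne')).congr_deriv ?_
    have hd : d ≠ 0 := NeZero.ne d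
    obtain ⟨n, hn⟩ := Nat.exists_eq_succ_of_ne_zero hd
    rw [hn]
    simp only [Nat.succ_eq_add_one, Nat.add_sub_cancel, pow_succ]
    field_simp
  have h4 : HasDerivAt (fun l => ((τ l)⁻¹ * z.1, l⁻¹ • z.2))
      (-(κ * l⁻¹ * (τ l)⁻¹) * z.1, -(l⁻¹ * l⁻¹) • z.2) l :=
    (h1.mul_const _).prodMk (h2.smul_const _)
  have h5 := (hθ ((τ l)⁻¹ * z.1, l⁻¹ • z.2)).hasFDerivAt.comp_hasDerivAt l h4
  have h6 := (h1.mul h3).mul h5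
  unfold scaled
  refine h6.congr_deriv ?_
  rw [scaleProfile_eq hθ]
  have h7 : ((-(κ * l⁻¹ * (τ l)⁻¹) * z.1, -(l⁻¹ * l⁻¹) • z.2) : ℝ × Space d)
      = (-l⁻¹) • (κ * ((τ l)⁻¹ * z.1), l⁻¹ • z.2) := by
    ext
    · simp; ring
    · simp; ring
  rw [h7, map_smul]
  simp
  ring

end Profiles

/-! ### Pointwise bounds of mollifications by averages of the data. -/

section Pointwise

set_option linter.unusedSectionVars false

variable {d : ℕ}

/-- The normalized indicator of the times `s` with `τ ≤ σ s ≤ 2 τ`. -/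
noncomputable def timeKernel (σ τ s : ℝ) : ℝ≥0∞ :=
  {s : ℝ | 1 ≤ σ * (τ⁻¹ * s) ∧ σ * (τ⁻¹ * s) ≤ 2}.indicator (fun _ => ENNReal.ofReal τ⁻¹) s

/-- The normalized indicator of the ball of radius `l`. -/
noncomputable def spaceKernel (l : ℝ) (y : Space d) : ℝ≥0∞ :=
  {y : Space d | ‖y‖ ≤ l}.indicator (fun _ => ENNReal.ofReal (l ^ d)⁻¹) y

/-- The average of `W` over a cylinder of duration `τ` and radius `l`. -/
noncomputable def avg (σ : ℝ) (W : ℝ × Space d → ℝ≥0∞) (τ l : ℝ) (z₀ : ℝ × Space d) : ℝ≥0∞ :=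
  ∫⁻ z, W z * (timeKernel σ τ (z₀ - z).1 * spaceKernel l (z₀ - z).2)

theorem measurable_timeKernel (σ : ℝ) : Measurable fun q : ℝ × ℝ => timeKernel σ q.1 q.2 := by
  have : (fun q : ℝ × ℝ => timeKernel σ q.1 q.2) =
      {q : ℝ × ℝ | 1 ≤ σ * (q.1⁻¹ * q.2) ∧ σ * (q.1⁻¹ * q.2) ≤ 2}.indicator
        fun q => ENNReal.ofReal q.1⁻¹ := rfl
  rw [this]
  have h1 : Measurable fun q : ℝ × ℝ => σ * (q.1⁻¹ * q.2) := by fun_prop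
  exact Measurable.indicator (by fun_prop)
    ((measurableSet_le measurable_const h1).inter (measurableSet_le h1 measurable_const))

theorem measurable_spaceKernel : Measurable fun q : ℝ × Space d => spaceKernel q.1 q.2 := by
  have : (fun q : ℝ × Space d => spaceKernel q.1 q.2) =
      {q : ℝ × Space d | ‖q.2‖ ≤ q.1}.indicator
        fun q => ENNReal.ofReal (q.1 ^ d)⁻¹ := rfl
  rw [this]
  exact Measurable.indicator (by fun_prop) (measurableSet_le (by fun_prop) (by fun_prop))

variable [NeZero d] {σ T : ℝ} {Ω : Set (Space d)}

theorem enorm_scaled_le {ψ : ℝ × Space d → ℝ} (hψ : IsProfile σ ψ) {M : ℝ} (hM0 : 0 ≤ M)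
    (hM : ∀ z, |ψ z| ≤ M) {τ l : ℝ} (hτ : 0 < τ) (hl : 0 < l) (ζ : ℝ × Space d) :
    ‖scaled ψ τ l ζ‖ₑ ≤ ENNReal.ofReal M * (timeKernel σ τ ζ.1 * spaceKernel l ζ.2) := by
  by_cases hζ : (τ⁻¹ * ζ.1, l⁻¹ • ζ.2) ∈ box d σ
  · obtain ⟨h1, h2, h3, -⟩ := hζ
    have h3' : ‖ζ.2‖ ≤ l := by
      simp only [norm_smul, norm_inv, Real.norm_eq_abs, abs_of_pos hl] at h3
      rwa [inv_mul_le_iff₀ hl, mul_one] at h3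
    unfold timeKernel spaceKernel
    rw [indicator_of_mem (by exact ⟨h1, h2⟩), indicator_of_mem (by exact h3'),
      ← ENNReal.ofReal_mul (by positivity), ← ENNReal.ofReal_mul hM0, Real.enorm_eq_ofReal_abs]
    refine ENNReal.ofReal_le_ofReal ?_
    unfold scaled
    rw [abs_mul, abs_of_pos (by positivity : 0 < τ⁻¹ * (l ^ d)⁻¹), mul_comm M]
    gcongr
    exact hM _
  · rw [scaled_eq_zero hψ hζ]; simp

theorem enorm_integral_scaled_le {Q : Set (ℝ × Space d)} {w : ℝ × Space d → ℝ}
    {W : ℝ × Space d → ℝ≥0∞} (hw : ∀ᵐ z ∂(volume.restrict Q), ‖w z‖ₑ ≤ W z)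
    {ψ : ℝ × Space d → ℝ} (hψ : IsProfile σ ψ) {M : ℝ} (hM0 : 0 ≤ M)
    (hM : ∀ z, |ψ z| ≤ M) {τ l : ℝ} (hτ : 0 < τ) (hl : 0 < l) (z₀ : ℝ × Space d) :
    ‖∫ z in Q, w z * scaled ψ τ l (z₀ - z)‖ₑ ≤ ENNReal.ofReal M * avg σ W τ l z₀ := by
  refine (enorm_integral_le_lintegral_enorm _).trans ?_
  unfold avg
  rw [← lintegral_const_mul' _ _ (by simp)]
  refine (lintegral_mono_ae ?_).trans (setLIntegral_le_lintegral Q _)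
  filter_upwards [hw] with z hz
  rw [enorm_mul, mul_left_comm]
  gcongr
  exact enorm_scaled_le hψ hM0 hM hτ hl _

theorem measurableSet_cylinder (hΩ : Ω = univ ∨ Ω = halfSpace d) :
    MeasurableSet (cylinder T Ω) := by
  refine measurableSet_Ioo.prod ?_
  rcases hΩ with rfl | rfl
  · exact MeasurableSet.univ
  · have h0 : Continuous fun x : Space d => x 0 := by fun_prop
    exact measurableSet_lt measurable_const h0.measurable

theorem integrableOn_mul_scaled (hσ : σ = 1 ∨ σ = -1) (hΩ : Ω = univ ∨ Ω = halfSpace d)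
    {u : ℝ × Space d → ℝ} (hu : LocallyIntegrableOn u (cylinder T Ω))
    {z₀ : ℝ × Space d} {τ l : ℝ} (h : Admissible σ T Ω z₀ τ) (hτ : 0 < τ) (hl : 0 < l)
    {ψ : ℝ × Space d → ℝ} (hψ : IsProfile σ ψ) :
    IntegrableOn (fun z => u z * scaled ψ τ l (z₀ - z)) (cylinder T Ω) := by
  have ht := isTestFunction_scaled hσ hΩ h hτ hl hψ
  have hK : IntegrableOn u (tsupport fun z => scaled ψ τ l (z₀ - z)) :=
    hu.integrableOn_compact_subset ht.tsupport_subset ht.hasCompactSupport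
  have h1 : IntegrableOn (fun z => u z * scaled ψ τ l (z₀ - z))
      (tsupport fun z => scaled ψ τ l (z₀ - z)) :=
    hK.mul_continuousOn ht.smooth.continuous.continuousOn ht.hasCompactSupport
  refine h1.of_forall_sdiff_eq_zero (measurableSet_cylinder hΩ) fun z hz => ?_
  have h0 : scaled ψ τ l (z₀ - z) = 0 := image_eq_zero_of_notMem_tsupport
    (f := fun z => scaled ψ τ l (z₀ - z)) hz.2
  rw [h0, mul_zero]

theorem IsProfile.scaleProfile {θ : ℝ × Space d → ℝ} (hθ : IsProfile σ θ) (κ : ℝ) :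
    IsProfile σ (scaleProfile κ θ) := by
  have h1 : IsProfile σ fun z => z.1 * θ z := hθ.mul_left contDiff_fst
  have h2 : ∀ i, IsProfile σ fun z => z.2 i * θ z := fun i => hθ.mul_left (by fun_prop)
  exact (h1.timeDeriv.mul_left (χ := fun _ => κ) contDiff_const).add
    (IsProfile.sum Finset.univ fun i => (h2 i).spaceDeriv i)

theorem continuousOn_scaled_path {ψ : ℝ × Space d → ℝ} (hψ : IsProfile σ ψ) {τ : ℝ → ℝ} {a b : ℝ}
    (ha : 0 < a) (hτ0 : ∀ l ∈ Icc a b, 0 < τ l) (hτ : ContinuousOn τ (Icc a b))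
    (z₀ : ℝ × Space d) :
    ContinuousOn (fun q : ℝ × (ℝ × Space d) => scaled ψ (τ q.1) q.1 (z₀ - q.2))
      (Icc a b ×ˢ univ) := by
  have h1 : ContinuousOn (fun q : ℝ × (ℝ × Space d) => (τ q.1)⁻¹) (Icc a b ×ˢ univ) :=
    (hτ.comp continuousOn_fst fun q hq => hq.1).inv₀ fun q hq => (hτ0 _ hq.1).ne'
  have h2 : ContinuousOn (fun q : ℝ × (ℝ × Space d) => q.1⁻¹) (Icc a b ×ˢ univ) :=
    continuousOn_fst.inv₀ fun q hq => (ha.trans_le hq.1.1).ne'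
  have h3 : ContinuousOn (fun q : ℝ × (ℝ × Space d) => (q.1 ^ d)⁻¹) (Icc a b ×ˢ univ) :=
    (continuousOn_fst.pow d).inv₀ fun q hq => (pow_pos (ha.trans_le hq.1.1) d).ne'
  have h4 : ContinuousOn (fun q : ℝ × (ℝ × Space d) =>
      (((τ q.1)⁻¹ * (z₀ - q.2).1, q.1⁻¹ • (z₀ - q.2).2) : ℝ × Space d)) (Icc a b ×ˢ univ) :=
    (h1.mul (by fun_prop)).prodMk (h2.smul (by fun_prop))
  exact (h1.mul h3).mul (hψ.smooth.continuous.comp_continuousOn h4)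

/-- Over a compact interval of scales the supports of the mollifiers fill a compact subset of the
cylinder, so `enorm_setIntegral_path_le` applies to the path of `hasDerivAt_scaled`. -/
theorem enorm_integral_scaled_path_le (hσ : σ = 1 ∨ σ = -1) (hΩ : Ω = univ ∨ Ω = halfSpace d)
    {u : ℝ × Space d → ℝ} (hu : LocallyIntegrableOn u (cylinder T Ω)) {κ : ℝ} {τ : ℝ → ℝ}
    (hτ0 : ∀ l, 0 < l → 0 < τ l) (hτ : ∀ l, 0 < l → HasDerivAt τ (κ * τ l / l) l)
    {z₀ : ℝ × Space d} {a b : ℝ} (ha : 0 < a) (hab : a ≤ b)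
    (h : ∀ l ∈ Icc a b, Admissible σ T Ω z₀ (τ l))
    {θ : ℝ × Space d → ℝ} (hθ : IsProfile σ θ) :
    ‖∫ z in cylinder T Ω, u z * scaled θ (τ a) a (z₀ - z)‖ₑ
      ≤ ‖∫ z in cylinder T Ω, u z * scaled θ (τ b) b (z₀ - z)‖ₑ
        + ∫⁻ l in Ioo a b,
          ‖∫ z in cylinder T Ω, u z * -(l⁻¹ * scaled (scaleProfile κ θ) (τ l) l (z₀ - z))‖ₑ := by
  have hpos : ∀ l ∈ Icc a b, 0 < l := fun l hl => ha.trans_le hl.1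
  have hτc : ContinuousOn τ (Icc a b) := fun l hl =>
    (hτ l (hpos l hl)).continuousAt.continuousWithinAt
  set K := (fun q : ℝ × (ℝ × Space d) => z₀ - (τ q.1 * q.2.1, q.1 • q.2.2)) ''
    (Icc a b ×ˢ box d σ) with hK
  have hKc : IsCompact K := by
    refine (isCompact_Icc.prod (isCompact_box hσ)).image_of_continuousOn ?_
    have h1 : ContinuousOn (fun q : ℝ × (ℝ × Space d) => τ q.1) (Icc a b ×ˢ box d σ) :=
      hτc.comp continuousOn_fst fun q hq => hq.1
    exact continuousOn_const.sub ((h1.mul (by fun_prop)).prodMk (by fun_prop))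
  have hKQ : K ⊆ cylinder T Ω := by
    rintro _ ⟨q, hq, rfl⟩
    exact (h q.1 hq.1).sub_mem hσ hΩ (hτ0 _ (hpos _ hq.1)) (hpos _ hq.1) hq.2
  have hzero : ∀ ψ : ℝ × Space d → ℝ, IsProfile σ ψ → ∀ l ∈ Icc a b, ∀ z, z ∉ K →
      scaled ψ (τ l) l (z₀ - z) = 0 := by
    intro ψ hψ l hl z hz
    refine scaled_eq_zero hψ fun hmem => hz ?_
    obtain ⟨ζ, hζ, rfl⟩ := mem_image_box (hτ0 l (hpos l hl)).ne' (hpos l hl).ne' hmem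
    exact ⟨(l, ζ), ⟨hl, hζ⟩, rfl⟩
  refine enorm_setIntegral_path_le (k := fun l z => scaled θ (τ l) l (z₀ - z))
    (measurableSet_cylinder hΩ) hKc hKQ (hu.integrableOn_compact_subset hKQ hKc) hab
    (fun l hl z => hasDerivAt_scaled hθ.differentiable (hpos l hl) (hτ0 l (hpos l hl))
      (hτ l (hpos l hl)) _)
    (fun l hl => (contDiff_scaled hθ.smooth _ _).continuous.comp (continuous_sub_left z₀)) ?_
    (hzero θ hθ) ?_
  · refine (ContinuousOn.mul ?_ (continuousOn_scaled_path (hθ.scaleProfile κ) ha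
      (fun l hl => hτ0 l (hpos l hl)) hτc z₀)).neg
    exact continuousOn_fst.inv₀ fun q hq => (hpos _ hq.1).ne'
  · intro l hl z hz
    rw [hzero _ (hθ.scaleProfile κ) l hl z hz]
    simp

theorem integral_scaleProfile (hσ : σ = 1 ∨ σ = -1) (hΩ : Ω = univ ∨ Ω = halfSpace d)
    {u : ℝ × Space d → ℝ} (hu : LocallyIntegrableOn u (cylinder T Ω)) (κ : ℝ)
    {z₀ : ℝ × Space d} {τ l : ℝ} (h : Admissible σ T Ω z₀ τ) (hτ : 0 < τ) (hl : 0 < l)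
    {θ : ℝ × Space d → ℝ} (hθ : IsProfile σ θ) :
    ∫ z in cylinder T Ω, u z * -(l⁻¹ * scaled (scaleProfile κ θ) τ l (z₀ - z))
      = -(l⁻¹ * (κ * (∫ z in cylinder T Ω,
            u z * scaled (timeDeriv fun z => z.1 * θ z) τ l (z₀ - z))
          + ∑ i, ∫ z in cylinder T Ω,
            u z * scaled (spaceDeriv i fun z => z.2 i * θ z) τ l (z₀ - z))) := by
  have h1 : IsProfile σ fun z => z.1 * θ z := hθ.mul_left contDiff_fst
  have h2 : ∀ i, IsProfile σ fun z => z.2 i * θ z := fun i => hθ.mul_left (by fun_prop)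
  have hi1 := integrableOn_mul_scaled hσ hΩ hu h hτ hl h1.timeDeriv
  have hi2 := fun i => integrableOn_mul_scaled hσ hΩ hu h hτ hl ((h2 i).spaceDeriv i)
  rw [← integral_finsetSum _ fun i _ => hi2 i, ← integral_const_mul,
    ← integral_add (hi1.const_mul κ) (integrable_finsetSum _ fun i _ => hi2 i),
    ← integral_const_mul, ← integral_neg]
  refine integral_congr_ae (Eventually.of_forall fun z => ?_)
  simp only [scaled, scaleProfile, Finset.mul_sum, mul_add, ← Finset.sum_neg_distrib, neg_add]
  congr 1
  · ring
  · exact Finset.sum_congr rfl fun i _ => by ring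

theorem exists_profile_bound (hσ : σ = 1 ∨ σ = -1) {θ : ℝ × Space d → ℝ} (hθ : IsProfile σ θ) :
    ∃ M : ℝ, 0 < M ∧ (∀ z, |θ z| ≤ M) ∧ (∀ z : ℝ × Space d, |z.1 * θ z| ≤ M) ∧
      (∀ (i : Fin d) (z : ℝ × Space d), |z.2 i * θ z| ≤ M) ∧
      ∀ i z, |spaceDeriv i (fun z => z.1 * θ z) z| ≤ M := by
  have h1 : IsProfile σ fun z => z.1 * θ z := hθ.mul_left contDiff_fst
  have h2 : ∀ i, IsProfile σ fun z => z.2 i * θ z := fun i => hθ.mul_left (by fun_prop)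
  obtain ⟨M1, hM1, hM1'⟩ := hθ.exists_bound hσ
  obtain ⟨M2, hM2, hM2'⟩ := h1.exists_bound hσ
  choose M3 hM3 hM3' using fun i => (h2 i).exists_bound hσ
  choose M4 hM4 hM4' using fun i => (h1.spaceDeriv i).exists_bound hσ
  have s3 : ∀ i, M3 i ≤ ∑ i, M3 i := fun i =>
    Finset.single_le_sum (fun i _ => (hM3 i).le) (Finset.mem_univ i)
  have s4 : ∀ i, M4 i ≤ ∑ i, M4 i := fun i =>
    Finset.single_le_sum (fun i _ => (hM4 i).le) (Finset.mem_univ i)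
  have p3 : 0 ≤ ∑ i, M3 i := Finset.sum_nonneg fun i _ => (hM3 i).le
  have p4 : 0 ≤ ∑ i, M4 i := Finset.sum_nonneg fun i _ => (hM4 i).le
  refine ⟨M1 + M2 + ∑ i, M3 i + ∑ i, M4 i, by positivity, fun z => ?_, fun z => ?_,
    fun i z => ?_, fun i z => ?_⟩
  · linarith [hM1' z]
  · linarith [hM2' z]
  · linarith [hM3' i z, s3 i]
  · linarith [hM4' i z, s4 i]

theorem enorm_coord_le {E : Type*} {g : E → Space d} {i : Fin d} (z : E) : ‖g z i‖ₑ ≤ ‖g z‖ₑ := by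
  rw [enorm_le_iff_norm_le]
  exact PiLp.norm_apply_le (g z) i

theorem Admissible.mono (hσ : σ = 1 ∨ σ = -1) {z₀ : ℝ × Space d} {τ τ' : ℝ}
    (h : Admissible σ T Ω z₀ τ) (h0 : 0 ≤ τ') (hle : τ' ≤ τ) : Admissible σ T Ω z₀ τ' := by
  obtain ⟨h5, ⟨h6, h7⟩, ⟨h8, h9⟩⟩ := h
  refine ⟨h5, ⟨h6, h7⟩, ?_⟩
  rcases hσ with rfl | rfl <;> constructor <;> nlinarith

/-- Pointwise estimate of the mollification at scales `(ε, a)` by averages of the gradient. -/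
theorem elliptic_pointwise (hσ : σ = 1 ∨ σ = -1) {θ : ℝ × Space d → ℝ} (hθ : IsProfile σ θ) :
    ∃ C : ℝ≥0, ∀ (T : ℝ) (Ω : Set (Space d)), (Ω = univ ∨ Ω = halfSpace d) →
      ∀ (u : ℝ × Space d → ℝ) (w : ℝ × Space d → Space d), IsWeakSpatialGradient T Ω u w →
      ∀ U W : ℝ × Space d → ℝ≥0∞, (∀ᵐ z ∂(volume.restrict (cylinder T Ω)), ‖u z‖ₑ ≤ U z) →
      (∀ᵐ z ∂(volume.restrict (cylinder T Ω)), ‖w z‖ₑ ≤ W z) →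
      ∀ (z₀ : ℝ × Space d) (ε a b : ℝ), 0 < ε → 0 < a → a ≤ b → Admissible σ T Ω z₀ ε →
      ‖∫ z in cylinder T Ω, u z * scaled θ ε a (z₀ - z)‖ₑ
        ≤ C * (avg σ U ε b z₀ + ∫⁻ l in Ioo 0 b, avg σ W ε l z₀) := by
  obtain ⟨M, hM0, hM1, -, hM3, -⟩ := exists_profile_bound hσ hθ
  have h2 : ∀ i, IsProfile σ fun z => z.2 i * θ z := fun i => hθ.mul_left (by fun_prop)
  refine ⟨(ENNReal.ofReal M + d * ENNReal.ofReal M).toNNReal,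
    fun T Ω hΩ u w hu U W hU hW z₀ ε a b hε ha hab h => ?_⟩
  rw [ENNReal.coe_toNNReal (by finiteness), mul_add]
  -- With `κ = 0` the scale derivative is a purely spatial divergence, and only the weak gradient is
  -- needed.
  refine (enorm_integral_scaled_path_le hσ hΩ hu.locallyIntegrable (κ := 0) (τ := fun _ => ε)
    (fun _ _ => hε) (fun l _ => by simpa using hasDerivAt_const l ε) ha hab (fun _ _ => h) hθ).trans ?_
  gcongr
  · refine (enorm_integral_scaled_le hU hθ hM0.le hM1 hε (ha.trans_le hab) z₀).trans ?_
    gcongr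
    exact le_self_add
  · rw [← lintegral_const_mul' _ _ (by finiteness)]
    refine (setLIntegral_mono' measurableSet_Ioo fun l hl => ?_).trans
      (lintegral_mono_set (Ioo_subset_Ioo_left ha.le))
    have hl0 : 0 < l := ha.trans hl.1
    rw [integral_scaleProfile hσ hΩ hu.locallyIntegrable 0 h hε hl0 hθ]
    have h3 := fun i => hu.integral_scaled hσ hΩ h hε hl0 (h2 i) i
    simp only [h3, zero_mul, zero_add, ← Finset.mul_sum]
    rw [inv_mul_cancel_left₀ hl0.ne', enorm_neg]
    refine (enorm_sum_le _ _).trans ?_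
    refine (Finset.sum_le_sum fun i _ => enorm_integral_scaled_le (W := W)
      (hW.mono fun z hz => (enorm_coord_le z).trans hz) (h2 i) hM0.le (hM3 i) hε hl0 z₀).trans ?_
    simp only [Finset.sum_const, Finset.card_univ, Fintype.card_fin, nsmul_eq_mul]
    rw [← mul_assoc]
    gcongr
    exact le_add_self

/-- Pointwise estimate of the mollification at parabolic scale `a` by averages of the data. -/
theorem parabolic_pointwise (hσ : σ = 1 ∨ σ = -1) {θ : ℝ × Space d → ℝ} (hθ : IsProfile σ θ) :
    ∃ C : ℝ≥0, ∀ (T : ℝ) (Ω : Set (Space d)), (Ω = univ ∨ Ω = halfSpace d) →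
      ∀ (m : ℕ) (u : ℝ × Space d → ℝ) (w g : ℝ × Space d → Space d)
      (f : Fin m → ℝ × Space d → ℝ), IsWeakSpatialGradient T Ω u w → SolvesDistrib T Ω u g f →
      ∀ (U W H : ℝ × Space d → ℝ≥0∞) (F : Fin m → ℝ × Space d → ℝ≥0∞),
      (∀ᵐ z ∂(volume.restrict (cylinder T Ω)), ‖u z‖ₑ ≤ U z) →
      (∀ᵐ z ∂(volume.restrict (cylinder T Ω)), ‖w z‖ₑ ≤ W z) →
      (∀ᵐ z ∂(volume.restrict (cylinder T Ω)), ‖g z‖ₑ ≤ H z) →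
      (∀ k, ∀ᵐ z ∂(volume.restrict (cylinder T Ω)), ‖f k z‖ₑ ≤ F k z) →
      ∀ (z₀ : ℝ × Space d) (a b : ℝ), 0 < a → a ≤ b → Admissible σ T Ω z₀ (b ^ 2) →
      ‖∫ z in cylinder T Ω, u z * scaled θ (a ^ 2) a (z₀ - z)‖ₑ
        ≤ C * (avg σ U (b ^ 2) b z₀ + ∫⁻ l in Ioo 0 b, (avg σ W (l ^ 2) l z₀
          + avg σ H (l ^ 2) l z₀ + ENNReal.ofReal l * ∑ k, avg σ (F k) (l ^ 2) l z₀)) := by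
  obtain ⟨M, hM0, hM1, hM2, hM3, hM4⟩ := exists_profile_bound hσ hθ
  have h1 : IsProfile σ fun z => z.1 * θ z := hθ.mul_left contDiff_fst
  have h2 : ∀ i, IsProfile σ fun z => z.2 i * θ z := fun i => hθ.mul_left (by fun_prop)
  refine ⟨(ENNReal.ofReal (2 * (d + 1) * M)).toNNReal,
    fun T Ω hΩ m u w g f hu hs U W H F hU hW hH hF z₀ a b ha hab h => ?_⟩
  have hd : (0 : ℝ) ≤ d := Nat.cast_nonneg d
  rw [ENNReal.coe_toNNReal (by finiteness), mul_add]
  have hadm : ∀ l ∈ Icc a b, Admissible σ T Ω z₀ (l ^ 2) := fun l hl =>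
    h.mono hσ (by positivity) (pow_le_pow_left₀ (ha.le.trans hl.1) hl.2 2)
  refine (enorm_integral_scaled_path_le hσ hΩ hu.locallyIntegrable (κ := 2) (τ := fun l => l ^ 2)
    (fun _ h => by positivity) (fun l h => ?_) ha hab hadm hθ).trans ?_
  · refine (hasDerivAt_pow 2 l).congr_deriv ?_
    field_simp
    norm_num
  gcongr
  · refine (enorm_integral_scaled_le hU hθ hM0.le hM1 (by have := ha.trans_le hab; positivity)
      (ha.trans_le hab) z₀).trans ?_
    gcongr
    nlinarith
  · rw [← lintegral_const_mul' _ _ (by finiteness)]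
    refine (setLIntegral_mono' measurableSet_Ioo fun l hl => ?_).trans
      (lintegral_mono_set (Ioo_subset_Ioo_left ha.le))
    have hl0 : 0 < l := ha.trans hl.1
    have hll := hadm l (Ioo_subset_Icc_self hl)
    have hl2 : 0 < l ^ 2 := by positivity
    rw [integral_scaleProfile hσ hΩ hu.locallyIntegrable 2 hll hl2 hl0 hθ,
      hs.integral_scaled hσ hΩ hll hl2 hl0 h1]
    have h3 := fun i => hu.integral_scaled hσ hΩ hll hl2 hl0 (h2 i) i
    simp only [h3, ← Finset.mul_sum]
    have b1 : ‖∑ i, ∫ z in cylinder T Ω, w z i * scaled (fun z => z.2 i * θ z) (l ^ 2) l (z₀ - z)‖ₑ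
        ≤ d * (ENNReal.ofReal M * avg σ W (l ^ 2) l z₀) := by
      refine (enorm_sum_le _ _).trans ?_
      refine (Finset.sum_le_sum fun i _ => enorm_integral_scaled_le (W := W)
        (hW.mono fun z hz => (enorm_coord_le z).trans hz) (h2 i) hM0.le (hM3 i) hl2 hl0 z₀).trans ?_
      simp
    have b2 : ‖∑ i, ∫ z in cylinder T Ω,
        g z i * scaled (spaceDeriv i fun z => z.1 * θ z) (l ^ 2) l (z₀ - z)‖ₑ
        ≤ d * (ENNReal.ofReal M * avg σ H (l ^ 2) l z₀) := by
      refine (enorm_sum_le _ _).trans ?_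
      refine (Finset.sum_le_sum fun i _ => enorm_integral_scaled_le (W := H)
        (hH.mono fun z hz => (enorm_coord_le z).trans hz) (h1.spaceDeriv i) hM0.le (hM4 i)
        hl2 hl0 z₀).trans ?_
      simp
    have b3 : ‖∑ k, ∫ z in cylinder T Ω, f k z * scaled (fun z => z.1 * θ z) (l ^ 2) l (z₀ - z)‖ₑ
        ≤ ENNReal.ofReal M * ∑ k, avg σ (F k) (l ^ 2) l z₀ := by
      refine (enorm_sum_le _ _).trans ?_
      rw [Finset.mul_sum]
      exact Finset.sum_le_sum fun k _ => enorm_integral_scaled_le (hF k) h1 hM0.le hM2 hl2 hl0 z₀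
    set S1 := ∑ i, ∫ z in cylinder T Ω, w z i * scaled (fun z => z.2 i * θ z) (l ^ 2) l (z₀ - z)
    set S2 := ∑ i, ∫ z in cylinder T Ω,
        g z i * scaled (spaceDeriv i fun z => z.1 * θ z) (l ^ 2) l (z₀ - z)
    set S3 := ∑ k, ∫ z in cylinder T Ω, f k z * scaled (fun z => z.1 * θ z) (l ^ 2) l (z₀ - z)
    -- The powers of `l` cancel for the gradient and for `g`; one factor `l` survives for the `f_k`.
    -- This fixes the orders `1` and `2` of the two potentials.
    have e1 : -(l⁻¹ * (2 * (l ^ 2 * (l⁻¹ * S2 + S3)) + l * S1)) = -(S1 + 2 * S2 + 2 * l * S3) := by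
      field_simp
      ring
    rw [e1, enorm_neg]
    refine (enorm_add_le _ _).trans ((add_le_add (enorm_add_le _ _) le_rfl).trans ?_)
    rw [enorm_mul, enorm_mul]
    have e2 : ‖(2 : ℝ)‖ₑ = ENNReal.ofReal 2 := by rw [Real.enorm_eq_ofReal]; norm_num
    have e3 : ‖2 * l‖ₑ = ENNReal.ofReal 2 * ENNReal.ofReal l := by
      rw [Real.enorm_eq_ofReal (by positivity), ENNReal.ofReal_mul (by norm_num)]
    rw [e2, e3, mul_add, mul_add]
    have hdc : (d : ℝ≥0∞) = ENNReal.ofReal d := by simp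
    rw [hdc, ← mul_assoc, ← ENNReal.ofReal_mul hd] at b1 b2
    gcongr ?_ + ?_ + ?_
    · refine b1.trans ?_
      gcongr
      nlinarith
    · refine (mul_le_mul_right b2 _).trans ?_
      rw [← mul_assoc, ← ENNReal.ofReal_mul (by norm_num)]
      exact mul_le_mul_left (ENNReal.ofReal_le_ofReal (by nlinarith)) _
    · refine (mul_le_mul_right b3 _).trans ?_
      have e4 : ENNReal.ofReal 2 * ENNReal.ofReal l * (ENNReal.ofReal M *
          ∑ k, avg σ (F k) (l ^ 2) l z₀) = ENNReal.ofReal (2 * M) *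
          (ENNReal.ofReal l * ∑ k, avg σ (F k) (l ^ 2) l z₀) := by
        rw [ENNReal.ofReal_mul (by norm_num)]; ring
      rw [e4]
      gcongr
      nlinarith

theorem hasDerivAt_scaled_line {θ : ℝ × Space d → ℝ} (hθ : Differentiable ℝ θ) (τ l : ℝ)
    (i : Fin d) (c : ℝ × Space d) (r : ℝ) :
    HasDerivAt (fun r : ℝ => scaled θ τ l (c + r • ((0, EuclideanSpace.single i 1) : ℝ × Space d)))
      (l⁻¹ * scaled (spaceDeriv i θ) τ l
        (c + r • ((0, EuclideanSpace.single i 1) : ℝ × Space d))) r := by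
  set e : ℝ × Space d := (0, EuclideanSpace.single i 1) with he
  have hd : Differentiable ℝ fun z => scaled θ τ l (c - z) := by
    unfold scaled
    fun_prop
  have h1 : HasDerivAt (fun r : ℝ => -(r • e)) (-e) r :=
    HasDerivAt.congr_deriv ((hasDerivAt_id r).smul_const e).neg (by rw [one_smul])
  have h2 := (hd (-(r • e))).hasFDerivAt.comp_hasDerivAt r h1
  have h3 := spaceDeriv_scaled_sub hθ τ l i c (-(r • e))
  simp only [spaceDeriv] at h3
  rw [map_neg, h3] at h2
  simp only [neg_neg, sub_neg_eq_add] at h2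
  refine HasDerivAt.congr_of_eventuallyEq h2 (Eventually.of_forall fun r => ?_)
  simp

/-- One-dimensional estimate of the mollification along coordinate lines. -/
theorem line_pointwise (hσ : σ = 1 ∨ σ = -1) {θ : ℝ × Space d → ℝ} (hθ : IsProfile σ θ) :
    ∃ C : ℝ≥0, ∀ (T : ℝ) (Ω : Set (Space d)), (Ω = univ ∨ Ω = halfSpace d) →
      ∀ (u : ℝ × Space d → ℝ) (w : ℝ × Space d → Space d), IsWeakSpatialGradient T Ω u w →
      ∀ U W : ℝ × Space d → ℝ≥0∞, (∀ᵐ z ∂(volume.restrict (cylinder T Ω)), ‖u z‖ₑ ≤ U z) →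
      (∀ᵐ z ∂(volume.restrict (cylinder T Ω)), ‖w z‖ₑ ≤ W z) →
      ∀ (t : ℝ) (x : Space d) (τ l : ℝ), 0 < τ → 0 < l → Admissible σ T Ω (t, x) τ →
      ∀ i : Fin d,
      ‖∫ z in cylinder T Ω, u z * scaled θ τ l ((t, x) - z)‖ₑ
        ≤ C * ∫⁻ r in Ioo (0 : ℝ) 1, (avg σ U τ l (t, x + EuclideanSpace.single i r)
          + avg σ W τ l (t, x + EuclideanSpace.single i r)) := by
  obtain ⟨M, hM0, hM1⟩ := hθ.exists_bound hσ
  refine ⟨(ENNReal.ofReal M).toNNReal, fun T Ω hΩ u w hu U W hU hW t x τ l hτ hl h i => ?_⟩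
  rw [ENNReal.coe_toNNReal (by finiteness)]
  set e : ℝ × Space d := (0, EuclideanSpace.single i 1) with he
  set z₀ : ℝ × Space d := (t, x)
  have hze : ∀ r : ℝ, z₀ + r • e = (t, x + EuclideanSpace.single i r) := fun r => by
    simp only [e, z₀, Prod.smul_mk, smul_zero, Prod.mk_add_mk, add_zero, Prod.mk.injEq, true_and]
    congr 1
    ext j
    simp
  -- A translation by a nonnegative multiple of a coordinate vector does not leave the half-space.
  have hadm : ∀ r ∈ Icc (0 : ℝ) 1, Admissible σ T Ω (z₀ + r • e) τ := by
    intro r hr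
    rw [hze]
    refine ⟨?_, h.time, h.time'⟩
    have h0 := h.space
    rcases hΩ with rfl | rfl
    · trivial
    · change 0 < (x + EuclideanSpace.single i r) 0
      have h0 : 0 < x 0 := h0
      have : 0 ≤ (EuclideanSpace.single i r : Space d) 0 := by
        simp only [PiLp.single_apply]
        split_ifs
        · exact hr.1
        · exact le_rfl
      simp only [PiLp.add_apply]
      linarith
  set K := (fun q : ℝ × (ℝ × Space d) => z₀ + q.1 • e - (τ * q.2.1, l • q.2.2)) ''
    (Icc 0 1 ×ˢ box d σ) with hK
  have hKc : IsCompact K := (isCompact_Icc.prod (isCompact_box hσ)).image (by fun_prop)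
  have hKQ : K ⊆ cylinder T Ω := by
    rintro _ ⟨q, hq, rfl⟩
    exact (hadm q.1 hq.1).sub_mem hσ hΩ hτ hl hq.2
  have hzero : ∀ ψ : ℝ × Space d → ℝ, IsProfile σ ψ → ∀ r ∈ Icc (0 : ℝ) 1, ∀ z, z ∉ K →
      scaled ψ τ l (z₀ + r • e - z) = 0 := by
    intro ψ hψ r hr z hz
    refine scaled_eq_zero hψ fun hmem => hz ?_
    obtain ⟨ζ, hζ, rfl⟩ := mem_image_box hτ.ne' hl.ne' hmem
    exact ⟨(r, ζ), ⟨hr, hζ⟩, rfl⟩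
  have hcomm : ∀ (r : ℝ) z, z₀ + r • e - z = z₀ - z + r • e := fun r z => by abel
  -- The cutoff `1 - r` removes the endpoint `r = 1`, so no decay of `u` along the line is required.
  -- Its derivative accounts for the average of `U`.
  have key := enorm_setIntegral_path_le (μ := volume) (v := u)
    (k := fun r z => (1 - r) * scaled θ τ l (z₀ + r • e - z))
    (k' := fun r z => -scaled θ τ l (z₀ + r • e - z)
      + (1 - r) * (l⁻¹ * scaled (spaceDeriv i θ) τ l (z₀ + r • e - z)))
    (measurableSet_cylinder (T := T) hΩ) hKc hKQ
    (hu.locallyIntegrable.integrableOn_compact_subset hKQ hKc) zero_le_one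
    (fun r _ z => by
      have h1 := ((hasDerivAt_id r).const_sub 1).mul
        (hasDerivAt_scaled_line hθ.differentiable τ l i (z₀ - z) r)
      simp only [hcomm]
      refine h1.congr_deriv ?_
      simp [e])
    (fun r _ => continuous_const.mul
      ((contDiff_scaled hθ.smooth _ _).continuous.comp (continuous_sub_left _)))
    (by
      have c1 := (contDiff_scaled hθ.smooth τ l).continuous
      have c2 := (contDiff_scaled (hθ.spaceDeriv i).smooth τ l).continuous
      fun_prop)
    (fun r hr z hz => by rw [hzero θ hθ r hr z hz, mul_zero])
    (fun r hr z hz => by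
      rw [hzero θ hθ r hr z hz, hzero _ (hθ.spaceDeriv i) r hr z hz]; simp)
  simp only [zero_smul, add_zero, sub_zero, one_mul, sub_self, zero_mul, mul_zero, integral_zero,
    enorm_zero, zero_add] at key
  refine key.trans ?_
  rw [← lintegral_const_mul' _ _ (by finiteness)]
  refine setLIntegral_mono' measurableSet_Ioo fun r hr => ?_
  have hr' := hadm r (Ioo_subset_Icc_self hr)
  have hi1 := integrableOn_mul_scaled hσ hΩ hu.locallyIntegrable hr' hτ hl hθ
  have hi2 := integrableOn_mul_scaled hσ hΩ hu.locallyIntegrable hr' hτ hl (hθ.spaceDeriv i)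
  have e1 : ∫ z in cylinder T Ω, u z * (-scaled θ τ l (z₀ + r • e - z)
      + (1 - r) * (l⁻¹ * scaled (spaceDeriv i θ) τ l (z₀ + r • e - z)))
      = -(∫ z in cylinder T Ω, u z * scaled θ τ l (z₀ + r • e - z))
        + (1 - r) * ∫ z in cylinder T Ω, w z i * scaled θ τ l (z₀ + r • e - z) := by
    have h3 := hu.integral_scaled hσ hΩ hr' hτ hl hθ i
    have h4 : ∫ z in cylinder T Ω, w z i * scaled θ τ l (z₀ + r • e - z)
        = l⁻¹ * ∫ z in cylinder T Ω, u z * scaled (spaceDeriv i θ) τ l (z₀ + r • e - z) := by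
      rw [h3, inv_mul_cancel_left₀ hl.ne']
    rw [h4, ← mul_assoc, ← integral_const_mul, ← integral_neg,
      ← integral_add (f := fun z => -(u z * scaled θ τ l (z₀ + r • e - z))) hi1.neg (hi2.const_mul _)]
    refine integral_congr_ae (Eventually.of_forall fun z => ?_)
    ring
  rw [e1]
  refine (enorm_add_le _ _).trans ?_
  rw [enorm_neg, enorm_mul, mul_add, ← hze]
  refine add_le_add ?_ ?_
  · exact enorm_integral_scaled_le hU hθ hM0.le hM1 hτ hl _
  · refine (mul_le_of_le_one_left zero_le ?_).trans
      (enorm_integral_scaled_le (W := W) (hW.mono fun z hz => (enorm_coord_le z).trans hz)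
        hθ hM0.le hM1 hτ hl _)
    rw [Real.enorm_eq_ofReal (by linarith [hr.2])]
    rw [ENNReal.ofReal_le_one]
    linarith [hr.1]

end Pointwise

/-! ### Mixed-norm bounds for averages and their potentials. -/

section MixedBounds

set_option linter.unusedSectionVars false

variable {d : ℕ}

/-- The mixed norm on `ℝ × ℝ^d` of a function with values in `[0, ∞]`. -/
noncomputable def mixed (p q : ℝ≥0∞) (W : ℝ × Space d → ℝ≥0∞) : ℝ≥0∞ :=
  eLpNorm (fun t : ℝ => eLpNorm (fun x : Space d => W (t, x)) p volume) q volume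

variable [NeZero d] {σ : ℝ}

theorem isKernelFamily_spaceKernel :
    ∃ C : ℝ, IsKernelFamily (volume : Measure (Space d)) d C spaceKernel := by
  have hV : volume (Metric.closedBall (0 : Space d) 1) ≠ ∞ :=
    (isCompact_closedBall (0 : Space d) 1).measure_lt_top.ne
  set V := (volume (Metric.closedBall (0 : Space d) 1)).toReal
  have hV0 : 0 ≤ V := ENNReal.toReal_nonneg
  -- The one serves the supremum `l^(-d)`, the volume `V` of the unit ball serves the mass.
  refine ⟨1 + V, by positivity, measurable_spaceKernel, fun l hl y => ?_, fun l hl => ?_⟩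
  · refine (indicator_le_self' (fun _ _ => zero_le) y).trans (ENNReal.ofReal_le_ofReal ?_)
    rw [Real.rpow_neg hl.le, Real.rpow_natCast]
    exact le_mul_of_one_le_left (by positivity) (by linarith)
  · have hset : {y : Space d | ‖y‖ ≤ l} = Metric.closedBall 0 l := by
      ext y; simp
    unfold spaceKernel
    rw [hset, lintegral_indicator_const Metric.isClosed_closedBall.measurableSet,
      Measure.addHaar_closedBall _ _ hl.le, ← Measure.addHaar_closedBall_eq_addHaar_ball,
      finrank_euclideanSpace_fin,
      ← mul_assoc, ← ENNReal.ofReal_mul (by positivity), inv_mul_cancel₀ (by positivity)]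
    rw [← ENNReal.ofReal_toReal hV, ← ENNReal.ofReal_mul zero_le_one]
    exact ENNReal.ofReal_le_ofReal (by linarith)

theorem lintegral_timeKernel_le (hσ : σ = 1 ∨ σ = -1) {τ : ℝ} (hτ : 0 < τ) :
    ∫⁻ s, timeKernel σ τ s ≤ 1 := by
  have hsub : {s : ℝ | 1 ≤ σ * (τ⁻¹ * s) ∧ σ * (τ⁻¹ * s) ≤ 2}
      ⊆ Icc (3 / 2 * σ * τ - τ / 2) (3 / 2 * σ * τ + τ / 2) := by
    rintro s ⟨h1, h2⟩
    have e : σ * (τ⁻¹ * s) = σ * s / τ := by field_simp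
    rw [e, le_div_iff₀ hτ] at h1
    rw [e, div_le_iff₀ hτ] at h2
    rcases hσ with rfl | rfl <;> constructor <;> linarith
  unfold timeKernel
  calc _ ≤ ∫⁻ s, (Icc (3 / 2 * σ * τ - τ / 2) (3 / 2 * σ * τ + τ / 2)).indicator
        (fun _ => ENNReal.ofReal τ⁻¹) s :=
        lintegral_mono fun s => indicator_le_indicator_of_subset hsub (fun _ => zero_le) s
    _ = 1 := by
        rw [lintegral_indicator_const measurableSet_Icc, Real.volume_Icc,
          ← ENNReal.ofReal_mul (by positivity)]
        have : τ⁻¹ * (3 / 2 * σ * τ + τ / 2 - (3 / 2 * σ * τ - τ / 2)) = 1 := by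
          field_simp; ring
        rw [this, ENNReal.ofReal_one]

theorem measurable_spaceKernel_comp {γ : Type*} [MeasurableSpace γ] {f : γ → ℝ} {g : γ → Space d}
    (hf : Measurable f) (hg : Measurable g) : Measurable fun c => spaceKernel (f c) (g c) := by
  have := (measurable_spaceKernel (d := d)).comp (hf.prodMk hg)
  exact this

theorem measurable_timeKernel_comp {γ : Type*} [MeasurableSpace γ] {f g : γ → ℝ}
    (hf : Measurable f) (hg : Measurable g) : Measurable fun c => timeKernel σ (f c) (g c) := by
  have := (measurable_timeKernel σ).comp (hf.prodMk hg)
  exact this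

theorem measurable_spaceKernel_apply (l : ℝ) : Measurable (spaceKernel (d := d) l) :=
  measurable_spaceKernel_comp measurable_const measurable_id

theorem measurable_timeKernel_apply (σ τ : ℝ) : Measurable (timeKernel σ τ) :=
  measurable_timeKernel_comp measurable_const measurable_id

theorem isKernelFamily_timeKernel (hσ : σ = 1 ∨ σ = -1) :
    IsKernelFamily (volume : Measure ℝ) 2 1 fun l => timeKernel σ (l ^ 2) := by
  refine ⟨one_pos, ?_, fun l hl y => ?_, fun l hl => ?_⟩
  · exact measurable_timeKernel_comp (f := fun q : ℝ × ℝ => q.1 ^ 2) (by fun_prop) measurable_snd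
  · refine (indicator_le_self' (fun _ _ => zero_le) y).trans (ENNReal.ofReal_le_ofReal ?_)
    rw [one_mul, Real.rpow_neg hl.le, Real.rpow_two]
  · simpa using lintegral_timeKernel_le hσ (by positivity)

theorem avg_eq_lintegral {W : ℝ × Space d → ℝ≥0∞} (hW : Measurable W) (τ l t : ℝ) (x : Space d) :
    avg σ W τ l (t, x)
      = ∫⁻ s, lconv volume (fun y => W (s, y)) (spaceKernel l) x * timeKernel σ τ (t - s) := by
  unfold avg
  rw [Measure.volume_eq_prod, lintegral_prod]
  · refine lintegral_congr fun s => ?_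
    have h1 : ∀ y, W (s, y) * (timeKernel σ τ ((t, x) - (s, y)).1 * spaceKernel l ((t, x) - (s, y)).2)
        = spaceKernel l (x - y) * W (s, y) * timeKernel σ τ (t - s) := fun y => by
      simp only [Prod.mk_sub_mk]; ring
    simp only [h1]
    rw [lintegral_mul_const, lconv_comm]
    · rfl
    · exact (measurable_spaceKernel_comp measurable_const (by fun_prop)).mul
        (hW.comp measurable_prodMk_left)
  · exact (hW.mul ((measurable_timeKernel_comp measurable_const (by fun_prop)).mul
      (measurable_spaceKernel_comp measurable_const (by fun_prop)))).aemeasurable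

theorem measurable_avg {γ : Type*} [MeasurableSpace γ] {W : ℝ × Space d → ℝ≥0∞}
    (hW : Measurable W) {f g h : γ → ℝ} {k : γ → Space d} (hf : Measurable f) (hg : Measurable g)
    (hh : Measurable h) (hk : Measurable k) :
    Measurable fun c => avg σ W (f c) (g c) (h c, k c) := by
  unfold avg
  refine Measurable.lintegral_prod_right'
    (f := fun q : γ × (ℝ × Space d) => W q.2 * (timeKernel σ (f q.1) ((h q.1, k q.1) - q.2).1
      * spaceKernel (g q.1) ((h q.1, k q.1) - q.2).2)) ?_
  exact (hW.comp measurable_snd).mul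
    ((measurable_timeKernel_comp (by fun_prop) (by fun_prop)).mul
      (measurable_spaceKernel_comp (by fun_prop) (by fun_prop)))

theorem measurable_lconv_slice {γ : Type*} [MeasurableSpace γ] {W : ℝ × Space d → ℝ≥0∞}
    (hW : Measurable W) {f g : γ → ℝ} {k : γ → Space d} (hf : Measurable f) (hg : Measurable g)
    (hk : Measurable k) :
    Measurable fun c => lconv volume (fun y => W (g c, y)) (spaceKernel (f c)) (k c) := by
  unfold lconv
  refine Measurable.lintegral_prod_right'
    (f := fun q : γ × Space d => W (g q.1, k q.1 - q.2) * spaceKernel (f q.1) q.2) ?_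
  have h1 : Measurable fun q : γ × Space d => (g q.1, k q.1 - q.2) := by fun_prop
  have h2 : Measurable fun q : γ × Space d => W (g q.1, k q.1 - q.2) := hW.comp h1
  exact h2.mul (measurable_spaceKernel_comp (by fun_prop) (by fun_prop))

theorem lconv_eq_lintegral_sub {w k : ℝ → ℝ≥0∞} (t : ℝ) :
    lconv volume w k t = ∫⁻ s, w s * k (t - s) := by
  rw [lconv_comm]
  simp [lconv, mul_comm]

variable {C : ℝ} (hC : IsKernelFamily (volume : Measure (Space d)) d C spaceKernel)
include hC

/-- Minkowski's inequality over the past or future times and Young's inequality in space at each of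
them. The convolution in time is kept, so that it can be treated later at one scale or as part of a
potential. -/
theorem eLpNorm_avg_le {a b : ℝ≥0∞} (ha : 1 ≤ a) (hab : a ≤ b) {W : ℝ × Space d → ℝ≥0∞}
    (hW : Measurable W) {τ l : ℝ} (hl : 0 < l) (t : ℝ) :
    eLpNorm (fun x => avg σ W τ l (t, x)) b volume
      ≤ ENNReal.ofReal (C * l ^ (-(d * (a⁻¹.toReal - b⁻¹.toReal)))) *
        lconv volume (fun s => eLpNorm (fun y => W (s, y)) a volume) (timeKernel σ τ) t := by
  have hm : Measurable fun q : Space d × ℝ => lconv volume (fun y => W (q.2, y)) (spaceKernel l) q.1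
      * timeKernel σ τ (t - q.2) :=
    (measurable_lconv_slice hW measurable_const measurable_snd measurable_fst).mul
      (measurable_timeKernel_comp measurable_const (by fun_prop))
  have hN := measurable_eLpNorm_slice (ν := (volume : Measure (Space d))) hW a
  simp only [avg_eq_lintegral hW]
  refine (eLpNorm_lintegral_le (ha.trans hab) hm).trans ?_
  rw [lconv_eq_lintegral_sub, ← lintegral_const_mul' _ _ (by simp)]
  refine lintegral_mono fun s => ?_
  simp only [mul_comm _ (timeKernel σ τ (t - s))]
  have hWs : Measurable fun y => W (s, y) := hW.comp measurable_prodMk_left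
  rw [eLpNorm_const_mul_ennreal (measurable_lconv hWs (measurable_spaceKernel_apply l)),
    mul_left_comm]
  gcongr
  exact hC.eLpNorm_lconv_le ha hab hWs hl

/-- The averages at a fixed parabolic scale map `L_{a,q}` to `L_{b,r}`. -/
theorem mixed_avg_le (hσ : σ = 1 ∨ σ = -1) {a b q r : ℝ≥0∞} (ha : 1 ≤ a) (hab : a ≤ b)
    (hq : 1 ≤ q) (hqr : q ≤ r) {l : ℝ} (hl : 0 < l) :
    ∃ N : ℝ≥0, ∀ W : ℝ × Space d → ℝ≥0∞, Measurable W →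
      mixed b r (avg σ W (l ^ 2) l) ≤ N * mixed a q W := by
  refine ⟨(ENNReal.ofReal (C * l ^ (-(d * (a⁻¹.toReal - b⁻¹.toReal)))) *
    ENNReal.ofReal (1 * l ^ (-(2 * (q⁻¹.toReal - r⁻¹.toReal))))).toNNReal, fun W hW => ?_⟩
  rw [ENNReal.coe_toNNReal (by finiteness)]
  have hN := measurable_eLpNorm_slice (ν := (volume : Measure (Space d))) hW a
  unfold mixed
  refine (eLpNorm_mono_ennreal fun t => eLpNorm_avg_le hC ha hab hW hl t).trans ?_
  rw [eLpNorm_const_mul_ennreal (measurable_lconv hN (measurable_timeKernel_apply _ _)), mul_assoc]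
  gcongr
  exact (isKernelFamily_timeKernel hσ).eLpNorm_lconv_le hq hqr hN hl

/-- The averages at a fixed time scale map `L_{a,q}` to `L_{b,q}`, uniformly in the time scale. -/
theorem mixed_avg_le_uniform (hσ : σ = 1 ∨ σ = -1) {a b q : ℝ≥0∞} (ha : 1 ≤ a) (hab : a ≤ b)
    (hq : 1 ≤ q) {l : ℝ} (hl : 0 < l) :
    ∃ N : ℝ≥0, ∀ ε : ℝ, 0 < ε → ∀ W : ℝ × Space d → ℝ≥0∞, Measurable W →
      mixed b q (avg σ W ε l) ≤ N * mixed a q W := by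
  refine ⟨(ENNReal.ofReal (C * l ^ (-(d * (a⁻¹.toReal - b⁻¹.toReal))))).toNNReal,
    fun ε hε W hW => ?_⟩
  rw [ENNReal.coe_toNNReal (by finiteness)]
  have hN := measurable_eLpNorm_slice (ν := (volume : Measure (Space d))) hW a
  have ht := measurable_timeKernel_apply σ ε
  unfold mixed
  refine (eLpNorm_mono_ennreal fun t => eLpNorm_avg_le hC ha hab hW hl t).trans ?_
  rw [eLpNorm_const_mul_ennreal (measurable_lconv hN ht)]
  gcongr
  simpa using eLpNorm_lconv_le_self (μ := volume) hN ht hq (lintegral_timeKernel_le hσ hε)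

omit hC in
-- The endpoint from `L¹` to `L^∞` in time. A time lag `s` is seen only by scales `l` comparable to
-- `√(σ s)`, where the weight `l · l⁻²` is comparable to `1/√(σ s)`. The integral over the scales is
-- thus bounded uniformly in `s`.
theorem potential_time_le (hσ : σ = 1 ∨ σ = -1) {w : ℝ → ℝ≥0∞} (hw : Measurable w) (L t : ℝ) :
    potential volume (fun l => timeKernel σ (l ^ 2)) 2 (Ioo 0 L) w t ≤ 2 * ∫⁻ s, w s := by
  have hk := isKernelFamily_timeKernel hσ
  have hm : Measurable fun q : ℝ × ℝ => w (t - q.2) * timeKernel σ (q.1 ^ 2) q.2 := by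
    refine (hw.comp (by fun_prop)).mul hk.measurable
  have hm' : Measurable fun q : ℝ × ℝ => ENNReal.ofReal (q.1 ^ ((2 : ℝ) - 1)) *
      (w (t - q.2) * timeKernel σ (q.1 ^ 2) q.2) := Measurable.mul (by fun_prop) hm
  unfold potential lconv
  calc ∫⁻ l in Ioo 0 L, ENNReal.ofReal (l ^ ((2 : ℝ) - 1)) *
        ∫⁻ s, w (t - s) * timeKernel σ (l ^ 2) s
      = ∫⁻ l in Ioo 0 L, ∫⁻ s, ENNReal.ofReal (l ^ ((2 : ℝ) - 1)) *
        (w (t - s) * timeKernel σ (l ^ 2) s) :=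
        lintegral_congr fun l => (lintegral_const_mul _
          (hm.comp (measurable_prodMk_left (x := l)))).symm
    _ = ∫⁻ s, ∫⁻ l in Ioo 0 L, ENNReal.ofReal (l ^ ((2 : ℝ) - 1)) *
        (w (t - s) * timeKernel σ (l ^ 2) s) := lintegral_lintegral_swap hm'.aemeasurable
    _ ≤ ∫⁻ s, 2 * w (t - s) := by
        refine lintegral_mono fun s => ?_
        calc ∫⁻ l in Ioo 0 L, ENNReal.ofReal (l ^ ((2 : ℝ) - 1)) *
              (w (t - s) * timeKernel σ (l ^ 2) s)
            ≤ ∫⁻ l in Ioo 0 L, w (t - s) * (Icc (Real.sqrt (σ * s) / 2) (Real.sqrt (σ * s))).indicator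
                (fun _ => ENNReal.ofReal (2 / Real.sqrt (σ * s))) l := by
              refine setLIntegral_mono' measurableSet_Ioo fun l hl => ?_
              rw [mul_left_comm]
              gcongr
              have hl0 := hl.1
              by_cases h : 1 ≤ σ * ((l ^ 2)⁻¹ * s) ∧ σ * ((l ^ 2)⁻¹ * s) ≤ 2
              · obtain ⟨h1, h2⟩ := h
                have hl2 : 0 < l ^ 2 := by positivity
                have e : σ * ((l ^ 2)⁻¹ * s) = σ * s / l ^ 2 := by field_simp
                have h1' := h1
                have h2' := h2
                rw [e, le_div_iff₀ hl2, one_mul] at h1'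
                rw [e, div_le_iff₀ hl2] at h2'
                have h3 : l ≤ Real.sqrt (σ * s) := Real.le_sqrt_of_sq_le h1'
                have h4 : Real.sqrt (σ * s) ≤ 2 * l := by
                  rw [Real.sqrt_le_left (by positivity)]
                  nlinarith
                unfold timeKernel
                rw [indicator_of_mem (by exact ⟨h1, h2⟩), indicator_of_mem (mem_Icc.2 ⟨by linarith, h3⟩),
                  ← ENNReal.ofReal_mul (by positivity)]
                refine ENNReal.ofReal_le_ofReal ?_
                have e2 : l ^ ((2 : ℝ) - 1) * (l ^ 2)⁻¹ = 1 / l := by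
                  norm_num
                  field_simp
                rw [e2, div_le_div_iff₀ hl0 (by linarith)]
                linarith
              · unfold timeKernel
                rw [indicator_of_notMem (by exact h), mul_zero]
                exact zero_le
          _ ≤ ∫⁻ l, w (t - s) * (Icc (Real.sqrt (σ * s) / 2) (Real.sqrt (σ * s))).indicator
                (fun _ => ENNReal.ofReal (2 / Real.sqrt (σ * s))) l := setLIntegral_le_lintegral _ _
          _ ≤ 2 * w (t - s) := by
              rw [lintegral_const_mul _ (measurable_const.indicator measurableSet_Icc),
                lintegral_indicator_const measurableSet_Icc, Real.volume_Icc, mul_comm]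
              gcongr
              rw [← ENNReal.ofReal_mul (by positivity)]
              have h5 : ENNReal.ofReal 2 = 2 := by norm_num
              rw [← h5]
              refine ENNReal.ofReal_le_ofReal ?_
              rcases (Real.sqrt_nonneg (σ * s)).eq_or_lt with h0 | h0
              · rw [← h0]; norm_num
              · field_simp
                norm_num
    _ = 2 * ∫⁻ s, w s := by
        rw [lintegral_const_mul' _ _ (by simp), lintegral_sub_left_eq_self]

/-- The superposition of the averages at parabolic scales maps `L_{a,q}` to `L_{b,r}`. -/
theorem mixed_potential_le (hσ : σ = 1 ∨ σ = -1) {a b q r : ℝ≥0∞} (ha : 1 ≤ a) (hab : a ≤ b)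
    (hq : 1 ≤ q) (hqr : q ≤ r) {e : ℝ}
    (he : d * (a⁻¹.toReal - b⁻¹.toReal) + 2 * (q⁻¹.toReal - r⁻¹.toReal) ≤ e)
    (he' : d * (a⁻¹.toReal - b⁻¹.toReal) + 2 * (q⁻¹.toReal - r⁻¹.toReal) = e →
      (q = 1 ∧ r = ∞) ∨ (1 < q ∧ q < r ∧ r < ∞)) {L : ℝ} (hL : 0 < L) :
    ∃ N : ℝ≥0, ∀ W : ℝ × Space d → ℝ≥0∞, Measurable W →
      mixed b r (fun z => ∫⁻ l in Ioo 0 L, ENNReal.ofReal (l ^ (e - 1)) * avg σ W (l ^ 2) l z)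
        ≤ N * mixed a q W := by
  set δ := d * (a⁻¹.toReal - b⁻¹.toReal) with hδ
  have hk := isKernelFamily_timeKernel hσ
  -- The space variables cost `l ^ (-δ)`. What is left is a potential of order `e - δ` in time
  -- alone, for a family of dimension `2` in the parameter `l`.
  have htime : ∃ N : ℝ≥0, ∀ w : ℝ → ℝ≥0∞, Measurable w →
      eLpNorm (potential volume (fun l => timeKernel σ (l ^ 2)) (e - δ) (Ioo 0 L) w) r volume
        ≤ N * eLpNorm w q volume := by
    rcases he.lt_or_eq with hlt | heq
    · exact hk.eLpNorm_potential_le_of_lt hq hqr (by linarith) hL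
    · rcases he' heq with ⟨rfl, rfl⟩ | ⟨h1, h2, h3⟩
      · refine ⟨2, fun w hw => ?_⟩
        have he2 : e - δ = 2 := by rw [← heq]; simp
        rw [he2, eLpNorm_top_ennreal_eq, eLpNorm_one_eq_lintegral_enorm]
        refine essSup_le_of_ae_le _ (Eventually.of_forall fun t => ?_)
        simpa using potential_time_le hσ hw L t
      · obtain ⟨N, hN⟩ := hk.eLpNorm_potential_le_of_eq two_pos h1 h2 h3
        refine ⟨N, fun w hw => (eLpNorm_mono_ennreal fun t => ?_).trans (hN w hw)⟩
        have he2 : e - δ = 2 * (q⁻¹.toReal - r⁻¹.toReal) := by linarith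
        rw [he2]
        exact lintegral_mono_set Ioo_subset_Ioi_self
  obtain ⟨N, hN⟩ := htime
  refine ⟨(ENNReal.ofReal C * N).toNNReal, fun W hW => ?_⟩
  rw [ENNReal.coe_toNNReal (by finiteness)]
  have hNm := measurable_eLpNorm_slice (ν := (volume : Measure (Space d))) hW a
  have hm : ∀ t, Measurable fun q : Space d × ℝ =>
      ENNReal.ofReal (q.2 ^ (e - 1)) * avg σ W (q.2 ^ 2) q.2 (t, q.1) := by
    intro t
    exact Measurable.mul (by fun_prop)
      (measurable_avg hW (by fun_prop) measurable_snd measurable_const measurable_fst)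
  unfold mixed
  refine (eLpNorm_mono_ennreal (g := fun t => ENNReal.ofReal C *
    potential volume (fun l => timeKernel σ (l ^ 2)) (e - δ) (Ioo 0 L)
      (fun s => eLpNorm (fun y => W (s, y)) a volume) t) fun t => ?_).trans ?_
  · refine (eLpNorm_lintegral_le (ha.trans hab) (hm t)).trans ?_
    unfold potential
    rw [← lintegral_const_mul' _ _ (by simp)]
    refine setLIntegral_mono' measurableSet_Ioo fun l hl => ?_
    have hl0 : 0 < l := hl.1
    have hma : Measurable fun x => avg σ W (l ^ 2) l (t, x) :=
      measurable_avg hW measurable_const measurable_const measurable_const measurable_id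
    rw [eLpNorm_const_mul_ennreal hma]
    refine (mul_le_mul_right (eLpNorm_avg_le hC ha hab hW hl0 t) _).trans (le_of_eq ?_)
    rw [← hδ, ← mul_assoc, ← mul_assoc, ← ENNReal.ofReal_mul (by positivity),
      ← ENNReal.ofReal_mul hC.pos.le]
    congr 2
    rw [mul_left_comm, ← Real.rpow_add hl0]
    ring_nf
  · rw [eLpNorm_const_mul_ennreal (measurable_potential hk.measurable hNm _ _), mul_assoc]
    gcongr
    exact hN _ hNm

/-- The superposition of the averages at a fixed time scale maps `L_{a,q}` to `L_{b,q}`, uniformly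
in the time scale. -/
theorem mixed_potential_le_uniform (hσ : σ = 1 ∨ σ = -1) {a b q : ℝ≥0∞} (ha : 1 ≤ a)
    (hab : a ≤ b) (hq : 1 ≤ q) (he : d * (a⁻¹.toReal - b⁻¹.toReal) ≤ 1)
    (he' : d * (a⁻¹.toReal - b⁻¹.toReal) = 1 → 1 < a ∧ a < b ∧ b < ∞) {L : ℝ} (hL : 0 < L) :
    ∃ N : ℝ≥0, ∀ ε : ℝ, 0 < ε → ∀ W : ℝ × Space d → ℝ≥0∞, Measurable W →
      mixed b q (fun z => ∫⁻ l in Ioo 0 L, avg σ W ε l z) ≤ N * mixed a q W := by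
  have hspace : ∃ N : ℝ≥0, ∀ w : Space d → ℝ≥0∞, Measurable w →
      eLpNorm (potential volume spaceKernel 1 (Ioo 0 L) w) b volume ≤ N * eLpNorm w a volume := by
    rcases he.lt_or_eq with hlt | heq
    · exact hC.eLpNorm_potential_le_of_lt ha hab hlt hL
    · obtain ⟨h1, h2, h3⟩ := he' heq
      obtain ⟨N, hN⟩ := hC.eLpNorm_potential_le_of_eq
        (by exact_mod_cast Nat.pos_of_ne_zero (NeZero.ne d)) h1 h2 h3
      refine ⟨N, fun w hw => (eLpNorm_mono_ennreal fun x => ?_).trans (hN w hw)⟩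
      rw [heq]
      exact lintegral_mono_set Ioo_subset_Ioi_self
  obtain ⟨N, hN⟩ := hspace
  refine ⟨N, fun ε hε W hW => ?_⟩
  have hNm := measurable_eLpNorm_slice (ν := (volume : Measure (Space d))) hW a
  have ht := measurable_timeKernel_apply σ ε
  have hpm : Measurable fun q : Space d × ℝ =>
      potential volume spaceKernel 1 (Ioo 0 L) (fun y => W (q.2, y)) q.1 := by
    unfold potential
    refine Measurable.lintegral_prod_right' (f := fun q : (Space d × ℝ) × ℝ =>
      ENNReal.ofReal (q.2 ^ ((1 : ℝ) - 1)) * lconv volume (fun y => W (q.1.2, y))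
        (spaceKernel q.2) q.1.1) (Measurable.mul (by fun_prop) ?_)
    exact measurable_lconv_slice hW measurable_snd (by fun_prop) (by fun_prop)
  -- With a frozen time scale the time kernel does not depend on `l` and comes out of the potential.
  -- It is then used only through its mass, which is why the constant does not depend on `ε`.
  have hrepr : ∀ t x, ∫⁻ l in Ioo 0 L, avg σ W ε l (t, x)
      = ∫⁻ s, potential volume spaceKernel 1 (Ioo 0 L) (fun y => W (s, y)) x
        * timeKernel σ ε (t - s) := by
    intro t x
    simp only [avg_eq_lintegral hW]
    rw [lintegral_lintegral_swap]
    · refine lintegral_congr fun s => ?_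
      rw [lintegral_mul_const]
      · simp [potential]
      · exact measurable_lconv_slice hW measurable_id measurable_const measurable_const
    · exact ((measurable_lconv_slice hW measurable_fst measurable_snd measurable_const).mul
        (measurable_timeKernel_comp measurable_const (by fun_prop))).aemeasurable
  unfold mixed
  refine (eLpNorm_mono_ennreal (g := fun t => N * lconv volume
      (fun s => eLpNorm (fun y => W (s, y)) a volume) (timeKernel σ ε) t) fun t => ?_).trans ?_
  · simp only [hrepr]
    refine (eLpNorm_lintegral_le (ha.trans hab) (hpm.mul
      (measurable_timeKernel_comp measurable_const (by fun_prop)))).trans ?_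
    rw [lconv_eq_lintegral_sub, ← lintegral_const_mul' _ _ (by simp)]
    refine lintegral_mono fun s => ?_
    simp only [mul_comm _ (timeKernel σ ε (t - s))]
    have hWs : Measurable fun y => W (s, y) := hW.comp measurable_prodMk_left
    rw [eLpNorm_const_mul_ennreal (measurable_potential hC.measurable hWs _ _), mul_left_comm]
    gcongr
    exact hN _ hWs
  · rw [eLpNorm_const_mul_ennreal (measurable_lconv hNm ht)]
    gcongr
    simpa using eLpNorm_lconv_le_self (μ := volume) hNm ht hq (lintegral_timeKernel_le hσ hε)

end MixedBounds

/-! ### Fatou's lemma for mixed norms. -/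

section Fatou

variable {α : Type*} [MeasurableSpace α] {μ : Measure α}

theorem eLpNorm_le_liminf {p : ℝ≥0∞} {G : α → ℝ≥0∞} {H : ℕ → α → ℝ≥0∞}
    (hH : ∀ n, Measurable (H n)) (h : ∀ᵐ x ∂μ, G x ≤ liminf (fun n => H n x) atTop) :
    eLpNorm G p μ ≤ liminf (fun n => eLpNorm (H n) p μ) atTop := by
  rcases eq_or_ne p 0 with rfl | hp0
  · simp
  rcases eq_or_ne p ∞ with rfl | hp
  · simp only [eLpNorm_top_ennreal_eq]
    refine essSup_le_of_ae_le _ ?_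
    have h1 : ∀ᵐ x ∂μ, ∀ n, H n x ≤ essSup (H n) μ := ae_all_iff.2 fun n => ae_le_essSup
    filter_upwards [h, h1] with x hx hx1
    exact hx.trans (liminf_le_liminf (Eventually.of_forall hx1))
  · have hr := ENNReal.toReal_pos hp0 hp
    have hmap : ∀ (s : ℝ), 0 < s → ∀ a : ℕ → ℝ≥0∞,
        (liminf a atTop) ^ s = liminf (fun n => a n ^ s) atTop := fun s hs a =>
      (ENNReal.monotone_rpow_of_nonneg hs.le).map_liminf_of_continuousAt a
        ENNReal.continuous_rpow_const.continuousAt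
    simp only [eLpNorm_ennreal_eq hp0 hp]
    rw [← hmap _ (by positivity)]
    gcongr
    calc ∫⁻ x, G x ^ p.toReal ∂μ ≤ ∫⁻ x, liminf (fun n => H n x ^ p.toReal) atTop ∂μ := by
          refine lintegral_mono_ae (h.mono fun x hx => ?_)
          rw [← hmap _ hr]
          gcongr
      _ ≤ _ := lintegral_liminf_le fun n => (hH n).pow_const _

theorem mixed_le_of_le_liminf {d : ℕ} {p q : ℝ≥0∞} {G : ℝ × Space d → ℝ≥0∞}
    {H : ℕ → ℝ × Space d → ℝ≥0∞} (hH : ∀ n, Measurable (H n))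
    (h : ∀ᵐ z, G z ≤ liminf (fun n => H n z) atTop) {C : ℝ≥0∞} (hC : ∀ n, mixed p q (H n) ≤ C) :
    mixed p q G ≤ C := by
  rw [Measure.volume_eq_prod] at h
  have h1 : ∀ᵐ t : ℝ, eLpNorm (fun x : Space d => G (t, x)) p volume
      ≤ liminf (fun n => eLpNorm (fun x => H n (t, x)) p volume) atTop := by
    filter_upwards [Measure.ae_ae_of_ae_prod h] with t ht
    exact eLpNorm_le_liminf (fun n => (hH n).comp measurable_prodMk_left) ht
  have h2 := eLpNorm_le_liminf (p := q) (fun n => measurable_eLpNorm_slice (hH n) p) h1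
  refine h2.trans ((liminf_le_liminf (v := fun _ => C) (Eventually.of_forall hC)).trans ?_)
  simp

end Fatou

/-! ### Existence of the mollifiers and almost everywhere convergence. -/

section Approximation

set_option linter.unusedSectionVars false

variable {d : ℕ} [NeZero d] {σ T : ℝ} {Ω : Set (Space d)}

instance : (volume : Measure (ℝ × Space d)).IsAddHaarMeasure :=
  Measure.prod.instIsAddHaarMeasure volume volume

theorem exists_profile (hσ : σ = 1 ∨ σ = -1) :
    ∃ θ : ℝ × Space d → ℝ, IsProfile σ θ ∧ ∫ z, θ z = 1 := by
  -- The product carries the maximum norm, so the closed ball of radius `1/2` about this centre lies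
  -- in `box d σ`.
  let c : ℝ × Space d := (3 / 2 * σ, EuclideanSpace.single 0 (-(1 / 2)))
  let f : ContDiffBump c := ⟨1 / 4, 1 / 2, by norm_num, by norm_num⟩
  refine ⟨f.normed volume, ⟨f.contDiff_normed, ?_⟩, f.integral_normed⟩
  rw [f.tsupport_normed_eq]
  intro z hz
  rw [mem_closedBall_iff_norm, Prod.norm_def, max_le_iff] at hz
  obtain ⟨h1, h2⟩ := hz
  change ‖z.1 - 3 / 2 * σ‖ ≤ 1 / 2 at h1
  change ‖z.2 - EuclideanSpace.single 0 (-(1 / 2))‖ ≤ 1 / 2 at h2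
  rw [Real.norm_eq_abs, abs_le] at h1
  have h3 : ‖z.2‖ ≤ 1 := by
    have h4 : ‖(EuclideanSpace.single 0 (-(1 / 2)) : Space d)‖ = 1 / 2 := by
      rw [PiLp.norm_single]; norm_num
    have := norm_le_norm_sub_add z.2 (EuclideanSpace.single 0 (-(1 / 2)))
    linarith
  have h5 : z.2 0 ≤ 0 := by
    have h6 := (PiLp.norm_apply_le (z.2 - EuclideanSpace.single 0 (-(1 / 2))) 0).trans h2
    rw [Real.norm_eq_abs, abs_le] at h6
    simp at h6
    linarith
  refine ⟨?_, ?_, h3, h5⟩ <;> rcases hσ with rfl | rfl <;> linarith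

theorem norm_le_of_mem_box (hσ : σ = 1 ∨ σ = -1) {l : ℝ} (hl : 0 < l) (hl1 : l ≤ 1)
    {ζ : ℝ × Space d} (hζ : ((l ^ 2)⁻¹ * ζ.1, l⁻¹ • ζ.2) ∈ box d σ) : ‖ζ‖ ≤ 2 * l := by
  obtain ⟨h1, h2, h3, -⟩ := hζ
  have hl2 : 0 < l ^ 2 := by positivity
  have h4 : l ^ 2 ≤ l := by nlinarith
  rw [Prod.norm_def, max_le_iff]
  constructor
  · have e : σ * ((l ^ 2)⁻¹ * ζ.1) = σ * ζ.1 / l ^ 2 := by field_simp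
    simp only at h1 h2
    rw [e, le_div_iff₀ hl2] at h1
    rw [e, div_le_iff₀ hl2] at h2
    rw [Real.norm_eq_abs, abs_le]
    rcases hσ with rfl | rfl <;> constructor <;> linarith
  · simp only [norm_smul, norm_inv, Real.norm_eq_abs, abs_of_pos hl] at h3
    rw [inv_mul_le_iff₀ hl] at h3
    linarith

theorem hasCompactSupport_scaled (hσ : σ = 1 ∨ σ = -1) {θ : ℝ × Space d → ℝ} (hθ : IsProfile σ θ)
    {τ l : ℝ} (hτ : 0 < τ) (hl : 0 < l) : HasCompactSupport (scaled θ τ l) := by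
  refine HasCompactSupport.intro ((isCompact_box (d := d) hσ).image
    (f := fun ζ : ℝ × Space d => (τ * ζ.1, l • ζ.2)) (by fun_prop)) fun z hz => ?_
  refine scaled_eq_zero hθ fun h => hz ⟨_, h, ?_⟩
  simp only
  rw [mul_inv_cancel_left₀ hτ.ne', smul_inv_smul₀ hl.ne']

theorem integral_scaled (hσ : σ = 1 ∨ σ = -1) {θ : ℝ × Space d → ℝ} (hθ : IsProfile σ θ)
    {τ l : ℝ} (hτ : 0 < τ) (hl : 0 < l) : ∫ z, scaled θ τ l z = ∫ z, θ z := by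
  have h1 : Integrable (scaled θ τ l) :=
    (contDiff_scaled hθ.smooth τ l).continuous.integrable_of_hasCompactSupport
      (hasCompactSupport_scaled hσ hθ hτ hl)
  have h2 : Integrable θ := by
    refine hθ.smooth.continuous.integrable_of_hasCompactSupport
      (HasCompactSupport.intro (isCompact_box (d := d) hσ) fun z hz => hθ.eq_zero hz)
  rw [Measure.volume_eq_prod] at h1 h2 ⊢
  rw [integral_prod _ h1, integral_prod _ h2]
  have h3 : ∀ s, ∫ y, scaled θ τ l (s, y) = τ⁻¹ * ∫ y, θ (τ⁻¹ * s, y) := by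
    intro s
    simp only [scaled]
    rw [integral_const_mul, Measure.integral_comp_inv_smul volume (fun y => θ (τ⁻¹ * s, y)) l,
      finrank_euclideanSpace_fin, abs_of_pos (by positivity), smul_eq_mul]
    field_simp
  simp only [h3]
  rw [integral_const_mul, Measure.integral_comp_inv_mul_left (fun s => ∫ y, θ (s, y)) τ,
    abs_of_pos hτ, smul_eq_mul, inv_mul_cancel_left₀ hτ.ne']

theorem exists_lintegral_scaled_le (hσ : σ = 1 ∨ σ = -1) {θ : ℝ × Space d → ℝ}
    (hθ : IsProfile σ θ) : ∃ C : ℝ≥0, ∀ τ l : ℝ, 0 < τ → 0 < l →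
      ∫⁻ z, ‖scaled θ τ l z‖ₑ ≤ C := by
  obtain ⟨M, hM0, hM⟩ := hθ.exists_bound hσ
  obtain ⟨C, hC⟩ := isKernelFamily_spaceKernel (d := d)
  refine ⟨(ENNReal.ofReal M * ENNReal.ofReal C).toNNReal, fun τ l hτ hl => ?_⟩
  rw [ENNReal.coe_toNNReal (by finiteness)]
  refine (lintegral_mono fun z => enorm_scaled_le hθ hM0.le hM hτ hl z).trans ?_
  rw [lintegral_const_mul' _ _ (by simp)]
  gcongr
  rw [Measure.volume_eq_prod, lintegral_prod_mul (measurable_timeKernel_apply σ τ).aemeasurable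
    (measurable_spaceKernel_apply l).aemeasurable]
  calc _ ≤ 1 * ENNReal.ofReal C := by
        gcongr
        · exact lintegral_timeKernel_le hσ hτ
        · exact hC.lintegral_le l hl
    _ = _ := one_mul _

/-- Continuity of translations in `L¹`. -/
theorem tendsto_lintegral_translate {v : ℝ × Space d → ℝ} (hv : Integrable v) :
    Tendsto (fun ζ : ℝ × Space d => ∫⁻ z, ‖v (z - ζ) - v z‖ₑ) (𝓝 0) (𝓝 0) := by
  have hv1 : MemLp v 1 volume := memLp_one_iff_integrable.2 hv
  let S : ℝ × Space d → C(ℝ × Space d, ℝ × Space d) := fun ζ => ⟨fun z => z - ζ, by fun_prop⟩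
  have hS : Continuous S := by
    let S' : C((ℝ × Space d) × (ℝ × Space d), ℝ × Space d) := ⟨fun q => q.2 - q.1, by fun_prop⟩
    exact S'.curry.continuous
  have hmp : ∀ ζ, MeasurePreserving (S ζ) (volume : Measure (ℝ × Space d)) volume := fun ζ =>
    measurePreserving_sub_right volume ζ
  have hc := Continuous.compMeasurePreservingLp (p := 1) (f := fun _ : ℝ × Space d => hv1.toLp v)
    continuous_const hS hmp (by simp)
  have h0 := (tendsto_iff_edist_tendsto_0.1 (hc.tendsto 0))
  refine h0.congr fun ζ => ?_
  simp only [Lp.toLp_compMeasurePreserving, Lp.edist_toLp_toLp]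
  rw [eLpNorm_one_eq_lintegral_enorm]
  simp [S]

/-- Mollifications at parabolic scale `l` converge in `L¹`. -/
theorem tendsto_mollify (hσ : σ = 1 ∨ σ = -1) {θ : ℝ × Space d → ℝ} (hθ : IsProfile σ θ)
    (hθ1 : ∫ z, θ z = 1) {v : ℝ × Space d → ℝ} (hv : Integrable v) :
    Tendsto (fun l : ℝ => ∫⁻ z₀, ‖(∫ z, v z * scaled θ (l ^ 2) l (z₀ - z)) - v z₀‖ₑ)
      (𝓝[>] 0) (𝓝 0) := by
  obtain ⟨C, hC⟩ := exists_lintegral_scaled_le hσ hθ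
  rw [ENNReal.tendsto_nhds_zero]
  intro η hη
  obtain ⟨η', hη'0, hη'⟩ : ∃ η' : ℝ≥0∞, 0 < η' ∧ η' * C ≤ η := by
    rcases eq_or_ne η ∞ with rfl | hηt
    · exact ⟨1, one_pos, le_top⟩
    · refine ⟨η / (C + 1), ENNReal.div_pos hη.ne' (by finiteness), ?_⟩
      calc η / (C + 1) * C ≤ η / (C + 1) * (C + 1) := by gcongr; exact le_self_add
        _ = η := ENNReal.div_mul_cancel (by simp) (by finiteness)
  have h1 := (ENNReal.tendsto_nhds_zero.1 (tendsto_lintegral_translate hv)) η' hη'0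
  obtain ⟨r, hr0, hr⟩ := Metric.eventually_nhds_iff_ball.1 h1
  have hsmall : ∀ᶠ l : ℝ in 𝓝[>] 0, 0 < l ∧ l ≤ 1 ∧ 2 * l < r := by
    have e1 : ∀ᶠ l : ℝ in 𝓝[>] 0, l < min 1 (r / 2) :=
      (eventually_lt_nhds (by positivity)).filter_mono nhdsWithin_le_nhds
    filter_upwards [self_mem_nhdsWithin, e1] with l hl hl1
    exact ⟨hl, (hl1.trans_le (min_le_left _ _)).le, by
      have := hl1.trans_le (min_le_right _ _); linarith⟩
  filter_upwards [hsmall] with l hl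
  obtain ⟨hl0, hl1, hlr⟩ := hl
  have hl2 : 0 < l ^ 2 := by positivity
  set K := scaled θ (l ^ 2) l with hK
  have hKc : Continuous K := (contDiff_scaled hθ.smooth _ _).continuous
  have hKs : HasCompactSupport K := hasCompactSupport_scaled hσ hθ hl2 hl0
  have hKi : Integrable K := hKc.integrable_of_hasCompactSupport hKs
  obtain ⟨M, hM⟩ := hKs.exists_bound_of_continuous hKc
  have hrepr : ∀ z₀, ‖(∫ z, v z * K (z₀ - z)) - v z₀‖ₑ ≤ ∫⁻ ζ, ‖v (z₀ - ζ) - v z₀‖ₑ * ‖K ζ‖ₑ := by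
    intro z₀
    have hvi : Integrable fun ζ => v (z₀ - ζ) := hv.comp_sub_left z₀
    have hi1 : Integrable fun ζ => v (z₀ - ζ) * K ζ :=
      hvi.mul_bdd hKc.aestronglyMeasurable (Eventually.of_forall hM)
    have e1 : ∫ z, v z * K (z₀ - z) = ∫ ζ, v (z₀ - ζ) * K ζ := by
      rw [← integral_sub_left_eq_self (fun z => v z * K (z₀ - z)) volume z₀]
      simp
    have e2 : v z₀ = ∫ ζ, v z₀ * K ζ := by
      rw [integral_const_mul, hK, integral_scaled hσ hθ hl2 hl0, hθ1, mul_one]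
    have e3 : (∫ z, v z * K (z₀ - z)) - v z₀ = ∫ ζ, (v (z₀ - ζ) - v z₀) * K ζ := by
      rw [e1]
      conv_lhs => rw [e2]
      rw [← integral_sub hi1 (hKi.const_mul _)]
      simp [sub_mul]
    rw [e3]
    refine (enorm_integral_le_lintegral_enorm _).trans (le_of_eq ?_)
    simp [enorm_mul]
  have hvm := hv.aestronglyMeasurable
  calc ∫⁻ z₀, ‖(∫ z, v z * K (z₀ - z)) - v z₀‖ₑ
      ≤ ∫⁻ z₀, ∫⁻ ζ, ‖v (z₀ - ζ) - v z₀‖ₑ * ‖K ζ‖ₑ := lintegral_mono hrepr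
    _ = ∫⁻ ζ, ∫⁻ z₀, ‖v (z₀ - ζ) - v z₀‖ₑ * ‖K ζ‖ₑ := by
        refine lintegral_lintegral_swap ?_
        refine AEMeasurable.mul (AEStronglyMeasurable.enorm (AEStronglyMeasurable.sub ?_ ?_)) ?_
        · exact hvm.comp_quasiMeasurePreserving
            (quasiMeasurePreserving_sub_of_right_invariant volume volume)
        · exact hvm.comp_fst
        · exact (hKc.comp continuous_snd).enorm.aemeasurable
    _ ≤ ∫⁻ ζ, η' * ‖K ζ‖ₑ := by
        refine lintegral_mono fun ζ => ?_
        rw [lintegral_mul_const' _ _ (by simp)]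
        -- On the support of the kernel `‖ζ‖ ≤ 2 l < r`, where translation moves `v` by at most `η'`
        -- in `L¹`; elsewhere the integrand vanishes.
        by_cases hζ : ((l ^ 2)⁻¹ * ζ.1, l⁻¹ • ζ.2) ∈ box d σ
        · gcongr
          refine hr ζ ?_
          rw [mem_ball_zero_iff]
          exact (norm_le_of_mem_box hσ hl0 hl1 hζ).trans_lt hlr
        · rw [hK, scaled_eq_zero hθ hζ]
          simp
    _ = η' * ∫⁻ ζ, ‖K ζ‖ₑ := lintegral_const_mul _ hKc.enorm.measurable
    _ ≤ η' * C := by gcongr; exact hC _ _ hl2 hl0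
    _ ≤ η := hη'

/-- Convergence in `L¹` gives convergence almost everywhere along a subsequence. As `u` is
integrable only on bounded parts of `Q`, it is cut off at radius `R + 2`. For `l ≤ 1` the mollifier
reaches no further than distance `2`, so points of the ball of radius `R` do not see the cut. -/
theorem exists_seq_tendsto_mollify (hσ : σ = 1 ∨ σ = -1) {θ : ℝ × Space d → ℝ}
    (hθ : IsProfile σ θ) (hθ1 : ∫ z, θ z = 1) {Q : Set (ℝ × Space d)} (hQ : MeasurableSet Q)
    {u : ℝ × Space d → ℝ} (hu : ∀ R : ℝ, IntegrableOn u (Q ∩ Metric.closedBall 0 R)) (R : ℝ) :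
    ∃ l : ℕ → ℝ, (∀ n, 0 < l n) ∧ Tendsto l atTop (𝓝 0) ∧
      ∀ᵐ z₀, z₀ ∈ Q ∩ Metric.closedBall 0 R →
        Tendsto (fun n => ∫ z in Q, u z * scaled θ (l n ^ 2) (l n) (z₀ - z)) atTop (𝓝 (u z₀)) := by
  set B := Q ∩ Metric.closedBall 0 (R + 2)
  have hB : MeasurableSet B := hQ.inter Metric.isClosed_closedBall.measurableSet
  set v := B.indicator u
  have hv : Integrable v := (integrable_indicator_iff hB).2 (hu _)
  have hl0 : Tendsto (fun n : ℕ => 1 / ((n : ℝ) + 1)) atTop (𝓝[>] 0) :=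
    tendsto_nhdsWithin_iff.2 ⟨tendsto_one_div_add_atTop_nhds_zero_nat,
      Eventually.of_forall fun n => by simp only [mem_Ioi]; positivity⟩
  have h1 := (tendsto_mollify hσ hθ hθ1 hv).comp hl0
  have h2 : TendstoInMeasure volume (fun (n : ℕ) z₀ =>
      ∫ z, v z * scaled θ ((1 / ((n : ℝ) + 1)) ^ 2) (1 / ((n : ℝ) + 1)) (z₀ - z)) atTop v := by
    refine tendstoInMeasure_of_tendsto_eLpNorm one_ne_zero (fun n => ?_) hv.aestronglyMeasurable ?_
    · refine AEStronglyMeasurable.integral_prod_right' (f := fun q : (ℝ × Space d) × (ℝ × Space d) =>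
        v q.2 * scaled θ ((1 / ((n : ℝ) + 1)) ^ 2) (1 / ((n : ℝ) + 1)) (q.1 - q.2)) ?_
      exact hv.aestronglyMeasurable.comp_snd.mul
        ((contDiff_scaled hθ.smooth _ _).continuous.comp (by fun_prop)).aestronglyMeasurable
    · simp only [eLpNorm_one_eq_lintegral_enorm]
      exact h1.congr fun n => rfl
  obtain ⟨ns, hns, hae⟩ := h2.exists_seq_tendsto_ae
  refine ⟨fun n => 1 / ((ns n : ℝ) + 1), fun n => by positivity,
    tendsto_one_div_add_atTop_nhds_zero_nat.comp hns.tendsto_atTop, ?_⟩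
  filter_upwards [hae] with z₀ hz₀ hmem
  have e0 : v z₀ = u z₀ := indicator_of_mem (s := B)
    ⟨hmem.1, Metric.closedBall_subset_closedBall (by linarith) hmem.2⟩ u
  rw [e0] at hz₀
  refine hz₀.congr fun n => ?_
  set l := 1 / ((ns n : ℝ) + 1)
  have hl : 0 < l := by positivity
  have hl1 : l ≤ 1 := by
    rw [div_le_one (by positivity)]
    have : (0 : ℝ) ≤ ns n := Nat.cast_nonneg _
    linarith
  rw [← integral_indicator hQ]
  refine integral_congr_ae (Eventually.of_forall fun z => ?_)
  by_cases hz : ((l ^ 2)⁻¹ * (z₀ - z).1, l⁻¹ • (z₀ - z).2) ∈ box d σ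
  · have h3 := norm_le_of_mem_box hσ hl hl1 hz
    have h4 : z ∈ Metric.closedBall 0 (R + 2) := by
      have h5 := hmem.2
      rw [mem_closedBall_zero_iff] at h5 ⊢
      have := norm_sub_norm_le z z₀
      rw [norm_sub_rev] at this
      linarith
    by_cases hzQ : z ∈ Q
    · have hzB : z ∈ B := ⟨hzQ, h4⟩
      simp [v, hzB, hzQ]
    · have hzB : z ∉ B := fun h => hzQ h.1
      simp [v, hzB, hzQ]
  · have h5 : scaled θ (l ^ 2) l (z₀ - z) = 0 := scaled_eq_zero hθ hz
    simp only [h5, mul_zero]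
    by_cases hzQ : z ∈ Q <;> simp [hzQ, h5]

end Approximation

/-! ### Gagliardo's line argument for the endpoint `p = 1`. -/

section GridLines

set_option linter.unusedSectionVars false

variable {d : ℕ} [NeZero d]

theorem lintegral_space_eq (E : Space d → ℝ≥0∞) :
    ∫⁻ x, E x = ∫⁻ y : Fin d → ℝ, E (WithLp.toLp 2 y) :=
  ((PiLp.volume_preserving_toLp (Fin d)).lintegral_comp_emb
    (MeasurableEquiv.toLp 2 (Fin d → ℝ)).measurableEmbedding E).symm

theorem toLp_add_single (y : Fin d → ℝ) (i : Fin d) (r : ℝ) :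
    WithLp.toLp 2 y + EuclideanSpace.single i r
      = WithLp.toLp 2 (Function.update y i (y i + r)) := by
  ext j
  by_cases h : j = i
  · subst h; simp
  · simp [h]

/-- The Gagliardo–Nirenberg–Sobolev estimate in terms of integrals along lines. -/
theorem eLpNorm_prod_lintegral_line_le {E : Space d → ℝ≥0∞} (hE : Measurable E) {p : ℝ≥0∞}
    (hp1 : 1 ≤ p) (hp : d * (1 - p⁻¹.toReal) = 1) :
    eLpNorm (fun x => (∏ i : Fin d, ∫⁻ r : ℝ, E (x + EuclideanSpace.single i r)) ^ (d : ℝ)⁻¹) p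
      volume ≤ ∫⁻ x, E x := by
  have hE' : Measurable fun y : Fin d → ℝ => E (WithLp.toLp 2 y) :=
    hE.comp (MeasurableEquiv.toLp 2 (Fin d → ℝ)).measurable
  have hline : ∀ (y : Fin d → ℝ) (i : Fin d),
      ∫⁻ r : ℝ, E (WithLp.toLp 2 y + EuclideanSpace.single i r)
        = ∫⁻ s : ℝ, E (WithLp.toLp 2 (Function.update y i s)) := fun y i => by
    simp only [toLp_add_single]
    exact lintegral_add_left_eq_self (fun s => E (WithLp.toLp 2 (Function.update y i s))) (y i)
  have hp0 : p ≠ 0 := (zero_lt_one.trans_le hp1).ne'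
  have hd0 : 0 < d := Nat.pos_of_ne_zero (NeZero.ne d)
  -- For `d = 1` the exponent is `p = ∞` and the line integral is the full integral. For `d ≥ 2` the
  -- exponent `d/(d-1)` is finite and conjugate to `d`, as the grid-lines inequality
  -- `lintegral_prod_lintegral_pow_le` requires.
  rcases (Nat.succ_le_of_lt hd0).eq_or_lt with h1 | h1
  · obtain rfl : d = 1 := h1.symm
    have hpt : p = ∞ := by
      have h2 : p⁻¹.toReal = 0 := by push_cast at hp; linarith
      rcases (ENNReal.toReal_eq_zero_iff _).1 h2 with h3 | h3
      · exact ENNReal.inv_eq_zero.1 h3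
      · exact absurd (ENNReal.inv_eq_top.1 h3) hp0
    subst hpt
    rw [eLpNorm_top_ennreal_eq]
    refine essSup_le_of_ae_le _ (Eventually.of_forall fun x => ?_)
    simp only [Fin.prod_univ_one, Nat.cast_one, inv_one, ENNReal.rpow_one]
    have e0 := hline (WithLp.ofLp x) 0
    rw [WithLp.toLp_ofLp] at e0
    rw [e0, lintegral_space_eq]
    refine le_of_eq ?_
    refine Eq.trans ?_ ((volume_preserving_funUnique (Fin 1) ℝ).symm.lintegral_comp_emb
      (MeasurableEquiv.measurableEmbedding _) fun y => E (WithLp.toLp 2 y))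
    refine lintegral_congr fun s => ?_
    congr 2
    ext i
    obtain rfl : i = 0 := Subsingleton.elim _ _
    simp [MeasurableEquiv.funUnique]
  · have hd1 : (1 : ℝ) < d := by exact_mod_cast h1
    have hinv : p⁻¹.toReal = 1 - (d : ℝ)⁻¹ := by
      field_simp; linarith
    have hpt : p ≠ ∞ := by
      rintro rfl
      simp only [ENNReal.inv_top, ENNReal.toReal_zero] at hinv
      have : (d : ℝ)⁻¹ < 1 := inv_lt_one_of_one_lt₀ hd1
      linarith
    have hs : p.toReal = d / (d - 1) := by
      rw [ENNReal.toReal_inv] at hinv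
      rw [← inv_inv p.toReal, hinv]
      have : (d : ℝ) - 1 ≠ 0 := by linarith
      field_simp
    have hs0 : 0 < p.toReal := ENNReal.toReal_pos hp0 hpt
    have hconj : Real.HolderConjugate (Fintype.card (Fin d) : ℝ) p.toReal := by
      rw [Fintype.card_fin, hs]
      exact Real.HolderConjugate.conjExponent hd1
    have key := lintegral_prod_lintegral_pow_le (fun _ : Fin d => (volume : Measure ℝ)) hconj hE'
    rw [eLpNorm_ennreal_eq hp0 hpt, one_div, ENNReal.rpow_inv_le_iff hs0, lintegral_space_eq,
      lintegral_space_eq]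
    refine le_trans (le_of_eq (lintegral_congr fun y => ?_)) key
    simp only [hline]
    rw [← ENNReal.rpow_mul, ← ENNReal.prod_rpow_of_nonneg]
    · congr 1
      rw [hs, Fintype.card_fin]
      field_simp
    · rw [hs]
      have : 0 < (d : ℝ) - 1 := by linarith
      positivity

variable {σ : ℝ} {C : ℝ}

/-- The endpoint `p = 1` of the Sobolev inequality, for mollifications. -/
theorem exists_mollify_bound_of_lines (hσ : σ = 1 ∨ σ = -1) {θ : ℝ × Space d → ℝ}
    (hθ : IsProfile σ θ) {p q : ℝ≥0∞} (hp1 : 1 ≤ p) (hp : d * (1 - p⁻¹.toReal) = 1) (hq : 1 ≤ q) :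
    ∃ N : ℝ≥0, ∀ (T : ℝ) (Ω : Set (Space d)), (Ω = univ ∨ Ω = halfSpace d) →
      ∀ (u : ℝ × Space d → ℝ) (w : ℝ × Space d → Space d), IsWeakSpatialGradient T Ω u w →
      ∀ U W : ℝ × Space d → ℝ≥0∞, Measurable U → Measurable W →
      (∀ᵐ z ∂(volume.restrict (cylinder T Ω)), ‖u z‖ₑ ≤ U z) →
      (∀ᵐ z ∂(volume.restrict (cylinder T Ω)), ‖w z‖ₑ ≤ W z) →
      ∀ τ l : ℝ, 0 < τ → 0 < l → ∃ B : ℝ × Space d → ℝ≥0∞, Measurable B ∧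
      (∀ z₀, Admissible σ T Ω z₀ τ → ‖∫ z in cylinder T Ω, u z * scaled θ τ l (z₀ - z)‖ₑ ≤ B z₀) ∧
      mixed p q B ≤ N * (mixed 1 q U + mixed 1 q W) := by
  obtain ⟨C, hC⟩ := isKernelFamily_spaceKernel (d := d)
  obtain ⟨K, hK⟩ := line_pointwise hσ hθ
  refine ⟨(K * ENNReal.ofReal C).toNNReal,
    fun T Ω hΩ u w hu U W hUm hWm hU hW τ l hτ hl => ?_⟩
  rw [ENNReal.coe_toNNReal (by finiteness)]
  have hd0 : (0 : ℝ) < d := by exact_mod_cast Nat.pos_of_ne_zero (NeZero.ne d)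
  set E : ℝ × Space d → ℝ≥0∞ := fun z => avg σ U τ l z + avg σ W τ l z with hEdef
  have hav : ∀ {V : ℝ × Space d → ℝ≥0∞}, Measurable V → Measurable (avg σ V τ l) := fun hV =>
    measurable_avg hV measurable_const measurable_const measurable_fst measurable_snd
  have hE : Measurable E := (hav hUm).add (hav hWm)
  have hJ : ∀ i : Fin d, Measurable fun z : ℝ × Space d =>
      ∫⁻ r : ℝ, E (z.1, z.2 + EuclideanSpace.single i r) := by
    intro i
    have hs : Measurable fun r : ℝ => (EuclideanSpace.single i r : Space d) :=
      ((PiLp.continuous_toLp 2 _).comp (continuous_single i)).measurable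
    refine Measurable.lintegral_prod_right' (f := fun z : (ℝ × Space d) × ℝ =>
      E (z.1.1, z.1.2 + EuclideanSpace.single i z.2)) (hE.comp ?_)
    fun_prop
  have hG : Measurable fun z : ℝ × Space d =>
      (∏ i : Fin d, ∫⁻ r : ℝ, E (z.1, z.2 + EuclideanSpace.single i r)) ^ (d : ℝ)⁻¹ :=
    (Finset.measurable_prod _ fun i _ => hJ i).pow_const _
  refine ⟨fun z => K * (∏ i : Fin d, ∫⁻ r : ℝ, E (z.1, z.2 + EuclideanSpace.single i r)) ^ (d : ℝ)⁻¹,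
    hG.const_mul _, ?_, ?_⟩
  · rintro ⟨t, x⟩ h
    set V := ‖∫ z in cylinder T Ω, u z * scaled θ τ l ((t, x) - z)‖ₑ
    -- The same number is bounded by a line integral in each of the `d` directions. The `d`-th root
    -- of the product of these bounds is the function controlled by
    -- `eLpNorm_prod_lintegral_line_le`.
    have h1 : ∀ i, V ≤ K * ∫⁻ r : ℝ, E (t, x + EuclideanSpace.single i r) := fun i =>
      (hK T Ω hΩ u w hu U W hU hW t x τ l hτ hl h i).trans
        (mul_le_mul_right (setLIntegral_le_lintegral _ _) _)
    have h2 : V ^ d ≤ K ^ d * ∏ i : Fin d, ∫⁻ r : ℝ, E (t, x + EuclideanSpace.single i r) := by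
      calc V ^ d = ∏ _i : Fin d, V := by simp
        _ ≤ ∏ i : Fin d, (K * ∫⁻ r : ℝ, E (t, x + EuclideanSpace.single i r)) :=
          Finset.prod_le_prod' fun i _ => h1 i
        _ = _ := by rw [Finset.prod_mul_distrib]; simp
    calc V = (V ^ d) ^ (d : ℝ)⁻¹ := by
          rw [← ENNReal.rpow_natCast, ENNReal.rpow_rpow_inv hd0.ne']
      _ ≤ (K ^ d * ∏ i : Fin d, ∫⁻ r : ℝ, E (t, x + EuclideanSpace.single i r)) ^ (d : ℝ)⁻¹ := by
          gcongr
      _ = _ := by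
          rw [ENNReal.mul_rpow_of_nonneg _ _ (by positivity), ← ENNReal.rpow_natCast,
            ENNReal.rpow_rpow_inv hd0.ne']
  · have havg : ∀ {V : ℝ × Space d → ℝ≥0∞}, Measurable V →
        mixed 1 q (avg σ V τ l) ≤ ENNReal.ofReal C * mixed 1 q V := fun {V} hV => by
      have hN := measurable_eLpNorm_slice (ν := (volume : Measure (Space d))) hV 1
      have ht := measurable_timeKernel_apply σ τ
      unfold mixed
      refine (eLpNorm_mono_ennreal fun t => eLpNorm_avg_le hC le_rfl le_rfl hV hl t).trans ?_
      rw [eLpNorm_const_mul_ennreal (measurable_lconv hN ht)]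
      simp only [sub_self, mul_zero, neg_zero, Real.rpow_zero, mul_one]
      gcongr
      simpa using eLpNorm_lconv_le_self (μ := volume) hN ht hq (lintegral_timeKernel_le hσ hτ)
    have hsl : ∀ {V : ℝ × Space d → ℝ≥0∞}, Measurable V → ∀ t, Measurable fun x => V (t, x) :=
      fun hV t => hV.comp measurable_prodMk_left
    calc mixed p q _ ≤ eLpNorm (fun t : ℝ => K * ∫⁻ x, E (t, x)) q volume := by
          refine eLpNorm_mono_ennreal fun t => ?_
          rw [eLpNorm_const_mul_ennreal (hsl hG t)]
          gcongr
          exact eLpNorm_prod_lintegral_line_le (hsl hE t) hp1 hp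
      _ = K * eLpNorm (fun t : ℝ => ∫⁻ x, E (t, x)) q volume :=
          eLpNorm_const_mul_ennreal hE.lintegral_prod_right'
      _ ≤ K * (mixed 1 q (avg σ U τ l) + mixed 1 q (avg σ W τ l)) := by
          gcongr
          have hi : ∀ {V : ℝ × Space d → ℝ≥0∞}, Measurable V → AEStronglyMeasurable
            (fun t => ∫⁻ x, V (t, x)) volume := fun hV =>
              hV.lintegral_prod_right'.aestronglyMeasurable
          have e1 : (fun t : ℝ => ∫⁻ x, E (t, x)) = (fun t => ∫⁻ x, avg σ U τ l (t, x))
              + fun t => ∫⁻ x, avg σ W τ l (t, x) := by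
            ext t
            exact lintegral_add_left (hsl (hav hUm) t) _
          rw [e1]
          refine (eLpNorm_add_le (hi (hav hUm)) (hi (hav hWm)) hq).trans (le_of_eq ?_)
          simp [mixed, eLpNorm_one_eq_lintegral_enorm]
      _ ≤ K * (ENNReal.ofReal C * mixed 1 q U + ENNReal.ofReal C * mixed 1 q W) := by
          gcongr
          · exact havg hUm
          · exact havg hWm
      _ = _ := by rw [← mul_add, mul_assoc]

end GridLines

/-! ### Elementary properties of mixed norms and extension by zero. -/

section MixedNorms

variable {d : ℕ} {p q : ℝ≥0∞}

theorem mixed_mono {V W : ℝ × Space d → ℝ≥0∞} (h : ∀ z, V z ≤ W z) : mixed p q V ≤ mixed p q W :=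
  eLpNorm_mono_ennreal fun t => eLpNorm_mono_ennreal fun x => h (t, x)

theorem mixed_const_mul {V : ℝ × Space d → ℝ≥0∞} (hV : Measurable V) (c : ℝ≥0∞) :
    mixed p q (fun z => c * V z) = c * mixed p q V := by
  unfold mixed
  rw [← eLpNorm_const_mul_ennreal (measurable_eLpNorm_slice hV p)]
  congr 1
  ext t
  exact eLpNorm_const_mul_ennreal (hV.comp measurable_prodMk_left)

theorem mixed_add_le (hp : 1 ≤ p) (hq : 1 ≤ q) {V W : ℝ × Space d → ℝ≥0∞} (hV : Measurable V)
    (hW : Measurable W) : mixed p q (fun z => V z + W z) ≤ mixed p q V + mixed p q W := by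
  unfold mixed
  have hsl : ∀ {V : ℝ × Space d → ℝ≥0∞}, Measurable V → ∀ t,
      AEStronglyMeasurable (fun x => V (t, x)) volume :=
    fun hV t => (hV.comp measurable_prodMk_left).aestronglyMeasurable
  refine le_trans ?_ (eLpNorm_add_le (measurable_eLpNorm_slice hV p).aestronglyMeasurable
    (measurable_eLpNorm_slice hW p).aestronglyMeasurable hq)
  exact eLpNorm_mono_ennreal fun t => eLpNorm_add_le (hsl hV t) (hsl hW t) hp

theorem mixed_sum_le {ι : Type*} (s : Finset ι) (hp : 1 ≤ p) (hq : 1 ≤ q)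
    {V : ι → ℝ × Space d → ℝ≥0∞} (hV : ∀ k, Measurable (V k)) :
    mixed p q (fun z => ∑ k ∈ s, V k z) ≤ ∑ k ∈ s, mixed p q (V k) := by
  classical
  induction s using Finset.induction_on with
  | empty => simp [mixed]
  | insert a s ha ih =>
    simp only [Finset.sum_insert ha]
    exact (mixed_add_le hp hq (hV a) (Finset.measurable_sum _ fun k _ => hV k)).trans (by gcongr)

/-- The mixed norm on `Ω_T` is that of the extension by zero. -/
theorem exists_extension {F : Type*} [NormedAddCommGroup F] {T : ℝ} {Ω : Set (Space d)}
    (hΩ : MeasurableSet Ω) {v : ℝ × Space d → F}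
    (hv : AEStronglyMeasurable v (volume.restrict (cylinder T Ω))) :
    ∃ V : ℝ × Space d → ℝ≥0∞, Measurable V ∧
      (∀ᵐ z ∂(volume.restrict (cylinder T Ω)), ‖v z‖ₑ = V z) ∧ (∀ z ∉ cylinder T Ω, V z = 0) ∧
      ∀ p q, mixedNorm T Ω p q v = mixed p q V := by
  obtain ⟨w, hwm, hvw⟩ := hv
  have hcyl : MeasurableSet (cylinder T Ω) := measurableSet_Ioo.prod hΩ
  have hae : ∀ᵐ z ∂(volume.restrict (cylinder T Ω)), ‖v z‖ₑ = ‖w z‖ₑ :=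
    hvw.mono fun z hz => by rw [hz]
  refine ⟨(cylinder T Ω).indicator fun z => ‖w z‖ₑ,
    hwm.enorm.indicator hcyl, ?_, fun z hz => indicator_of_notMem hz _,
    fun p q => ?_⟩
  · filter_upwards [hae, ae_restrict_mem hcyl] with z hz hzm
    rw [indicator_of_mem hzm, hz]
  · have h1 : ∀ t : ℝ, eLpNorm (fun x => (cylinder T Ω).indicator (fun z => ‖w z‖ₑ) (t, x)) p
        volume = (Ioo 0 T).indicator
          (fun t => eLpNorm (fun x => ‖w (t, x)‖ₑ) p (volume.restrict Ω)) t := by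
      intro t
      by_cases ht : t ∈ Ioo 0 T
      · rw [indicator_of_mem ht, ← eLpNorm_indicator_eq_eLpNorm_restrict hΩ]
        congr 1
        ext x
        by_cases hx : x ∈ Ω
        · rw [indicator_of_mem hx, indicator_of_mem (by exact ⟨ht, hx⟩)]
        · rw [indicator_of_notMem hx, indicator_of_notMem (fun h => hx h.2)]
      · rw [indicator_of_notMem ht]
        have : (fun x => (cylinder T Ω).indicator (fun z => ‖w z‖ₑ) (t, x))
            = fun _ => 0 := by
          ext x
          exact indicator_of_notMem (fun h => ht h.1) _
        rw [this]
        exact eLpNorm_zero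
    unfold mixed mixedNorm
    simp only [h1]
    have h2 : (fun t => (Ioo 0 T).indicator
          (fun t => eLpNorm (fun x => ‖w (t, x)‖ₑ) p (volume.restrict Ω)) t)
        = (Ioo 0 T).indicator
          (fun t => eLpNorm (fun x => ‖w (t, x)‖ₑ) p (volume.restrict Ω)) := rfl
    rw [h2, eLpNorm_indicator_eq_eLpNorm_restrict measurableSet_Ioo]
    refine eLpNorm_congr_ae ?_
    have h3 := hvw
    have h4 : (volume : Measure (ℝ × Space d)).restrict (cylinder T Ω)
        = (volume.restrict (Ioo 0 T)).prod (volume.restrict Ω) := by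
      rw [Measure.prod_restrict, ← Measure.volume_eq_prod]; rfl
    unfold Filter.EventuallyEq at h3
    rw [h4] at h3
    filter_upwards [Measure.ae_ae_of_ae_prod h3] with t ht
    refine eLpNorm_congr_enorm_ae (ht.mono fun x hx => ?_)
    rw [hx, enorm_enorm]

theorem lintegral_closedBall_ne_top (hp : 1 ≤ p) (hq : 1 ≤ q) {V : ℝ × Space d → ℝ≥0∞}
    (hV : Measurable V) (h : mixed p q V ≠ ∞) (R : ℝ) : ∫⁻ z in Metric.closedBall 0 R, V z ≠ ∞ := by
  have hN := measurable_eLpNorm_slice (ν := (volume : Measure (Space d))) hV p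
  set S : Set ℝ := Metric.closedBall 0 R
  set B : Set (Space d) := Metric.closedBall 0 R
  have hS : volume S ≠ ∞ := (isCompact_closedBall _ _).measure_lt_top.ne
  have hB : volume B ≠ ∞ := (isCompact_closedBall _ _).measure_lt_top.ne
  have hexp : ∀ {r : ℝ≥0∞}, 1 ≤ r → 0 ≤ 1 / (1 : ℝ≥0∞).toReal - 1 / r.toReal := fun {r} hr => by
    have := inv_toReal_le_one hr
    rw [ENNReal.toReal_inv] at this
    simpa using this
  have hin : ∀ t, ∫⁻ x in B, V (t, x) ≤ eLpNorm (fun x => V (t, x)) p volume *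
      volume B ^ (1 / (1 : ℝ≥0∞).toReal - 1 / p.toReal) := fun t => by
    have h1 := eLpNorm_le_eLpNorm_mul_rpow_measure_univ (μ := volume.restrict B) hp
      (f := fun x => V (t, x)) (hV.comp measurable_prodMk_left).aestronglyMeasurable
    rw [eLpNorm_one_eq_lintegral_enorm, Measure.restrict_apply_univ] at h1
    simp only [enorm_eq_self] at h1
    exact h1.trans (by
      gcongr; exact Measure.restrict_le_self)
  have hout : ∫⁻ t in S, eLpNorm (fun x => V (t, x)) p volume ≤ mixed p q V *
      volume S ^ (1 / (1 : ℝ≥0∞).toReal - 1 / q.toReal) := by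
    have h1 := eLpNorm_le_eLpNorm_mul_rpow_measure_univ (μ := volume.restrict S) hq
      hN.aestronglyMeasurable
    rw [eLpNorm_one_eq_lintegral_enorm, Measure.restrict_apply_univ] at h1
    simp only [enorm_eq_self] at h1
    exact h1.trans (by
      gcongr
      exact eLpNorm_mono_measure (fun t => eLpNorm (fun x => V (t, x)) p volume)
        Measure.restrict_le_self)
  have e : (Metric.closedBall 0 R : Set (ℝ × Space d)) = S ×ˢ B := (closedBall_prod_same 0 0 R).symm
  rw [e, Measure.volume_eq_prod, ← Measure.prod_restrict, lintegral_prod _ hV.aemeasurable]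
  refine ne_top_of_le_ne_top ?_ (lintegral_mono hin)
  rw [lintegral_mul_const _ hN]
  have h1 := ENNReal.rpow_ne_top_of_nonneg (hexp hp) hB
  have h2 := ENNReal.rpow_ne_top_of_nonneg (hexp hq) hS
  exact ENNReal.mul_ne_top (ne_top_of_le_ne_top (ENNReal.mul_ne_top h h2) hout) h1

end MixedNorms

/-! ### Translation of the exponent conditions into real numbers. -/

section Exponents

variable {d m : ℕ} {p q p₀ q₀ : ℝ≥0∞}

theorem toReal_div_add_div (d : ℕ) (hp : 1 ≤ p) (hq : 1 ≤ q) :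
    (d : ℝ≥0∞) / p + 2 / q ≠ ∞ ∧
      ((d : ℝ≥0∞) / p + 2 / q).toReal = d * p⁻¹.toReal + 2 * q⁻¹.toReal := by
  have h1 : p⁻¹ ≠ ∞ := by simpa using (zero_lt_one.trans_le hp).ne'
  have h2 : q⁻¹ ≠ ∞ := by simpa using (zero_lt_one.trans_le hq).ne'
  simp only [div_eq_mul_inv]
  refine ⟨by finiteness, ?_⟩
  rw [ENNReal.toReal_add (by finiteness) (by finiteness)]
  simp

/-- The number `n` is the order of the potential: `1` for the gradient and `g`, `2` for the `f_k`.
-/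
theorem parabolic_exponents_le (n : ℕ) (hp : 1 ≤ p) (hq : 1 ≤ q) (hp₀ : 1 ≤ p₀) (hq₀ : 1 ≤ q₀)
    (h : (d : ℝ≥0∞) / p + 2 / q ≤ n + d / p₀ + 2 / q₀) :
    d * (p⁻¹.toReal - p₀⁻¹.toReal) + 2 * (q⁻¹.toReal - q₀⁻¹.toReal) ≤ n ∧
      (d * (p⁻¹.toReal - p₀⁻¹.toReal) + 2 * (q⁻¹.toReal - q₀⁻¹.toReal) = n →
        (d : ℝ≥0∞) / p + 2 / q = n + d / p₀ + 2 / q₀) := by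
  obtain ⟨h1, h2⟩ := toReal_div_add_div d hp hq
  obtain ⟨h3, h4⟩ := toReal_div_add_div d hp₀ hq₀
  rw [add_assoc] at h ⊢
  have h5 : (n : ℝ≥0∞) + (d / p₀ + 2 / q₀) ≠ ∞ := by finiteness
  have h6 : ((n : ℝ≥0∞) + (d / p₀ + 2 / q₀)).toReal
      = n + (d * p₀⁻¹.toReal + 2 * q₀⁻¹.toReal) := by
    rw [ENNReal.toReal_add (by finiteness) h3, h4, ENNReal.toReal_natCast]
  constructor
  · have := ENNReal.toReal_mono h5 h
    rw [h2, h6] at this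
    linarith
  · intro he
    rw [← ENNReal.toReal_eq_toReal_iff' h1 h5, h2, h6]
    linarith

/-- In the case of equality `p₀ = ∞` forces `p = d`. This is excluded for `d ≥ 2` and means `p = 1`
for `d = 1`, so every other critical case is in the Hardy–Littlewood–Sobolev range. -/
theorem CondEqual.exponents [NeZero d] (hp : 1 ≤ p) (hp₀ : p ≤ p₀) (h : CondEqual d p q p₀ q₀) :
    d * (p⁻¹.toReal - p₀⁻¹.toReal) ≤ 1 ∧
      (d * (p⁻¹.toReal - p₀⁻¹.toReal) = 1 → p ≠ 1 → 1 < p ∧ p < p₀ ∧ p₀ < ∞) := by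
  obtain ⟨-, h2, h3⟩ := h
  have hi : p⁻¹ ≠ ∞ := by simpa using (zero_lt_one.trans_le hp).ne'
  have hi0 : p₀⁻¹ ≠ ∞ := by simpa using (zero_lt_one.trans_le (hp.trans hp₀)).ne'
  refine ⟨?_, fun he hp1 => ⟨lt_of_le_of_ne hp hp1.symm, lt_of_le_of_ne hp₀ ?_, ?_⟩⟩
  · simp only [div_eq_mul_inv] at h2
    have := ENNReal.toReal_mono (by finiteness) h2
    rw [ENNReal.toReal_add (by finiteness) (by finiteness)] at this
    simp at this
    simp only [ENNReal.toReal_inv]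
    linarith
  · rintro rfl
    simp at he
  · rw [lt_top_iff_ne_top]
    rintro rfl
    simp only [ENNReal.inv_top, ENNReal.toReal_zero, sub_zero, ENNReal.toReal_inv] at he
    have hd : p.toReal = d := by
      have : p.toReal ≠ 0 := by rintro h0; simp [h0] at he
      field_simp at he
      exact he.symm
    have hpt : p ≠ ∞ := by
      rintro rfl
      simp at he
    have hpd : p = d := by
      rw [← ENNReal.toReal_eq_toReal_iff' hpt (by finiteness), hd, ENNReal.toReal_natCast]
    refine h3 ⟨?_, hpd, rfl⟩
    have := Nat.pos_of_ne_zero (NeZero.ne d)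
    by_contra hlt
    have : d = 1 := by omega
    subst this
    exact hp1 (by simpa using hpd)

end Exponents

/-! ### Uniform bounds for mollifications and passage to the limit. -/

section Embedding

variable {d m : ℕ} [NeZero d] {σ : ℝ} {p q p₀ q₀ : ℝ≥0∞} {pk qk : Fin m → ℝ≥0∞}

/-- Estimate of the mollifications if the exponent in time is raised. -/
theorem exists_mollify_bound_of_condGreater (hσ : σ = 1 ∨ σ = -1) {θ : ℝ × Space d → ℝ}
    (hθ : IsProfile σ θ) (hp : 1 ≤ p) (hq : 1 ≤ q) (hp₀ : p ≤ p₀) (hq₀ : q ≤ q₀)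
    (h : CondGreater d p q p₀ q₀ pk qk) {L : ℝ} (hL : 0 < L) :
    ∃ N : ℝ≥0, ∀ (T : ℝ) (Ω : Set (Space d)), (Ω = univ ∨ Ω = halfSpace d) →
      ∀ (u : ℝ × Space d → ℝ) (w g : ℝ × Space d → Space d) (f : Fin m → ℝ × Space d → ℝ),
      IsWeakSpatialGradient T Ω u w → SolvesDistrib T Ω u g f →
      ∀ (U W H : ℝ × Space d → ℝ≥0∞) (F : Fin m → ℝ × Space d → ℝ≥0∞),
      Measurable U → Measurable W → Measurable H → (∀ k, Measurable (F k)) →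
      (∀ᵐ z ∂(volume.restrict (cylinder T Ω)), ‖u z‖ₑ ≤ U z) →
      (∀ᵐ z ∂(volume.restrict (cylinder T Ω)), ‖w z‖ₑ ≤ W z) →
      (∀ᵐ z ∂(volume.restrict (cylinder T Ω)), ‖g z‖ₑ ≤ H z) →
      (∀ k, ∀ᵐ z ∂(volume.restrict (cylinder T Ω)), ‖f k z‖ₑ ≤ F k z) →
      ∀ l : ℝ, 0 < l → l ≤ L → ∃ B : ℝ × Space d → ℝ≥0∞, Measurable B ∧
      (∀ z₀, Admissible σ T Ω z₀ (L ^ 2) →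
        ‖∫ z in cylinder T Ω, u z * scaled θ (l ^ 2) l (z₀ - z)‖ₑ ≤ B z₀) ∧
      mixed p₀ q₀ B ≤ N * (mixed p q U + mixed p q W + mixed p q H
        + ∑ k, mixed (pk k) (qk k) (F k)) := by
  have hp1 := hp.trans hp₀
  have hq1 := hq.trans hq₀
  obtain ⟨C, hC⟩ := isKernelFamily_spaceKernel (d := d)
  obtain ⟨K, hK⟩ := parabolic_pointwise hσ hθ
  obtain ⟨NU, hNU⟩ := mixed_avg_le hC hσ hp hp₀ hq hq₀ hL
  obtain ⟨e1, e2⟩ := parabolic_exponents_le (d := d) 1 hp hq hp1 hq1 (by exact_mod_cast h.le)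
  simp only [Nat.cast_one] at e1 e2
  obtain ⟨NW, hNW⟩ := mixed_potential_le hC hσ hp hp₀ hq hq₀ e1
    (fun he => Or.inr (h.borderline (e2 he))) hL
  have hk : ∀ k, ∃ N : ℝ≥0, ∀ V : ℝ × Space d → ℝ≥0∞, Measurable V →
      mixed p₀ q₀ (fun z => ∫⁻ l in Ioo 0 L, ENNReal.ofReal (l ^ ((2 : ℝ) - 1)) *
        avg σ V (l ^ 2) l z) ≤ N * mixed (pk k) (qk k) V := by
    intro k
    obtain ⟨e3, e4⟩ := parabolic_exponents_le (d := d) 2 (h.pk_mem k).1 (h.qk_mem k).1 hp1 hq1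
      (by exact_mod_cast h.le_k k)
    simp only [Nat.cast_ofNat] at e3 e4
    exact mixed_potential_le hC hσ (h.pk_mem k).1 (h.pk_mem k).2 (h.qk_mem k).1 (h.qk_mem k).2 e3
      (fun he => h.borderline_k k (e4 he)) hL
  choose NF hNF using hk
  set M : ℝ≥0 := NU + NW + ∑ k, NF k with hM
  refine ⟨K * M, fun T Ω hΩ u w g f hu hf U W H F hUm hWm hHm hFm hU hW hH hF l hl hlL => ?_⟩
  -- Order `1` is used for `W` and `H`. The `F k` have order `2` because of their extra weight `l`.
  let P : ℝ → (ℝ × Space d → ℝ≥0∞) → ℝ × Space d → ℝ≥0∞ := fun e V z =>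
    ∫⁻ l in Ioo 0 L, ENNReal.ofReal (l ^ (e - 1)) * avg σ V (l ^ 2) l z
  have hPm : ∀ e {V : ℝ × Space d → ℝ≥0∞}, Measurable V → Measurable (P e V) := by
    intro e V hV
    refine Measurable.lintegral_prod_right' (f := fun c : (ℝ × Space d) × ℝ =>
      ENNReal.ofReal (c.2 ^ (e - 1)) * avg σ V (c.2 ^ 2) c.2 (c.1.1, c.1.2))
      (Measurable.mul (by fun_prop) (measurable_avg hV ?_ ?_ ?_ ?_)) <;> fun_prop
  have hUa : Measurable (avg σ U (L ^ 2) L) :=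
    measurable_avg hUm measurable_const measurable_const measurable_fst measurable_snd
  have hS : Measurable fun z => ∑ k, P 2 (F k) z :=
    Finset.measurable_sum _ fun k _ => hPm 2 (hFm k)
  have hWH : Measurable fun z => P 1 W z + P 1 H z := (hPm 1 hWm).add (hPm 1 hHm)
  have hBm : Measurable fun z => avg σ U (L ^ 2) L z + ((P 1 W z + P 1 H z) + ∑ k, P 2 (F k) z) :=
    hUa.add (hWH.add hS)
  refine ⟨fun z => K * (avg σ U (L ^ 2) L z + ((P 1 W z + P 1 H z) + ∑ k, P 2 (F k) z)),
    hBm.const_mul _, ?_, ?_⟩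
  · intro z₀ hz₀
    refine (hK T Ω hΩ m u w g f hu hf U W H F hU hW hH hF z₀ l L hl hlL hz₀).trans ?_
    have hma : ∀ {V : ℝ × Space d → ℝ≥0∞}, Measurable V →
        Measurable fun l => avg σ V (l ^ 2) l z₀ := fun hV =>
      measurable_avg hV (by fun_prop) measurable_id (h := fun _ => z₀.1) (k := fun _ => z₀.2)
        measurable_const measurable_const
    refine mul_le_mul_right (add_le_add le_rfl ?_) _
    have hmWH : Measurable fun l => avg σ W (l ^ 2) l z₀ + avg σ H (l ^ 2) l z₀ :=
      (hma hWm).add (hma hHm)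
    rw [lintegral_add_left hmWH, lintegral_add_left (hma hWm)]
    refine le_of_eq ?_
    congr 1
    · simp [P]
    · simp only [P, Finset.mul_sum]
      have hmF : ∀ k, Measurable fun l => ENNReal.ofReal l * avg σ (F k) (l ^ 2) l z₀ := fun k =>
        Measurable.mul (by fun_prop) (hma (hFm k))
      rw [lintegral_finsetSum _ fun k _ => hmF k]
      refine Finset.sum_congr rfl fun k _ => lintegral_congr fun l => ?_
      norm_num
  · rw [mixed_const_mul hBm, ENNReal.coe_mul, mul_assoc]
    gcongr
    have hNUM : NU ≤ M := by
      rw [hM, add_assoc]; exact le_self_add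
    have hNWM : NW ≤ M := le_trans le_add_self le_self_add
    have hNFM : ∀ k, NF k ≤ M := fun k =>
      (Finset.single_le_sum (fun _ _ => zero_le) (Finset.mem_univ k)).trans le_add_self
    calc mixed p₀ q₀ _ ≤ mixed p₀ q₀ (avg σ U (L ^ 2) L)
          + ((mixed p₀ q₀ (P 1 W) + mixed p₀ q₀ (P 1 H)) + ∑ k, mixed p₀ q₀ (P 2 (F k))) := by
          refine (mixed_add_le hp1 hq1 hUa (hWH.add hS)).trans ?_
          gcongr
          refine (mixed_add_le hp1 hq1 hWH hS).trans ?_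
          gcongr
          · exact mixed_add_le hp1 hq1 (hPm 1 hWm) (hPm 1 hHm)
          · exact mixed_sum_le _ hp1 hq1 fun k => hPm 2 (hFm k)
      _ ≤ M * mixed p q U + ((M * mixed p q W + M * mixed p q H)
          + ∑ k, M * mixed (pk k) (qk k) (F k)) := by
          gcongr with k
          · exact (hNU U hUm).trans (by gcongr)
          · exact (hNW W hWm).trans (by gcongr)
          · exact (hNW H hHm).trans (by gcongr)
          · exact (hNF k (F k) (hFm k)).trans (by gcongr; exact hNFM k)
      _ = _ := by rw [← Finset.mul_sum]; ring

/-- Estimate of the mollifications if the exponent in time is not raised. -/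
theorem exists_mollify_bound_of_condEqual (hσ : σ = 1 ∨ σ = -1) {θ : ℝ × Space d → ℝ}
    (hθ : IsProfile σ θ) (hp : 1 ≤ p) (hq : 1 ≤ q) (hp₀ : p ≤ p₀)
    (h : CondEqual d p q p₀ q₀) {L : ℝ} (hL : 0 < L) :
    ∃ N : ℝ≥0, ∀ (T : ℝ) (Ω : Set (Space d)), (Ω = univ ∨ Ω = halfSpace d) →
      ∀ (u : ℝ × Space d → ℝ) (w : ℝ × Space d → Space d), IsWeakSpatialGradient T Ω u w →
      ∀ U W : ℝ × Space d → ℝ≥0∞, Measurable U → Measurable W →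
      (∀ᵐ z ∂(volume.restrict (cylinder T Ω)), ‖u z‖ₑ ≤ U z) →
      (∀ᵐ z ∂(volume.restrict (cylinder T Ω)), ‖w z‖ₑ ≤ W z) →
      ∀ l : ℝ, 0 < l → l ≤ L → ∃ B : ℝ × Space d → ℝ≥0∞, Measurable B ∧
      (∀ z₀, Admissible σ T Ω z₀ (L ^ 2) →
        ‖∫ z in cylinder T Ω, u z * scaled θ (l ^ 2) l (z₀ - z)‖ₑ ≤ B z₀) ∧
      mixed p₀ q₀ B ≤ N * (mixed p q U + mixed p q W) := by
  obtain ⟨e1, e2⟩ := h.exponents hp hp₀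
  obtain rfl := h.1
  have hp1 := hp.trans hp₀
  -- Critical exponents with `p = 1` need the line argument, including `d = 1`, `p₀ = ∞`. All other
  -- cases go through potentials in space.
  by_cases hcrit : p = 1 ∧ d * (p⁻¹.toReal - p₀⁻¹.toReal) = 1
  · obtain ⟨rfl, he⟩ := hcrit
    obtain ⟨N, hN⟩ := exists_mollify_bound_of_lines hσ hθ hp1 (by simpa using he) hq
    refine ⟨N, fun T Ω hΩ u w hu U W hUm hWm hU hW l hl hlL => ?_⟩
    obtain ⟨B, hB, hB1, hB2⟩ := hN T Ω hΩ u w hu U W hUm hWm hU hW (l ^ 2) l (by positivity) hl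
    exact ⟨B, hB, fun z₀ hz₀ => hB1 z₀ (hz₀.mono hσ (by positivity) (by gcongr)), hB2⟩
  · obtain ⟨C, hC⟩ := isKernelFamily_spaceKernel (d := d)
    obtain ⟨K, hK⟩ := elliptic_pointwise hσ hθ
    obtain ⟨NU, hNU⟩ := mixed_avg_le_uniform hC hσ hp hp₀ hq hL
    obtain ⟨NW, hNW⟩ := mixed_potential_le_uniform hC hσ hp hp₀ hq e1
      (fun he => e2 he fun h1 => hcrit ⟨h1, he⟩) hL
    refine ⟨K * (NU + NW), fun T Ω hΩ u w hu U W hUm hWm hU hW l hl hlL => ?_⟩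
    have hl2 : 0 < l ^ 2 := by positivity
    have hUa : Measurable (avg σ U (l ^ 2) L) :=
      measurable_avg hUm measurable_const measurable_const measurable_fst measurable_snd
    have hPm : Measurable fun z : ℝ × Space d => ∫⁻ s in Ioo 0 L, avg σ W (l ^ 2) s z := by
      refine Measurable.lintegral_prod_right' (f := fun c : (ℝ × Space d) × ℝ =>
        avg σ W (l ^ 2) c.2 (c.1.1, c.1.2)) (measurable_avg hWm ?_ ?_ ?_ ?_) <;> fun_prop
    have hBm : Measurable fun z => avg σ U (l ^ 2) L z + ∫⁻ s in Ioo 0 L, avg σ W (l ^ 2) s z :=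
      hUa.add hPm
    refine ⟨fun z => K * (avg σ U (l ^ 2) L z + ∫⁻ s in Ioo 0 L, avg σ W (l ^ 2) s z),
      hBm.const_mul _, fun z₀ hz₀ => ?_, ?_⟩
    -- The time scale stays at `l ^ 2` while the space scale runs from `l` to `L`. As `l` tends to
    -- zero the time scale shrinks, so bounds uniform in it are essential.
    · exact hK T Ω hΩ u w hu U W hU hW z₀ (l ^ 2) l L hl2 hl hlL
        (hz₀.mono hσ (by positivity) (by gcongr))
    · rw [mixed_const_mul hBm, ENNReal.coe_mul, mul_assoc]
      gcongr
      refine (mixed_add_le hp1 hq hUa hPm).trans ?_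
      rw [mul_add]
      gcongr
      · exact (hNU _ hl2 U hUm).trans (by gcongr; exact le_self_add)
      · exact (hNW _ hl2 W hWm).trans (by gcongr; exact le_add_self)

/-- Passage to the limit in an estimate of the mollifications. -/
theorem mixed_indicator_le_of_mollify_bound (hσ : σ = 1 ∨ σ = -1) {θ : ℝ × Space d → ℝ}
    (hθ : IsProfile σ θ) (hθ1 : ∫ z, θ z = 1) {T : ℝ} {Ω : Set (Space d)}
    (hΩ : Ω = univ ∨ Ω = halfSpace d) {u : ℝ × Space d → ℝ} {U : ℝ × Space d → ℝ≥0∞}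
    (hUm : Measurable U) (hu : AEStronglyMeasurable u (volume.restrict (cylinder T Ω)))
    (hU : ∀ᵐ z ∂(volume.restrict (cylinder T Ω)), ‖u z‖ₑ = U z) (hp : 1 ≤ p) (hq : 1 ≤ q)
    (hfin : mixed p q U ≠ ∞) {L : ℝ} (hL : 0 < L) {A : ℝ≥0∞}
    (hB : ∀ l : ℝ, 0 < l → l ≤ L → ∃ B : ℝ × Space d → ℝ≥0∞, Measurable B ∧
      (∀ z₀, Admissible σ T Ω z₀ (L ^ 2) →
        ‖∫ z in cylinder T Ω, u z * scaled θ (l ^ 2) l (z₀ - z)‖ₑ ≤ B z₀) ∧ mixed p₀ q₀ B ≤ A) :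
    mixed p₀ q₀ ({z | Admissible σ T Ω z (L ^ 2)}.indicator U) ≤ A := by
  have hcyl := measurableSet_cylinder (T := T) hΩ
  have hadm : ({z | Admissible σ T Ω z (L ^ 2)} : Set (ℝ × Space d)) =
      cylinder T Ω ∩ {z | z.1 - 2 * σ * L ^ 2 ∈ Ioo 0 T} := by
    ext z
    exact ⟨fun h => ⟨⟨h.time, h.space⟩, h.time'⟩, fun h => ⟨h.1.2, h.1.1, h.2⟩⟩
  have hQ : MeasurableSet ({z | Admissible σ T Ω z (L ^ 2)} : Set (ℝ × Space d)) := by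
    rw [hadm]
    refine hcyl.inter (measurableSet_preimage (f := fun z : ℝ × Space d => z.1 - 2 * σ * L ^ 2)
      (by fun_prop) measurableSet_Ioo)
  set Q : Set (ℝ × Space d) := {z | Admissible σ T Ω z (L ^ 2)} 
  have hint : ∀ R : ℝ, IntegrableOn u (cylinder T Ω ∩ Metric.closedBall 0 R) := by
    intro R
    refine ⟨hu.mono_measure (Measure.restrict_mono inter_subset_left le_rfl), ?_⟩
    have h1 : ∀ᵐ z ∂(volume.restrict (cylinder T Ω ∩ Metric.closedBall 0 R)), ‖u z‖ₑ = U z :=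
      ae_mono (Measure.restrict_mono inter_subset_left le_rfl) hU
    rw [hasFiniteIntegral_iff_enorm, lintegral_congr_ae h1]
    exact (lintegral_mono_set inter_subset_right).trans_lt
      (lintegral_closedBall_ne_top hp hq hUm hfin R).lt_top
  -- Fatou's lemma is used twice: on a bounded part along a sequence of scales, shifted by `n₀` so
  -- that all of them are at most `L`, and then for an exhaustion by balls.
  have hball : ∀ R : ℝ, mixed p₀ q₀ ((Q ∩ Metric.closedBall 0 R).indicator U) ≤ A := by
    intro R
    obtain ⟨l, hl0, hl, hae⟩ := exists_seq_tendsto_mollify hσ hθ hθ1 hcyl hint R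
    obtain ⟨n₀, hn₀⟩ := eventually_atTop.1 (hl.eventually_le_const hL)
    choose B hBm hB1 hB2 using fun n => hB (l (n + n₀)) (hl0 _) (hn₀ _ (Nat.le_add_left _ _))
    refine mixed_le_of_le_liminf hBm ?_ hB2
    filter_upwards [hae, (ae_restrict_iff' hcyl).1 hU] with z hz hzU
    by_cases hzQ : z ∈ Q ∩ Metric.closedBall 0 R
    · have hzc : z ∈ cylinder T Ω := by
        have h := hzQ.1
        rw [hadm] at h
        exact h.1
      rw [indicator_of_mem hzQ, ← hzU hzc]
      have h1 := (((continuous_enorm.tendsto _).comp (hz ⟨hzc, hzQ.2⟩)).comp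
        (tendsto_add_atTop_nat n₀)).liminf_eq
      rw [← h1]
      exact liminf_le_liminf (Eventually.of_forall fun n => hB1 n z hzQ.1)
    · rw [indicator_of_notMem hzQ]
      exact zero_le
  refine mixed_le_of_le_liminf (H := fun n : ℕ => (Q ∩ Metric.closedBall 0 (n : ℝ)).indicator U)
    (fun n => hUm.indicator (hQ.inter Metric.isClosed_closedBall.measurableSet))
    (Eventually.of_forall fun z => ?_) fun n => hball n
  refine le_liminf_of_le (by isBoundedDefault) ?_
  obtain ⟨n₀, hn₀⟩ := exists_nat_ge ‖z‖
  filter_upwards [eventually_ge_atTop n₀] with n hn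
  have hmem : z ∈ Metric.closedBall (0 : ℝ × Space d) (n : ℝ) := by
    rw [mem_closedBall_zero_iff]
    exact hn₀.trans (by exact_mod_cast hn)
  by_cases hz : z ∈ Q
  · rw [indicator_of_mem hz, indicator_of_mem (by exact ⟨hz, hmem⟩)]
  · rw [indicator_of_notMem hz]
    exact zero_le

/-- The estimate on the part of the cylinder in which the mollifiers in the time direction `σ` are
admissible. -/
theorem exists_mixed_indicator_le (hσ : σ = 1 ∨ σ = -1) (hp : 1 ≤ p) (hq : 1 ≤ q) (hp₀ : p ≤ p₀)
    (hq₀ : q ≤ q₀) (hcond : CondEqual d p q p₀ q₀ ∨ CondGreater d p q p₀ q₀ pk qk)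
    {L : ℝ} (hL : 0 < L) :
    ∃ N : ℝ≥0, ∀ (T : ℝ) (Ω : Set (Space d)), (Ω = univ ∨ Ω = halfSpace d) →
      ∀ (u : ℝ × Space d → ℝ) (w g : ℝ × Space d → Space d) (f : Fin m → ℝ × Space d → ℝ),
      MemW10 T Ω p q u w → MemMixed T Ω p q g → (∀ k, MemMixed T Ω (pk k) (qk k) (f k)) →
      SolvesDistrib T Ω u g f → ∀ U : ℝ × Space d → ℝ≥0∞, Measurable U →
      (∀ᵐ z ∂(volume.restrict (cylinder T Ω)), ‖u z‖ₑ = U z) →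
      mixedNorm T Ω p q u = mixed p q U →
      mixed p₀ q₀ ({z | Admissible σ T Ω z (L ^ 2)}.indicator U) ≤
        N * (normW10 T Ω p q u w + mixedNorm T Ω p q g
          + ∑ k, mixedNorm T Ω (pk k) (qk k) (f k)) := by
  obtain ⟨θ, hθ, hθ1⟩ := exists_profile (d := d) hσ
  have key : ∃ N : ℝ≥0, ∀ (T : ℝ) (Ω : Set (Space d)), (Ω = univ ∨ Ω = halfSpace d) →
      ∀ (u : ℝ × Space d → ℝ) (w g : ℝ × Space d → Space d) (f : Fin m → ℝ × Space d → ℝ),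
      IsWeakSpatialGradient T Ω u w → SolvesDistrib T Ω u g f →
      ∀ (U W H : ℝ × Space d → ℝ≥0∞) (F : Fin m → ℝ × Space d → ℝ≥0∞),
      Measurable U → Measurable W → Measurable H → (∀ k, Measurable (F k)) →
      (∀ᵐ z ∂(volume.restrict (cylinder T Ω)), ‖u z‖ₑ ≤ U z) →
      (∀ᵐ z ∂(volume.restrict (cylinder T Ω)), ‖w z‖ₑ ≤ W z) →
      (∀ᵐ z ∂(volume.restrict (cylinder T Ω)), ‖g z‖ₑ ≤ H z) →
      (∀ k, ∀ᵐ z ∂(volume.restrict (cylinder T Ω)), ‖f k z‖ₑ ≤ F k z) →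
      ∀ l : ℝ, 0 < l → l ≤ L → ∃ B : ℝ × Space d → ℝ≥0∞, Measurable B ∧
      (∀ z₀, Admissible σ T Ω z₀ (L ^ 2) →
        ‖∫ z in cylinder T Ω, u z * scaled θ (l ^ 2) l (z₀ - z)‖ₑ ≤ B z₀) ∧
      mixed p₀ q₀ B ≤ N * (mixed p q U + mixed p q W + mixed p q H
        + ∑ k, mixed (pk k) (qk k) (F k)) := by
    rcases hcond with h | h
    · obtain ⟨N, hN⟩ := exists_mollify_bound_of_condEqual hσ hθ hp hq hp₀ h hL
      refine ⟨N, fun T Ω hΩ u w _ _ hu _ U W _ _ hUm hWm _ _ hU hW _ _ l hl hlL => ?_⟩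
      obtain ⟨B, h1, h2, h3⟩ := hN T Ω hΩ u w hu U W hUm hWm hU hW l hl hlL
      refine ⟨B, h1, h2, h3.trans ?_⟩
      rw [add_assoc (mixed p q U + mixed p q W)]
      exact mul_le_mul_right le_self_add _
    · exact exists_mollify_bound_of_condGreater hσ hθ hp hq hp₀ hq₀ h hL
  obtain ⟨N, hN⟩ := key
  refine ⟨N, fun T Ω hΩ u w g f hu hg hf hs U hUm hU hUeq => ?_⟩
  have hΩm : MeasurableSet Ω := by
    rcases hΩ with rfl | rfl
    · exact MeasurableSet.univ
    · exact measurableSet_lt measurable_const (by fun_prop)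
  obtain ⟨W, hWm, hW, -, hWeq⟩ := exists_extension hΩm hu.memMixed_grad.1
  obtain ⟨H, hHm, hH, -, hHeq⟩ := exists_extension hΩm hg.1
  choose F hFm hF _ hFeq using fun k => exists_extension hΩm (hf k).1
  simp only [normW10, hUeq, hWeq, hHeq, hFeq]
  refine mixed_indicator_le_of_mollify_bound hσ hθ hθ1 hΩ hUm hu.memMixed.1 hU hp hq
    (hUeq ▸ hu.memMixed.2.ne) hL ?_
  exact hN T Ω hΩ u w g f hu.isWeakSpatialGradient hs U W H F hUm hWm hHm hFm
    (hU.mono fun _ h => h.le) (hW.mono fun _ h => h.le) (hH.mono fun _ h => h.le)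
    fun k => (hF k).mono fun _ h => h.le

end Embedding

end ParabolicEmbedding

/-! ### Combination of the two time directions. -/

theorem theorem5p5 (d : ℕ) [NeZero d] (m : ℕ) (T : ℝ) (hT : 0 < T)
    (p q p₀ q₀ : ℝ≥0∞) (pk qk : Fin m → ℝ≥0∞)
    (hp : 1 ≤ p) (hq : 1 ≤ q) (hp₀ : p ≤ p₀) (hq₀ : q ≤ q₀)
    (hpk : ∀ k, 0 < pk k) (hqk : ∀ k, 0 < qk k)
    (hcond : CondEqual d p q p₀ q₀ ∨ CondGreater d p q p₀ q₀ pk qk) :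
    ∃ N : ℝ≥0, ∀ Ω : Set (Space d), Ω = univ ∨ Ω = halfSpace d →
      ∀ (u : ℝ × Space d → ℝ) (Du g : ℝ × Space d → Space d) (f : Fin m → ℝ × Space d → ℝ),
        MemW10 T Ω p q u Du →
        MemMixed T Ω p q g →
        (∀ k, MemMixed T Ω (pk k) (qk k) (f k)) →
        SolvesDistrib T Ω u g f →
        mixedNorm T Ω p₀ q₀ u ≤
          N * (normW10 T Ω p q u Du + mixedNorm T Ω p q g
            + ∑ k, mixedNorm T Ω (pk k) (qk k) (f k)) := by
  -- The mollifiers reach `2 L^2 = T/8` in time. Times at or above `T/2` are thus admissible looking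
  -- backwards and times at or below `T/2` looking forwards, and the two indicators together
  -- dominate `U`.
  set L : ℝ := Real.sqrt T / 4 with hLdef
  have hL : 0 < L := by positivity
  have hL2 : L ^ 2 = T / 16 := by
    rw [hLdef, div_pow, Real.sq_sqrt hT.le]; norm_num
  obtain ⟨N₁, hN₁⟩ := exists_mixed_indicator_le (m := m) (Or.inl rfl) hp hq hp₀ hq₀ hcond hL
  obtain ⟨N₂, hN₂⟩ := exists_mixed_indicator_le (m := m) (Or.inr rfl) hp hq hp₀ hq₀ hcond hL
  refine ⟨N₁ + N₂, fun Ω hΩ u Du g f hu hg hf hs => ?_⟩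
  have hΩm : MeasurableSet Ω := by
    rcases hΩ with rfl | rfl
    · exact MeasurableSet.univ
    · exact measurableSet_lt measurable_const (by fun_prop)
  obtain ⟨U, hUm, hU, hU0, hUeq⟩ := exists_extension hΩm hu.memMixed.1
  have h1 := hN₁ T Ω hΩ u Du g f hu hg hf hs U hUm hU (hUeq p q)
  have h2 := hN₂ T Ω hΩ u Du g f hu hg hf hs U hUm hU (hUeq p q)
  have hm : ∀ σ : ℝ, Measurable
      (({z | Admissible σ T Ω z (L ^ 2)} : Set (ℝ × Space d)).indicator U) := by
    intro σ
    refine hUm.indicator ?_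
    have : ({z | Admissible σ T Ω z (L ^ 2)} : Set (ℝ × Space d)) =
        cylinder T Ω ∩ (fun z : ℝ × Space d => z.1 - 2 * σ * L ^ 2) ⁻¹' Ioo 0 T := by
      ext z
      exact ⟨fun h => ⟨⟨h.time, h.space⟩, h.time'⟩, fun h => ⟨h.1.2, h.1.1, h.2⟩⟩
    rw [this]
    exact (measurableSet_cylinder hΩ).inter
      (measurableSet_preimage (by fun_prop) measurableSet_Ioo)
  rw [hUeq, ENNReal.coe_add, add_mul]
  refine le_trans ?_ (add_le_add h1 h2)
  refine (mixed_mono fun z => ?_).trans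
    (mixed_add_le (hp.trans hp₀) (hq.trans hq₀) (hm 1) (hm (-1)))
  by_cases hz : z ∈ cylinder T Ω
  · obtain ⟨⟨hz1, hz2⟩, hz3⟩ := hz
    rcases le_total (T / 2) z.1 with h | h
    · rw [indicator_of_mem (by exact ⟨hz3, ⟨hz1, hz2⟩, by constructor <;> linarith⟩)]
      exact le_self_add
    · rw [add_comm, indicator_of_mem (by exact ⟨hz3, ⟨hz1, hz2⟩, by constructor <;> linarith⟩)]
      exact le_self_add
  · rw [hU0 z hz]
    exact zero_le
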